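/- \textbf{Setting.} An operational-probabilistic theory is given by a symmetric monoidal category whose objects are systems, whose unit object $\mathrm I$ is the trivial system and whose morphisms are transformations. States of $\mathrm A$ are transformations $\mathrm I\to\mathrm A$, effects are transformations $\mathrm A\to\mathrm I$. Certain finite families of transformations are called tests; every transformation belongs to a test; tests are closed under sequential and parallel composition and under coarse-graining; a test with one outcome is called a channel, and the identities and structural isomorphisms are channels. Every scalar $\mathrm I\to\mathrm I$ has a probability, multiplicatively under composition; tests $\mathrm I\to\mathrm I$ are probability distributions, and every $p\in[0,1]$ occurs as the probability of an outcome of such a two-outcome test. Transformations $\mathrm A\to\mathrm B$ that give the same probabilities with every state of $\mathrm A\otimes\mathrm S$ and every effect on $\mathrm B\otimes\mathrm S$, for every $\mathrm S$, are equal; sums and multiples of transformations are read off from these probabilities. Write $(a|\rho)$ for the probability of the effect $a$ on the state $\rho$, and $\mathsf{St}_{\mathbb R}(\mathrm A)$, $\mathsf{Eff}_{\mathbb R}(\mathrm A)$ for the real vector spaces spanned by states and effects (effects being regarded as linear functionals on states); they are finite-dimensional, and the set of states is closed. $\mathsf{St}_+(\mathrm A)$ is the cone generated by the states. Put $\|\rho\|=\sup_a(a|\rho)$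 and $\|a\|=\sup_\rho(a|\rho)$; norm one is called normalised. A transformation is pure if whenever it is the sum of a nonempty subfamily of a test, the members of the subfamily are $p_j$ times it for a probability distribution $(p_j)$. A \emph{sharp theory with purification} is such a theory satisfying: \emph{Causality} (each system has a unique deterministic effect $u$, and tests may be chosen conditionally on earlier outcomes); \emph{Purity Preservation} (sequential and parallel compositions of pure transformations are pure); \emph{Pure Sharpness} (every system has a pure effect occurring with probability one on some state); \emph{Purification} (every normalised state of $\mathrm A$ is the marginal, obtained by applying $u_{\mathrm B}$, of a normalised pure state of some $\mathrm A\otimes\mathrm B$, and two normalised pure states of $\mathrm A\otimes\mathrm B$ with the same marginal on $\mathrm A$ differ by a reversible channel on $\mathrm B$). \textbf{Statement.} Let $\mathrm A$ be a system of a sharp theory with purification. There is a unique linear isomorphism $\dagger:\mathsf{St}_{\mathbb R}(\mathrm A)\to\mathsf{Eff}_{\mathbb R}(\mathrm A)$ that maps the normalised pure states onto the normalised pure effects and sends each normalised pure state $\alpha$ to the unique normalised pure effect $\alpha^\dagger$ with $(\alpha^\dagger|\alpha)=1$. The form $\langle\xi,\eta\rangle:=(\xi^\dagger|\eta)$ is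 a self-dualising inner product on $\mathsf{St}_{\mathbb R}(\mathrm A)$: it is symmetric and positive definite, and $\xi\in\mathsf{St}_+(\mathrm A)$ if and only if $\langle\xi,\eta\rangle\ge 0$ for all $\eta\in\mathsf{St}_+(\mathrm A)$. Let $\{\alpha_i\}_{i=1}^d$ be a maximal set of perfectly distinguishable states of $\mathrm A$, all of them pure (there is an observation-test $\{a_i\}$ with $(a_i|\alpha_j)=\delta_{ij}$, and no further state can be added), let $\mathsf I\subseteq\{1,\dots,d\}$ and $a_{\mathsf I}=\sum_{i\in\mathsf I}\alpha_i^\dagger$, and let $F_{\mathsf I}$, $F_{\mathsf I}^\perp$ be the sets of normalised states $\rho$ with $(a_{\mathsf I}|\rho)=1$, respectively $(a_{\mathsf I}|\rho)=0$. Let $P_{\mathsf I}:\mathrm A\to\mathrm A$ be any projector on $F_{\mathsf I}$, that is, any transformation with $P_{\mathsf I}\rho=\rho$ for $\rho\in F_{\mathsf I}$ and $P_{\mathsf I}\rho=0$ for $\rho\in F_{\mathsf I}^\perp$. Then $$(P_{\mathsf I}\rho)^\dagger=\rho^\dagger P_{\mathsf I}\quad\text{for every normalised state }\rho\text{ of }\mathrm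 A,$$ and $$\langle P_{\mathsf I}\,\xi,\eta\rangle=\langle\xi,P_{\mathsf I}\,\eta\rangle\quad\text{for all }\xi,\eta\in\mathsf{St}_{\mathbb R}(\mathrm A).$$ -/

import Mathlib

open CategoryTheory MonoidalCategory

universe v u

/-- The framework of operational-probabilistic theories with finite systems and closed state spaces.
Systems are the objects of a symmetric monoidal category `C`, transformations are its morphisms,
`𝟙_ C` is the trivial system. States of `A` are morphisms `𝟙_ C ⟶ A`, effects on `A` are morphisms
`A ⟶ 𝟙_ C`, scalars are morphisms `𝟙_ C ⟶ 𝟙_ C`, with associated probabilities `prob`. The remaining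
datum is which finite families of transformations are tests. -/
class OPTData (C : Type u) [Category.{v} C] [MonoidalCategory C] [SymmetricCategory C] where
  IsTest : ∀ {A B : C} {X : Type} [Fintype X], (X → (A ⟶ B)) → Prop
  prob : (𝟙_ C ⟶ 𝟙_ C) → ℝ

namespace OPT

section Data

variable {C : Type u} [Category.{v} C] [MonoidalCategory C] [SymmetricCategory C] [OPTData C]

/-- A finite family of transformations is a test. -/
def IsTest {A B : C} {X : Type} [Fintype X] (f : X → (A ⟶ B)) : Prop := OPTData.IsTest f

/-- The probability associated with a scalar. -/
def prob (p : 𝟙_ C ⟶ 𝟙_ C) : ℝ := OPTData.prob p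

/-- The probability `(E | t ⊗ id_S | ρ)` of the circuit in which `t` acts on the first factor of a
bipartite state `ρ` of `A ⊗ S`, followed by a bipartite effect `E` on `B ⊗ S`. -/
def circuitProb {A B : C} (t : A ⟶ B) (S : C) (ρ : 𝟙_ C ⟶ A ⊗ S) (E : B ⊗ S ⟶ 𝟙_ C) : ℝ :=
  prob (ρ ≫ (t ▷ S) ≫ E)

/-- `t = ∑ j ∈ Z, D j`, as an identity between the statistics of transformations. -/
def IsSum {A B : C} {Y : Type} (t : A ⟶ B) (Z : Finset Y) (D : Y → (A ⟶ B)) : Prop :=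
  ∀ (S : C) (ρ : 𝟙_ C ⟶ A ⊗ S) (E : B ⊗ S ⟶ 𝟙_ C),
    circuitProb t S ρ E = ∑ j ∈ Z, circuitProb (D j) S ρ E

/-- `t' = p • t`, as an identity between the statistics of transformations. -/
def IsMultiple {A B : C} (p : ℝ) (t t' : A ⟶ B) : Prop :=
  ∀ (S : C) (ρ : 𝟙_ C ⟶ A ⊗ S) (E : B ⊗ S ⟶ 𝟙_ C),
    circuitProb t' S ρ E = p * circuitProb t S ρ E

/-- A channel is a deterministic transformation: it forms a test with a single outcome. -/
def IsChannel {A B : C} (t : A ⟶ B) : Prop := IsTest (fun _ : Unit => t)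

/-- The vector of a state: the function sending an effect `a` to `(a|ρ)`. -/
def stFun {A : C} (ρ : 𝟙_ C ⟶ A) : (A ⟶ 𝟙_ C) → ℝ := fun a => prob (ρ ≫ a)

/-- The real vector space `St_ℝ(A)` spanned by the states of `A`. -/
def StR (A : C) : Submodule ℝ ((A ⟶ 𝟙_ C) → ℝ) := Submodule.span ℝ (Set.range stFun)

/-- A state as an element of `St_ℝ(A)`. -/
def stVec {A : C} (ρ : 𝟙_ C ⟶ A) : StR A := ⟨stFun ρ, Submodule.subset_span ⟨ρ, rfl⟩⟩

/-- The linear functional `ξ ↦ (a|ξ)` on `St_ℝ(A)` given by an effect `a`. -/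
def effFun {A : C} (a : A ⟶ 𝟙_ C) : Module.Dual ℝ (StR A) :=
  (LinearMap.proj a).comp (StR A).subtype

/-- The real vector space `Eff_ℝ(A)` spanned by the effects on `A`. -/
def EffR (A : C) : Submodule ℝ (Module.Dual ℝ (StR A)) := Submodule.span ℝ (Set.range effFun)

/-- An effect as an element of `Eff_ℝ(A)`. -/
def effVec {A : C} (a : A ⟶ 𝟙_ C) : EffR A := ⟨effFun a, Submodule.subset_span ⟨a, rfl⟩⟩

/-- The cone `St_+(A)` generated by the states of `A`. -/
def StCone (A : C) : PointedCone ℝ (StR A) := PointedCone.hull ℝ (Set.range stVec)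

theorem act_mem {A B : C} (t : A ⟶ B) (ξ : (A ⟶ 𝟙_ C) → ℝ) (hξ : ξ ∈ StR A) :
    LinearMap.funLeft ℝ ℝ (fun b : B ⟶ 𝟙_ C => t ≫ b) ξ ∈ StR B := by
  refine (Submodule.span_le (p := (StR B).comap
    (LinearMap.funLeft ℝ ℝ (fun b : B ⟶ 𝟙_ C => t ≫ b)))).2 ?_ hξ
  rintro _ ⟨ρ, rfl⟩
  refine Submodule.subset_span ⟨ρ ≫ t, ?_⟩
  funext b
  simp [stFun, LinearMap.funLeft]

/-- The linear map `St_ℝ(A) → St_ℝ(B)` induced by a transformation. -/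
def act {A B : C} (t : A ⟶ B) : StR A →ₗ[ℝ] StR B :=
  (LinearMap.funLeft ℝ ℝ (fun b : B ⟶ 𝟙_ C => t ≫ b)).restrict (act_mem t)

theorem act_stVec {A B : C} (t : A ⟶ B) (ρ : 𝟙_ C ⟶ A) : act t (stVec ρ) = stVec (ρ ≫ t) := by
  apply Subtype.ext
  funext b
  simp [act, stVec, stFun, LinearMap.funLeft]

/-- `‖ρ‖ = sup_a (a|ρ)` for a state. -/
noncomputable def stNorm {A : C} (ρ : 𝟙_ C ⟶ A) : ℝ := ⨆ a : A ⟶ 𝟙_ C, prob (ρ ≫ a)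

/-- `‖a‖ = sup_ρ (a|ρ)` for an effect. -/
noncomputable def effNorm {A : C} (a : A ⟶ 𝟙_ C) : ℝ := ⨆ ρ : 𝟙_ C ⟶ A, prob (ρ ≫ a)

/-- A transformation is pure if each of its refinements is trivial. A refinement of `t` consists of
the transformations `D j`, `j ∈ Z`, where `D` is a test and `Z` a nonempty set of outcomes that is
coarse-grained to `t`. -/
def IsPure {A B : C} (t : A ⟶ B) : Prop :=
  ∀ (Y : Type) [Fintype Y] (D : Y → (A ⟶ B)), IsTest D →
    ∀ Z : Finset Y, Z.Nonempty → IsSum t Z D →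
      ∃ p : Y → ℝ, (∀ j ∈ Z, 0 ≤ p j) ∧ ∑ j ∈ Z, p j = 1 ∧ ∀ j ∈ Z, IsMultiple (p j) t (D j)

/-- Normalised pure states. -/
def IsPureSt₁ {A : C} (ρ : 𝟙_ C ⟶ A) : Prop := IsPure ρ ∧ stNorm ρ = 1

/-- Normalised pure effects. -/
def IsPureEff₁ {A : C} (a : A ⟶ 𝟙_ C) : Prop := IsPure a ∧ effNorm a = 1

/-- A reversible channel. -/
def IsReversible {A B : C} (U : A ≅ B) : Prop := IsChannel U.hom ∧ IsChannel U.inv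

/-- `ρ` is the marginal on `A` of the bipartite state `Ψ`. -/
def IsMarginal {A B : C} (Ψ : 𝟙_ C ⟶ A ⊗ B) (ρ : 𝟙_ C ⟶ A) : Prop :=
  ∃ w : B ⟶ 𝟙_ C, IsChannel w ∧ Ψ ≫ (A ◁ w) ≫ (ρ_ A).hom = ρ

/-- The normalised pure state `Ψ` of `A ⊗ B` is a purification of the state `ρ` of `A`. -/
def IsPurification {A B : C} (Ψ : 𝟙_ C ⟶ A ⊗ B) (ρ : 𝟙_ C ⟶ A) : Prop :=
  IsPureSt₁ Ψ ∧ IsMarginal Ψ ρ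

/-- Perfectly distinguishable states. -/
def PerfectlyDistinguishable {A : C} {X : Type} [Fintype X] [DecidableEq X]
    (ρ : X → (𝟙_ C ⟶ A)) : Prop :=
  ∃ a : X → (A ⟶ 𝟙_ C), IsTest a ∧ ∀ i j, prob (ρ j ≫ a i) = if i = j then 1 else 0

/-- A maximal set of perfectly distinguishable states, all of them pure. -/
def IsPureMaximalSet {A : C} {d : ℕ} (α : Fin d → (𝟙_ C ⟶ A)) : Prop :=
  (∀ i, IsPure (α i)) ∧ PerfectlyDistinguishable α ∧
    ¬ ∃ ρ₀ : 𝟙_ C ⟶ A, PerfectlyDistinguishable (fun o : Option (Fin d) => o.elim ρ₀ α)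

/-- The linear isomorphism `D` between `St_ℝ(A)` and `Eff_ℝ(A)` is the dagger: it restricts to a
correspondence from normalised pure states onto normalised pure effects, sending `α` to the unique
normalised pure effect that occurs with probability one on `α`. -/
def IsDagger {A : C} (D : StR A ≃ₗ[ℝ] EffR A) : Prop :=
  (∀ α : 𝟙_ C ⟶ A, IsPureSt₁ α → ∃ a : A ⟶ 𝟙_ C,
      (IsPureEff₁ a ∧ prob (α ≫ a) = 1) ∧
      (∀ b : A ⟶ 𝟙_ C, IsPureEff₁ b → prob (α ≫ b) = 1 → b = a) ∧
      D (stVec α) = effVec a) ∧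
  ∀ a : A ⟶ 𝟙_ C, IsPureEff₁ a → ∃ α : 𝟙_ C ⟶ A, IsPureSt₁ α ∧ D (stVec α) = effVec a

/-- The bilinear form `⟨ξ, η⟩ = (ξ†|η)`. -/
def daggerForm {A : C} (D : StR A ≃ₗ[ℝ] EffR A) : LinearMap.BilinForm ℝ (StR A) :=
  (EffR A).subtype.comp D.toLinearMap

/-- A bilinear form on `St_ℝ(A)` is a self-dualising inner product. -/
def IsSelfDualisingInner {A : C} (β : LinearMap.BilinForm ℝ (StR A)) : Prop :=
  (∀ ξ η, β ξ η = β η ξ) ∧ (∀ ξ, ξ ≠ 0 → 0 < β ξ ξ) ∧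
    ∀ ξ, ξ ∈ StCone A ↔ ∀ η ∈ StCone A, 0 ≤ β ξ η

/-- The vector `a_I = ∑ i ∈ I, α_i†` of `Eff_ℝ(A)`. -/
noncomputable def faceEffect {A : C} (D : StR A ≃ₗ[ℝ] EffR A) {d : ℕ} (α : Fin d → (𝟙_ C ⟶ A))
    (I : Finset (Fin d)) : EffR A := ∑ i ∈ I, D (stVec (α i))

/-- The face `F_I` of normalised states on which `a_I` takes the value one. -/
def face {A : C} (D : StR A ≃ₗ[ℝ] EffR A) {d : ℕ} (α : Fin d → (𝟙_ C ⟶ A))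
    (I : Finset (Fin d)) : Set (𝟙_ C ⟶ A) :=
  {ρ | stNorm ρ = 1 ∧ (faceEffect D α I : Module.Dual ℝ (StR A)) (stVec ρ) = 1}

/-- The orthogonal face of normalised states on which `a_I` takes the value zero. -/
def orthFace {A : C} (D : StR A ≃ₗ[ℝ] EffR A) {d : ℕ} (α : Fin d → (𝟙_ C ⟶ A))
    (I : Finset (Fin d)) : Set (𝟙_ C ⟶ A) :=
  {ρ | stNorm ρ = 1 ∧ (faceEffect D α I : Module.Dual ℝ (StR A)) (stVec ρ) = 0}

/-- The transformation `P` is an orthogonal projector on the face `F_I`. -/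
def IsProjector {A : C} (D : StR A ≃ₗ[ℝ] EffR A) {d : ℕ} (α : Fin d → (𝟙_ C ⟶ A))
    (I : Finset (Fin d)) (P : A ⟶ A) : Prop :=
  (∀ ρ ∈ face D α I, ρ ≫ P = ρ) ∧ ∀ ρ ∈ orthFace D α I, stVec (ρ ≫ P) = 0

end Data

/-- The laws of an operational-probabilistic theory. -/
structure IsOPT (C : Type u) [Category.{v} C] [MonoidalCategory C] [SymmetricCategory C]
    [OPTData C] : Prop where
  /-- Tests from the trivial system to itself are probability distributions. -/
  prob_nonneg : ∀ {X : Type} [Fintype X] (c : X → (𝟙_ C ⟶ 𝟙_ C)), IsTest c → ∀ x, 0 ≤ prob (c x)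
  prob_sum : ∀ {X : Type} [Fintype X] (c : X → (𝟙_ C ⟶ 𝟙_ C)), IsTest c → ∑ x, prob (c x) = 1
  /-- Probabilities of composite scalars multiply. -/
  prob_comp : ∀ p q : 𝟙_ C ⟶ 𝟙_ C, prob (p ≫ q) = prob p * prob q
  /-- Every transformation belongs to a test. -/
  exists_test : ∀ {A B : C} (t : A ⟶ B),
    ∃ (X : Type) (_ : Fintype X) (f : X → (A ⟶ B)) (x : X), IsTest f ∧ f x = t
  /-- Tests are closed under sequential and parallel composition. -/
  test_comp : ∀ {A B D : C} {X Y : Type} [Fintype X] [Fintype Y]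
    (f : X → (A ⟶ B)) (g : Y → (B ⟶ D)), IsTest f → IsTest g →
      IsTest (fun p : X × Y => f p.1 ≫ g p.2)
  test_tensor : ∀ {A B A' B' : C} {X Y : Type} [Fintype X] [Fintype Y]
    (f : X → (A ⟶ B)) (g : Y → (A' ⟶ B')), IsTest f → IsTest g →
      IsTest (fun p : X × Y => f p.1 ⊗ₘ g p.2)
  /-- Identities, and the reversible rearrangements of systems, are channels. -/
  channel_id : ∀ A : C, IsChannel (𝟙 A)
  channel_braiding : ∀ A B : C, IsChannel (β_ A B).hom
  channel_associator : ∀ A B D : C, IsChannel (α_ A B D).hom ∧ IsChannel (α_ A B D).inv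
  channel_leftUnitor : ∀ A : C, IsChannel (λ_ A).hom ∧ IsChannel (λ_ A).inv
  channel_rightUnitor : ∀ A : C, IsChannel (ρ_ A).hom ∧ IsChannel (ρ_ A).inv
  /-- Every test can be coarse-grained. -/
  coarse_grain : ∀ {A B : C} {X Y : Type} [Fintype X] [Fintype Y] [DecidableEq X]
    (D : Y → (A ⟶ B)) (f : Y → X), IsTest D → Function.Surjective f →
      ∃ t : X → (A ⟶ B), IsTest t ∧ ∀ x, IsSum (t x) (Finset.univ.filter (fun y => f y = x)) D
  /-- Every probability can be realised (biased coins). -/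
  coin : ∀ p : ℝ, 0 ≤ p → p ≤ 1 → ∃ c : Bool → (𝟙_ C ⟶ 𝟙_ C), IsTest c ∧ prob (c true) = p
  /-- Transformations with the same statistics are equal. -/
  separation : ∀ {A B : C} (t t' : A ⟶ B),
    (∀ (S : C) (ρ : 𝟙_ C ⟶ A ⊗ S) (E : B ⊗ S ⟶ 𝟙_ C),
      circuitProb t S ρ E = circuitProb t' S ρ E) → t = t'
  /-- Systems are finite, and state spaces are closed. -/
  finite : ∀ A : C, FiniteDimensional ℝ (StR A)
  closed : ∀ A : C, IsClosed (Set.range (fun ρ : 𝟙_ C ⟶ A => stFun ρ))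

/-- Causality: every system has a unique deterministic effect, and the choice of a test may depend on
the outcomes of the tests that precede it. -/
structure IsCausal (C : Type u) [Category.{v} C] [MonoidalCategory C] [SymmetricCategory C]
    [OPTData C] : Prop where
  unique_deterministic : ∀ A : C, ∃! w : A ⟶ 𝟙_ C, IsChannel w
  conditioning : ∀ {A B D : C} {X : Type} {Y : X → Type} [Fintype X] [∀ x, Fintype (Y x)]
    (f : X → (A ⟶ B)) (g : ∀ x, Y x → (B ⟶ D)), IsTest f → (∀ x, IsTest (g x)) →
      IsTest (fun p : (Σ x, Y x) => f p.1 ≫ g p.1 p.2)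

/-- A sharp theory with purification: a causal operational-probabilistic theory satisfying Purity
Preservation, Pure Sharpness and Purification. -/
structure IsSharpTheoryWithPurification (C : Type u) [Category.{v} C] [MonoidalCategory C]
    [SymmetricCategory C] [OPTData C] : Prop where
  isOPT : IsOPT C
  causal : IsCausal C
  pure_comp : ∀ {A B D : C} (s : A ⟶ B) (t : B ⟶ D), IsPure s → IsPure t → IsPure (s ≫ t)
  pure_tensor : ∀ {A B A' B' : C} (s : A ⟶ B) (t : A' ⟶ B'),
    IsPure s → IsPure t → IsPure (s ⊗ₘ t)
  pure_sharpness : ∀ A : C, ∃ (a : A ⟶ 𝟙_ C) (ρ : 𝟙_ C ⟶ A), IsPure a ∧ prob (ρ ≫ a) = 1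
  exists_purification : ∀ {A : C} (ρ : 𝟙_ C ⟶ A), stNorm ρ = 1 →
    ∃ (B : C) (Ψ : 𝟙_ C ⟶ A ⊗ B), IsPurification Ψ ρ
  purification_unique : ∀ {A B : C} (ρ : 𝟙_ C ⟶ A) (Ψ Ψ' : 𝟙_ C ⟶ A ⊗ B),
    IsPurification Ψ ρ → IsPurification Ψ' ρ →
      ∃ U : B ≅ B, IsReversible U ∧ Ψ' = Ψ ≫ (A ◁ U.hom)

end OPT

/-!
The theorem rests on the symmetry of the transition probabilities, `(β†|α) = (α†|β)` for pure states
`α`, `β` (`prob_dag_comm`). Everything else is a spectral theory of states built from the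
purification axiom.

*The invariant state.* The centroid of the state space, normalised, is fixed by every reversible
channel, and no nonzero effect vanishes on it (`exists_invariant_state`). Its purification `bell A`
plays the role of a maximally entangled state: pure effects steer it to pure states, in both
directions. As the reversible channels act transitively on pure states, this gives the uniqueness of
the pure effect `dag α` occurring with certainty on a pure state `α` (`pure_effect_unique`), and a
conjugate state `conj α` of the purifying system, such that `dag α` steers the Bell state to
`conj α` and `dag (conj α)` steers it to `α`, both with the same probability `weight A`.

*Diagonalisation.* For a pure state `α` there is a pure transformation that fixes every state
orthogonal to `α` and occurs with the probability complementary to `dag α` (`exists_projector`): a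
pure transformation that realises the complement of `dag α` is corrected by a second one, which
exists because purifications are unique and because a purification of a state steers to everything
dominated by that state (`exists_steering`). Composing such projectors shows that the daggers of an
orthogonal family of pure states are dominated by the deterministic effect (`IsOrtho.exists_compl`).
A state dominates the part of it that is detected by the best pure effect, so that splitting off
pure states diagonalises every vector of `St_ℝ(A)` in an orthogonal family whose daggers add up to
the deterministic effect (`exists_diag`).

*Symmetry.* On the face of `A ⊗ bar A` generated by `α ⊗ conj α` and the projection of the Bell
state onto the complement of `α`, every state is pure or interior. Teleporting through suitable pure
states of this face yields an automorphism of the state cone that maps the invariant state `χ` to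
`χ + α` (`exists_automorphism`). An automorphism of the cone multiplies the volumes of all order
intervals by one constant. Applied to the automorphism of `α`, this expresses the volume of the
interval of `χ + α + β` by that of `χ` and a strictly monotone function of `(α†|β)`. Exchanging `α`
and `β` gives the symmetry.

*Conclusion.* By symmetry the dagger extends linearly from pure states. Diagonalisation shows that
the form is positive definite and self-dualising. A maximal set of perfectly distinguishable pure
states is an orthogonal family whose daggers add up to the deterministic effect
(`IsPureMaximalSet.ortho`). A projector `P` on the face of a subset `I` maps into the span of the
face, and `⟨x, P y⟩ = ⟨x, y⟩` for `x` in that span, since the vector that represents `x† P` lies in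
the span too and has the same inner products with it as `x`. Hence both `⟨P x, y⟩` and `⟨x, P y⟩`
are equal to `⟨P x, P y⟩` (`IsProjector.form_act`).
-/

namespace OPT

/-! ### Circuits with bipartite states and effects -/

section Circuits

set_option linter.unusedSectionVars false

variable {C : Type u} [Category.{v} C] [MonoidalCategory C] [SymmetricCategory C]

/-- The state of `A` obtained from a state of `A ⊗ B` by applying the effect `b` on `B`. -/
def sliceL {A B : C} (Ψ : 𝟙_ C ⟶ A ⊗ B) (b : B ⟶ 𝟙_ C) : 𝟙_ C ⟶ A := Ψ ≫ (A ◁ b) ≫ (ρ_ A).hom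

/-- The state of `B` obtained from a state of `A ⊗ B` by applying the effect `a` on `A`. -/
def sliceR {A B : C} (Ψ : 𝟙_ C ⟶ A ⊗ B) (a : A ⟶ 𝟙_ C) : 𝟙_ C ⟶ B := Ψ ≫ (a ▷ B) ≫ (λ_ B).hom

/-- The product of two states. -/
def prodSt {A B : C} (σ : 𝟙_ C ⟶ A) (τ : 𝟙_ C ⟶ B) : 𝟙_ C ⟶ A ⊗ B := (λ_ (𝟙_ C)).inv ≫ (σ ⊗ₘ τ)

/-- The product of two effects. -/
def prodEff {A B : C} (a : A ⟶ 𝟙_ C) (b : B ⟶ 𝟙_ C) : A ⊗ B ⟶ 𝟙_ C := (a ⊗ₘ b) ≫ (λ_ (𝟙_ C)).hom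

/-- The effect on `A` obtained from an effect on `A ⊗ B` by inserting the state `τ` of `B`. -/
def effSliceL {A B : C} (E : A ⊗ B ⟶ 𝟙_ C) (τ : 𝟙_ C ⟶ B) : A ⟶ 𝟙_ C :=
  (ρ_ A).inv ≫ (A ◁ τ) ≫ E

/-- The effect on `B` obtained from an effect on `A ⊗ B` by inserting the state `σ` of `A`. -/
def effSliceR {A B : C} (E : A ⊗ B ⟶ 𝟙_ C) (σ : 𝟙_ C ⟶ A) : B ⟶ 𝟙_ C :=
  (λ_ B).inv ≫ (σ ▷ B) ≫ E

theorem sliceL_comp {A B : C} (Ψ : 𝟙_ C ⟶ A ⊗ B) (a : A ⟶ 𝟙_ C) (b : B ⟶ 𝟙_ C) :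
    sliceL Ψ b ≫ a = Ψ ≫ prodEff a b := by
  simp only [sliceL, prodEff, Category.assoc, MonoidalCategory.tensorHom_def', unitors_equal]
  rw [rightUnitor_naturality]

theorem sliceR_comp {A B : C} (Ψ : 𝟙_ C ⟶ A ⊗ B) (a : A ⟶ 𝟙_ C) (b : B ⟶ 𝟙_ C) :
    sliceR Ψ a ≫ b = Ψ ≫ prodEff a b := by
  simp only [sliceR, prodEff, Category.assoc, MonoidalCategory.tensorHom_def]
  rw [leftUnitor_naturality]

theorem sliceR_comp_eq {A B : C} (Ψ : 𝟙_ C ⟶ A ⊗ B) (a : A ⟶ 𝟙_ C) (b : B ⟶ 𝟙_ C) :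
    sliceR Ψ a ≫ b = sliceL Ψ b ≫ a := by rw [sliceR_comp, sliceL_comp]

theorem prodSt_comp_prodEff {A B : C} (σ : 𝟙_ C ⟶ A) (τ : 𝟙_ C ⟶ B) (a : A ⟶ 𝟙_ C)
    (b : B ⟶ 𝟙_ C) : prodSt σ τ ≫ prodEff a b = (σ ≫ a) ≫ (τ ≫ b) := by
  simp only [prodSt, prodEff, Category.assoc, tensorHom_comp_tensorHom_assoc]
  simp only [MonoidalCategory.tensorHom_def, Category.assoc, leftUnitor_naturality,
    unitors_inv_equal]
  rw [← rightUnitor_inv_naturality_assoc, ← unitors_inv_equal]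
  simp

theorem comp_effSliceL {A B : C} (E : A ⊗ B ⟶ 𝟙_ C) (σ : 𝟙_ C ⟶ A) (τ : 𝟙_ C ⟶ B) :
    σ ≫ effSliceL E τ = prodSt σ τ ≫ E := by
  simp only [effSliceL, prodSt, MonoidalCategory.tensorHom_def, Category.assoc, unitors_inv_equal]
  rw [rightUnitor_inv_naturality_assoc]

theorem comp_effSliceR {A B : C} (E : A ⊗ B ⟶ 𝟙_ C) (σ : 𝟙_ C ⟶ A) (τ : 𝟙_ C ⟶ B) :
    τ ≫ effSliceR E σ = prodSt σ τ ≫ E := by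
  simp only [effSliceR, prodSt, MonoidalCategory.tensorHom_def', Category.assoc]
  rw [leftUnitor_inv_naturality_assoc]

theorem whiskerRight_comp_prodEff {A A' B : C} (t : A ⟶ A') (a : A' ⟶ 𝟙_ C) (b : B ⟶ 𝟙_ C) :
    (t ▷ B) ≫ prodEff a b = prodEff (t ≫ a) b := by
  simp [prodEff, MonoidalCategory.tensorHom_def]

theorem prodSt_comp_whiskerRight {A A' B : C} (t : A ⟶ A') (σ : 𝟙_ C ⟶ A) (τ : 𝟙_ C ⟶ B) :
    prodSt σ τ ≫ (t ▷ B) = prodSt (σ ≫ t) τ := by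
  simp [prodSt, MonoidalCategory.tensorHom_def']

theorem prodSt_comp_whiskerLeft {A B B' : C} (t : B ⟶ B') (σ : 𝟙_ C ⟶ A) (τ : 𝟙_ C ⟶ B) :
    prodSt σ τ ≫ (A ◁ t) = prodSt σ (τ ≫ t) := by
  simp [prodSt, MonoidalCategory.tensorHom_def]

theorem sliceR_whiskerRight {A A' B : C} (Ψ : 𝟙_ C ⟶ A ⊗ B) (t : A ⟶ A') (a : A' ⟶ 𝟙_ C) :
    sliceR (Ψ ≫ (t ▷ B)) a = sliceR Ψ (t ≫ a) := by simp [sliceR]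

theorem sliceL_whiskerLeft {A B B' : C} (Ψ : 𝟙_ C ⟶ A ⊗ B) (t : B ⟶ B') (b : B' ⟶ 𝟙_ C) :
    sliceL (Ψ ≫ (A ◁ t)) b = sliceL Ψ (t ≫ b) := by simp [sliceL]

theorem sliceL_whiskerRight {A A' B : C} (Ψ : 𝟙_ C ⟶ A ⊗ B) (t : A ⟶ A') (b : B ⟶ 𝟙_ C) :
    sliceL (Ψ ≫ (t ▷ B)) b = sliceL Ψ b ≫ t := by
  simp only [sliceL, Category.assoc]
  rw [← whisker_exchange_assoc, rightUnitor_naturality]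

theorem sliceR_whiskerLeft {A B B' : C} (Ψ : 𝟙_ C ⟶ A ⊗ B) (t : B ⟶ B') (a : A ⟶ 𝟙_ C) :
    sliceR (Ψ ≫ (A ◁ t)) a = sliceR Ψ a ≫ t := by
  simp only [sliceR, Category.assoc]
  rw [whisker_exchange_assoc, leftUnitor_naturality]

theorem sliceL_prodSt {A B : C} (σ : 𝟙_ C ⟶ A) (τ : 𝟙_ C ⟶ B) (b : B ⟶ 𝟙_ C) :
    sliceL (prodSt σ τ) b = (τ ≫ b) ≫ σ := by
  simp only [sliceL, ← Category.assoc, prodSt_comp_whiskerLeft]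
  simp only [prodSt, MonoidalCategory.tensorHom_def', Category.assoc, rightUnitor_naturality]
  rw [← leftUnitor_inv_naturality_assoc, unitors_inv_equal]
  simp

theorem sliceR_prodSt {A B : C} (σ : 𝟙_ C ⟶ A) (τ : 𝟙_ C ⟶ B) (a : A ⟶ 𝟙_ C) :
    sliceR (prodSt σ τ) a = (σ ≫ a) ≫ τ := by
  simp only [sliceR, ← Category.assoc, prodSt_comp_whiskerRight]
  simp only [prodSt, MonoidalCategory.tensorHom_def, Category.assoc, leftUnitor_naturality,
    unitors_inv_equal]
  rw [← rightUnitor_inv_naturality_assoc, ← unitors_inv_equal]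
  simp

theorem sliceL_braiding {A B : C} (Ψ : 𝟙_ C ⟶ A ⊗ B) (a : A ⟶ 𝟙_ C) :
    sliceL (Ψ ≫ (β_ A B).hom) a = sliceR Ψ a := by
  simp only [sliceL, sliceR, Category.assoc]
  rw [← BraidedCategory.braiding_naturality_left_assoc]
  simp

theorem sliceR_braiding {A B : C} (Ψ : 𝟙_ C ⟶ A ⊗ B) (b : B ⟶ 𝟙_ C) :
    sliceR (Ψ ≫ (β_ A B).hom) b = sliceL Ψ b := by
  simp only [sliceL, sliceR, Category.assoc]
  rw [← BraidedCategory.braiding_naturality_right_assoc]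
  simp

/-- Teleportation: `A` is coupled to one half of the bipartite state `Ψ` by the bipartite effect
`E`; what comes out is the other half of `Ψ`. -/
def teleport {A B D : C} (E : A ⊗ B ⟶ 𝟙_ C) (Ψ : 𝟙_ C ⟶ D ⊗ B) : A ⟶ D :=
  (ρ_ A).inv ≫ (A ◁ (Ψ ≫ (β_ D B).hom)) ≫ (α_ A B D).inv ≫ (E ▷ D) ≫ (λ_ D).hom

theorem comp_teleport {A B D : C} (E : A ⊗ B ⟶ 𝟙_ C) (Ψ : 𝟙_ C ⟶ D ⊗ B) (σ : 𝟙_ C ⟶ A) :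
    σ ≫ teleport E Ψ = sliceL Ψ (effSliceR E σ) := by
  rw [← sliceR_braiding]
  simp only [teleport, sliceR, effSliceR, comp_whiskerRight, Category.assoc]
  rw [rightUnitor_inv_naturality_assoc, ← whisker_exchange_assoc]
  simp only [associator_inv_naturality_left_assoc]
  monoidal

theorem circuitProb_state [OPTData C] {A : C} (σ : 𝟙_ C ⟶ A) (S : C) (Ψ : 𝟙_ C ⟶ 𝟙_ C ⊗ S)
    (E : A ⊗ S ⟶ 𝟙_ C) :
    circuitProb σ S Ψ E = prob (σ ≫ effSliceL E (Ψ ≫ (λ_ S).hom)) := by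
  rw [comp_effSliceL, circuitProb]
  congr 1
  simp [prodSt, MonoidalCategory.tensorHom_def']

theorem circuitProb_effect [OPTData C] {A : C} (a : A ⟶ 𝟙_ C) (S : C) (Ψ : 𝟙_ C ⟶ A ⊗ S)
    (E : 𝟙_ C ⊗ S ⟶ 𝟙_ C) :
    circuitProb a S Ψ E = prob (sliceL Ψ ((λ_ S).inv ≫ E) ≫ a) := by
  rw [← sliceR_comp_eq, circuitProb]
  congr 1
  simp [sliceR]

theorem circuitProb_unit [OPTData C] {A B : C} (t : A ⟶ B) (σ : 𝟙_ C ⟶ A) (b : B ⟶ 𝟙_ C) :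
    circuitProb t (𝟙_ C) (σ ≫ (ρ_ A).inv) ((ρ_ B).hom ≫ b) = prob (σ ≫ t ≫ b) := by
  simp [circuitProb]

theorem circuitProb_comp [OPTData C] {A B A' B' : C} (s : A' ⟶ A) (t : A ⟶ B) (r : B ⟶ B') (S : C)
    (Ψ : 𝟙_ C ⟶ A' ⊗ S) (E : B' ⊗ S ⟶ 𝟙_ C) :
    circuitProb (s ≫ t ≫ r) S Ψ E = circuitProb t S (Ψ ≫ (s ▷ S)) ((r ▷ S) ≫ E) := by
  simp [circuitProb]

theorem circuitProb_whiskerRight [OPTData C] {A B : C} (t : A ⟶ B) (X S : C)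
    (Ψ : 𝟙_ C ⟶ (A ⊗ X) ⊗ S) (E : (B ⊗ X) ⊗ S ⟶ 𝟙_ C) :
    circuitProb (t ▷ X) S Ψ E =
      circuitProb t (X ⊗ S) (Ψ ≫ (α_ A X S).hom) ((α_ B X S).inv ≫ E) := by
  simp [circuitProb]

end Circuits

/-! ### Probabilities, tests and the deterministic effect -/

section Basic

set_option linter.unusedSectionVars false

-- The axioms of the theory are carried as an instance, so that the systems alone determine `disc`,
-- `invState`, `bell` and `dag`.
variable {C : Type u} [Category.{v} C] [MonoidalCategory C] [SymmetricCategory C] [OPTData C]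
  [hC : Fact (IsSharpTheoryWithPurification C)]

variable (C) in
theorem laws : IsOPT C := hC.out.isOPT

theorem prob_id : prob (𝟙 (𝟙_ C)) = 1 := by
  simpa using (laws C).prob_sum _ ((laws C).channel_id (𝟙_ C))

theorem prob_comp (p q : 𝟙_ C ⟶ 𝟙_ C) : prob (p ≫ q) = prob p * prob q := (laws C).prob_comp p q

theorem prob_nonneg (p : 𝟙_ C ⟶ 𝟙_ C) : 0 ≤ prob p := by
  obtain ⟨X, _, f, x, hf, rfl⟩ := (laws C).exists_test p
  exact (laws C).prob_nonneg f hf x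

theorem prob_le_one (p : 𝟙_ C ⟶ 𝟙_ C) : prob p ≤ 1 := by
  obtain ⟨X, _, f, x, hf, rfl⟩ := (laws C).exists_test p
  rw [← (laws C).prob_sum f hf]
  exact Finset.single_le_sum (f := fun x => prob (f x))
    (fun x _ => (laws C).prob_nonneg f hf x) (Finset.mem_univ x)

theorem state_ext {A : C} {σ τ : 𝟙_ C ⟶ A} (h : ∀ a : A ⟶ 𝟙_ C, prob (σ ≫ a) = prob (τ ≫ a)) :
    σ = τ :=
  (laws C).separation _ _ fun S Ψ E => by rw [circuitProb_state, circuitProb_state, h]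

theorem effect_ext {A : C} {a b : A ⟶ 𝟙_ C} (h : ∀ σ : 𝟙_ C ⟶ A, prob (σ ≫ a) = prob (σ ≫ b)) :
    a = b :=
  (laws C).separation _ _ fun S Ψ E => by rw [circuitProb_effect, circuitProb_effect, h]

theorem scalar_ext {p q : 𝟙_ C ⟶ 𝟙_ C} (h : prob p = prob q) : p = q :=
  state_ext fun a => by rw [prob_comp, prob_comp, h]

theorem isSum_state_iff {A : C} {Y : Type} {σ : 𝟙_ C ⟶ A} {Z : Finset Y} {D : Y → (𝟙_ C ⟶ A)} :
    IsSum σ Z D ↔ ∀ a : A ⟶ 𝟙_ C, prob (σ ≫ a) = ∑ j ∈ Z, prob (D j ≫ a) := by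
  refine ⟨fun h a => ?_, fun h S Ψ E => ?_⟩
  · have := h (𝟙_ C) (𝟙 _ ≫ (ρ_ _).inv) ((ρ_ _).hom ≫ a)
    simp only [circuitProb_unit] at this
    simpa only [Category.id_comp] using this
  · simp only [circuitProb_state, h]

theorem isSum_effect_iff {A : C} {Y : Type} {a : A ⟶ 𝟙_ C} {Z : Finset Y} {D : Y → (A ⟶ 𝟙_ C)} :
    IsSum a Z D ↔ ∀ σ : 𝟙_ C ⟶ A, prob (σ ≫ a) = ∑ j ∈ Z, prob (σ ≫ D j) := by
  refine ⟨fun h σ => ?_, fun h S Ψ E => ?_⟩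
  · have := h (𝟙_ C) (σ ≫ (ρ_ _).inv) ((ρ_ _).hom ≫ 𝟙 _)
    simp only [circuitProb_unit] at this
    simpa only [Category.comp_id] using this
  · simp only [circuitProb_effect, h]

theorem isMultiple_state_iff {A : C} {p : ℝ} {σ τ : 𝟙_ C ⟶ A} :
    IsMultiple p σ τ ↔ ∀ a : A ⟶ 𝟙_ C, prob (τ ≫ a) = p * prob (σ ≫ a) := by
  refine ⟨fun h a => ?_, fun h S Ψ E => ?_⟩
  · have := h (𝟙_ C) (𝟙 _ ≫ (ρ_ _).inv) ((ρ_ _).hom ≫ a)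
    simp only [circuitProb_unit] at this
    simpa only [Category.id_comp] using this
  · simp only [circuitProb_state, h]

theorem isMultiple_effect_iff {A : C} {p : ℝ} {a b : A ⟶ 𝟙_ C} :
    IsMultiple p a b ↔ ∀ σ : 𝟙_ C ⟶ A, prob (σ ≫ b) = p * prob (σ ≫ a) := by
  refine ⟨fun h σ => ?_, fun h S Ψ E => ?_⟩
  · have := h (𝟙_ C) (σ ≫ (ρ_ _).inv) ((ρ_ _).hom ≫ 𝟙 _)
    simp only [circuitProb_unit] at this
    simpa only [Category.comp_id] using this
  · simp only [circuitProb_effect, h]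

theorem IsSum.comp {A B A' B' : C} {Y : Type} {t : A ⟶ B} {Z : Finset Y} {D : Y → (A ⟶ B)}
    (h : IsSum t Z D) (s : A' ⟶ A) (r : B ⟶ B') : IsSum (s ≫ t ≫ r) Z (fun j => s ≫ D j ≫ r) :=
  fun S Ψ E => by simp only [circuitProb_comp]; exact h _ _ _

theorem IsSum.whiskerRight {A B : C} {Y : Type} {t : A ⟶ B} {Z : Finset Y} {D : Y → (A ⟶ B)}
    (h : IsSum t Z D) (X : C) : IsSum (t ▷ X) Z (fun j => D j ▷ X) :=
  fun S Ψ E => by simp only [circuitProb_whiskerRight]; exact h _ _ _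

theorem IsMultiple.comp {A B A' B' : C} {p : ℝ} {t t' : A ⟶ B} (h : IsMultiple p t t')
    (s : A' ⟶ A) (r : B ⟶ B') : IsMultiple p (s ≫ t ≫ r) (s ≫ t' ≫ r) :=
  fun S Ψ E => by simp only [circuitProb_comp]; exact h _ _ _

/-- Outcomes may be relabelled: coarse-graining along a bijection. -/
theorem IsTest.reindex {A B : C} {X Y : Type} [Fintype X] [Fintype Y] (e : X ≃ Y) {D : Y → (A ⟶ B)}
    (hD : IsTest D) : IsTest (fun x => D (e x)) := by
  classical
  obtain ⟨t, ht, hs⟩ := (laws C).coarse_grain D e.symm hD e.symm.surjective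
  convert ht using 1
  funext x
  refine (laws C).separation _ _ fun S Ψ E => ?_
  rw [hs x S Ψ E]
  have : Finset.univ.filter (fun y => e.symm y = x) = {e x} := by
    ext y; simp [Equiv.symm_apply_eq]
  rw [this, Finset.sum_singleton]

theorem IsTest.comp_channel {A B D : C} {X : Type} [Fintype X] {f : X → (A ⟶ B)} (hf : IsTest f)
    {c : B ⟶ D} (hc : IsChannel c) : IsTest (fun x => f x ≫ c) :=
  ((laws C).test_comp _ _ hf hc).reindex (Equiv.prodPUnit X).symm

theorem IsTest.channel_comp {A B D : C} {X : Type} [Fintype X] {f : X → (B ⟶ D)} (hf : IsTest f)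
    {c : A ⟶ B} (hc : IsChannel c) : IsTest (fun x => c ≫ f x) :=
  ((laws C).test_comp _ _ hc hf).reindex (Equiv.punitProd X).symm

theorem IsTest.whiskerRight {A B : C} {X : Type} [Fintype X] {f : X → (A ⟶ B)} (hf : IsTest f)
    (S : C) : IsTest (fun x => f x ▷ S) := by
  simpa using ((laws C).test_tensor _ _ hf ((laws C).channel_id S)).reindex
    (Equiv.prodPUnit X).symm

theorem IsChannel.comp {A B D : C} {s : A ⟶ B} {t : B ⟶ D} (hs : IsChannel s) (ht : IsChannel t) :
    IsChannel (s ≫ t) := IsTest.comp_channel hs ht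

theorem IsChannel.whiskerRight {A B : C} {s : A ⟶ B} (hs : IsChannel s) (S : C) :
    IsChannel (s ▷ S) := IsTest.whiskerRight hs S

theorem IsChannel.tensor {A B A' B' : C} {s : A ⟶ B} {t : A' ⟶ B'} (hs : IsChannel s)
    (ht : IsChannel t) : IsChannel (s ⊗ₘ t) :=
  ((laws C).test_tensor _ _ hs ht).reindex (Equiv.prodPUnit Unit).symm

theorem IsChannel.whiskerLeft {A B : C} {s : A ⟶ B} (hs : IsChannel s) (S : C) :
    IsChannel (S ◁ s) := by simpa using IsChannel.tensor ((laws C).channel_id S) hs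

/-- The deterministic effect, which discards a system. -/
noncomputable def disc (A : C) : A ⟶ 𝟙_ C := (hC.out.causal.unique_deterministic A).choose

theorem isChannel_disc (A : C) : IsChannel (disc A) :=
  (hC.out.causal.unique_deterministic A).choose_spec.1

theorem eq_disc {A : C} {w : A ⟶ 𝟙_ C} (hw : IsChannel w) : w = disc A :=
  (hC.out.causal.unique_deterministic A).choose_spec.2 w hw

theorem IsChannel.comp_disc {A B : C} {t : A ⟶ B} (ht : IsChannel t) : t ≫ disc B = disc A :=
  eq_disc (ht.comp (isChannel_disc B))

theorem disc_unit : disc (𝟙_ C) = 𝟙 (𝟙_ C) := (eq_disc ((laws C).channel_id _)).symm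

theorem prodEff_disc (A B : C) : prodEff (disc A) (disc B) = disc (A ⊗ B) :=
  eq_disc (((isChannel_disc A).tensor (isChannel_disc B)).comp ((laws C).channel_leftUnitor _).1)

variable (C) in
theorem exists_prob_eq_one (A : C) :
    ∃ (a : A ⟶ 𝟙_ C) (σ : 𝟙_ C ⟶ A), IsPure a ∧ prob (σ ≫ a) = 1 := hC.out.pure_sharpness A

theorem IsTest.nonempty {A B : C} {X : Type} [Fintype X] {D : X → (A ⟶ B)} (hD : IsTest D) :
    Nonempty X := by
  by_contra hX
  rw [not_nonempty_iff] at hX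
  obtain ⟨_, σ, -, -⟩ := exists_prob_eq_one C A
  obtain ⟨Y, _, f, y, hf, -⟩ := (laws C).exists_test σ
  have := (laws C).prob_sum _
    (((laws C).test_comp _ _ hf hD).comp_channel (isChannel_disc B))
  simp at this

/-- Multiplication by a scalar, as a transformation. -/
def scalarMul (c : 𝟙_ C ⟶ 𝟙_ C) (B : C) : B ⟶ B := (λ_ B).inv ≫ (c ▷ B) ≫ (λ_ B).hom

theorem scalarMul_whiskerRight_comp (c : 𝟙_ C ⟶ 𝟙_ C) {B S : C} (E : B ⊗ S ⟶ 𝟙_ C) :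
    (scalarMul c B ▷ S) ≫ E = E ≫ c := by
  have h : scalarMul c B ▷ S = (λ_ (B ⊗ S)).inv ≫ (c ▷ (B ⊗ S)) ≫ (λ_ (B ⊗ S)).hom := by
    simp only [scalarMul]; monoidal
  rw [h]
  simp only [Category.assoc]
  rw [← leftUnitor_naturality, ← whisker_exchange_assoc, ← leftUnitor_inv_naturality_assoc]
  simp [unitors_equal, unitors_inv_equal]

theorem circuitProb_comp_scalarMul {A B : C} (t : A ⟶ B) (c : 𝟙_ C ⟶ 𝟙_ C) (S : C)
    (Ψ : 𝟙_ C ⟶ A ⊗ S) (E : B ⊗ S ⟶ 𝟙_ C) :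
    circuitProb (t ≫ scalarMul c B) S Ψ E = prob c * circuitProb t S Ψ E := by
  simp only [circuitProb, comp_whiskerRight, Category.assoc, scalarMul_whiskerRight_comp]
  rw [show Ψ ≫ t ▷ S ≫ E ≫ c = (Ψ ≫ t ▷ S ≫ E) ≫ c by simp, prob_comp, mul_comm]

theorem isTest_scalarMul {X : Type} [Fintype X] {c : X → (𝟙_ C ⟶ 𝟙_ C)} (hc : IsTest c) (B : C) :
    IsTest (fun x => scalarMul (c x) B) :=
  ((hc.whiskerRight B).channel_comp ((laws C).channel_leftUnitor B).2).comp_channel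
    ((laws C).channel_leftUnitor B).1 |> fun h => by simpa [scalarMul] using h

theorem prob_coin {c : Bool → (𝟙_ C ⟶ 𝟙_ C)} (hc : IsTest c) :
    prob (c false) = 1 - prob (c true) := by
  have := (laws C).prob_sum c hc
  simp at this
  linarith

/-- A test can be coarse-grained to the two outcomes "in `Z`" and "not in `Z`". Padding with a
deterministic coin makes the coarse-graining map surjective for every `Z`. -/
theorem IsTest.split {A B : C} {Y : Type} [Fintype Y] [DecidableEq Y] {D : Y → (A ⟶ B)}
    (hD : IsTest D) (Z : Finset Y) :
    ∃ t : Bool → (A ⟶ B), IsTest t ∧ IsSum (t true) Z D ∧ IsSum (t false) Zᶜ D := by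
  classical
  obtain ⟨c, hc, h1⟩ := (laws C).coin 1 zero_le_one le_rfl
  have h0 : prob (c false) = 0 := by rw [prob_coin hc, h1, sub_self]
  have hcc := isTest_scalarMul ((laws C).test_comp c c hc hc) B
  have hT := (laws C).test_comp _ _ hD hcc
  obtain ⟨y0⟩ := hD.nonempty
  obtain ⟨t, ht, hs⟩ := (laws C).coarse_grain _
    (fun p : Y × Bool × Bool => if p.2 = (true, true) then decide (p.1 ∈ Z) else p.2.1) hT
    (fun b => by cases b; exacts [⟨(y0, false, false), by simp⟩, ⟨(y0, true, false), by simp⟩])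
  refine ⟨t, ht, fun S Ψ E => ?_, fun S Ψ E => ?_⟩
  · rw [hs true S Ψ E, Finset.sum_filter, Fintype.sum_prod_type]
    simp only [circuitProb_comp_scalarMul, prob_comp, Fintype.sum_prod_type, Fintype.sum_bool]
    simp [h0, h1]
  · rw [hs false S Ψ E, Finset.sum_filter, Fintype.sum_prod_type]
    simp only [circuitProb_comp_scalarMul, prob_comp, Fintype.sum_prod_type, Fintype.sum_bool]
    simp [h0, h1, ← Finset.mem_compl]

theorem sum_prob_eq_disc {A : C} {X : Type} [Fintype X] {D : X → (A ⟶ 𝟙_ C)} (hD : IsTest D)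
    (σ : 𝟙_ C ⟶ A) : ∑ x, prob (σ ≫ D x) = prob (σ ≫ disc A) := by
  classical
  obtain ⟨x0⟩ := hD.nonempty
  obtain ⟨t, ht, hs⟩ := (laws C).coarse_grain D (fun _ => ()) hD (fun _ => ⟨x0, rfl⟩)
  have h := isSum_effect_iff.1 (hs ()) σ
  rw [eq_disc (w := t ()) ht] at h
  simpa using h.symm

theorem prob_comp_le_disc {A : C} (σ : 𝟙_ C ⟶ A) (a : A ⟶ 𝟙_ C) :
    prob (σ ≫ a) ≤ prob (σ ≫ disc A) := by
  obtain ⟨X, _, f, x, hf, rfl⟩ := (laws C).exists_test a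
  rw [← sum_prob_eq_disc hf]
  exact Finset.single_le_sum (f := fun x => prob (σ ≫ f x))
    (fun x _ => prob_nonneg _) (Finset.mem_univ x)

theorem prob_comp_disc_le {A B : C} (t : A ⟶ B) (σ : 𝟙_ C ⟶ A) :
    prob (σ ≫ t ≫ disc B) ≤ prob (σ ≫ disc A) := prob_comp_le_disc σ _

theorem stNorm_eq {A : C} (σ : 𝟙_ C ⟶ A) : stNorm σ = prob (σ ≫ disc A) := by
  have : Nonempty (A ⟶ 𝟙_ C) := ⟨disc A⟩
  exact le_antisymm (ciSup_le fun a => prob_comp_le_disc σ a)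
    (le_ciSup (f := fun a : A ⟶ 𝟙_ C => prob (σ ≫ a)) ⟨1, by
      rintro _ ⟨a, rfl⟩; exact prob_le_one _⟩ (disc A))

/-- The complementary effect `u - a`. -/
theorem exists_compl {A : C} (a : A ⟶ 𝟙_ C) : ∃ a' : A ⟶ 𝟙_ C,
    IsTest (fun b : Bool => cond b a a') ∧
      ∀ σ : 𝟙_ C ⟶ A, prob (σ ≫ a) + prob (σ ≫ a') = prob (σ ≫ disc A) := by
  classical
  obtain ⟨X, _, f, x, hf, rfl⟩ := (laws C).exists_test a
  obtain ⟨t, ht, h1, -⟩ := hf.split {x}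
  have h : t true = f x := effect_ext fun σ => by
    rw [isSum_effect_iff.1 h1 σ, Finset.sum_singleton]
  have h2 : (fun b : Bool => cond b (f x) (t false)) = t := by
    funext b; cases b <;> simp [h]
  refine ⟨t false, by rw [h2]; exact ht, fun σ => ?_⟩
  rw [← sum_prob_eq_disc ht]
  simp [h]

/-- A normalised state is deterministic. -/
theorem isChannel_of_prob_disc {A : C} {σ : 𝟙_ C ⟶ A} (h : prob (σ ≫ disc A) = 1) :
    IsChannel σ := by
  classical
  obtain ⟨X, _, f, x, hf, rfl⟩ := (laws C).exists_test σ
  have hs := (laws C).prob_sum _ (hf.comp_channel (isChannel_disc A))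
  rw [← Finset.add_sum_erase _ _ (Finset.mem_univ x), h] at hs
  have h0 : ∀ y ≠ x, prob (f y ≫ disc A) = 0 := fun y hy =>
    (Finset.sum_eq_zero_iff_of_nonneg (fun y _ => prob_nonneg _)).1
      (by linarith : ∑ y ∈ Finset.univ.erase x, prob (f y ≫ disc A) = 0) y (by simp [hy])
  obtain ⟨t, ht, hs⟩ := (laws C).coarse_grain f (fun _ => ()) hf (fun _ => ⟨x, rfl⟩)
  have : f x = t () := state_ext fun a => by
    rw [isSum_state_iff.1 (hs ()) a, Finset.sum_eq_single x _ (by simp)]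
    exact fun y _ hy => le_antisymm ((prob_comp_le_disc _ _).trans (h0 y hy).le) (prob_nonneg _)
  rw [this]
  exact ht

/-- The second test is chosen according to the outcome of the first. -/
theorem IsTest.cond {A B D : C} {Y₁ Y₂ : Type} [Fintype Y₁] [Fintype Y₂] {t : Bool → (A ⟶ B)}
    (ht : IsTest t) {g₁ : Y₁ → (B ⟶ D)} {g₂ : Y₂ → (B ⟶ D)} (h₁ : IsTest g₁) (h₂ : IsTest g₂) :
    IsTest (Sum.elim (fun y => t true ≫ g₁ y) (fun y => t false ≫ g₂ y)) := by
  let Y : Bool → Type := fun b => _root_.cond b Y₁ Y₂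
  let _ : ∀ b, Fintype (Y b) := fun b => by cases b <;> (dsimp [Y]; infer_instance)
  let g : ∀ b, Y b → (B ⟶ D) := fun b => by cases b; exacts [g₂, g₁]
  have hg : ∀ b, IsTest (g b) := fun b => by cases b; exacts [h₂, h₁]
  let e : Y₁ ⊕ Y₂ ≃ Σ b, Y b :=
    { toFun := Sum.elim (fun y => ⟨true, y⟩) (fun y => ⟨false, y⟩)
      invFun := fun p => match p with
        | ⟨true, y⟩ => Sum.inl y
        | ⟨false, y⟩ => Sum.inr y
      left_inv := by rintro (y | y) <;> rfl
      right_inv := by rintro ⟨(_ | _), y⟩ <;> rfl }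
  convert (hC.out.causal.conditioning t g ht hg).reindex e using 1
  funext y
  rcases y with y | y <;> rfl

end Basic

/-! ### The state cone and normalised states -/

section States

set_option linter.unusedSectionVars false

variable {C : Type u} [Category.{v} C] [MonoidalCategory C] [SymmetricCategory C] [OPTData C]
  [hC : Fact (IsSharpTheoryWithPurification C)]

instance (A : C) : FiniteDimensional ℝ (StR A) := (laws C).finite A

theorem effFun_stVec {A : C} (a : A ⟶ 𝟙_ C) (σ : 𝟙_ C ⟶ A) :
    effFun a (stVec σ) = prob (σ ≫ a) := rfl

theorem vec_ext {A : C} {x y : StR A} (h : ∀ a : A ⟶ 𝟙_ C, effFun a x = effFun a y) : x = y :=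
  Subtype.ext (funext h)

theorem stVec_injective {A : C} : Function.Injective (stVec : (𝟙_ C ⟶ A) → StR A) :=
  fun σ τ h => state_ext fun a => by rw [← effFun_stVec, h, effFun_stVec]

theorem effFun_act {A B : C} (t : A ⟶ B) (b : B ⟶ 𝟙_ C) (x : StR A) :
    effFun b (act t x) = effFun (t ≫ b) x := rfl

/-- A state is normalised if it is detected with certainty. -/
def Normalised {A : C} (σ : 𝟙_ C ⟶ A) : Prop := prob (σ ≫ disc A) = 1

theorem Normalised.isChannel {A : C} {σ : 𝟙_ C ⟶ A} (h : Normalised σ) : IsChannel σ :=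
  isChannel_of_prob_disc h

theorem normalised_iff {A : C} {σ : 𝟙_ C ⟶ A} : Normalised σ ↔ stNorm σ = 1 := by
  rw [stNorm_eq, Normalised]

theorem Normalised.comp {A B : C} {σ : 𝟙_ C ⟶ A} (h : Normalised σ) {t : A ⟶ B}
    (ht : IsChannel t) : Normalised (σ ≫ t) := by
  rw [Normalised, Category.assoc, ht.comp_disc]; exact h

theorem normalised_of_prob_eq_one {A : C} {σ : 𝟙_ C ⟶ A} {a : A ⟶ 𝟙_ C}
    (h : prob (σ ≫ a) = 1) : Normalised σ :=
  le_antisymm (prob_le_one _) (h ▸ prob_comp_le_disc σ a)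

variable (C) in
theorem exists_normalised (A : C) : ∃ σ : 𝟙_ C ⟶ A, Normalised σ := by
  obtain ⟨a, σ, -, h⟩ := exists_prob_eq_one C A
  exact ⟨σ, normalised_of_prob_eq_one h⟩

/-- Two subnormalised multiples of states occur as different outcomes of one test. -/
theorem exists_test_pair {A : C} {σ τ : 𝟙_ C ⟶ A} (hσ : Normalised σ) (hτ : Normalised τ)
    {p r : ℝ} (hp : 0 ≤ p) (hr : 0 ≤ r) (hpr : p + r ≤ 1) :
    ∃ D : Unit ⊕ Bool → (𝟙_ C ⟶ A), IsTest D ∧ stVec (D (Sum.inl ())) = p • stVec σ ∧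
      stVec (D (Sum.inr true)) = r • stVec τ := by
  obtain ⟨c, hc, hcp⟩ := (laws C).coin p hp (by linarith)
  have hd : r / (1 - p) ≤ 1 := div_le_one_of_le₀ (by linarith) (by linarith)
  obtain ⟨d, hd, hdr⟩ := (laws C).coin (r / (1 - p)) (div_nonneg hr (by linarith)) hd
  refine ⟨_, hc.cond hσ.isChannel (hd.comp_channel hτ.isChannel), vec_ext fun a => ?_,
    vec_ext fun a => ?_⟩
  · simp only [Sum.elim_inl, effFun_stVec, map_smul, smul_eq_mul, Category.assoc, prob_comp, hcp]
  · simp only [Sum.elim_inr, effFun_stVec, map_smul, smul_eq_mul, Category.assoc, prob_comp, hdr,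
      prob_coin hc, hcp]
    rcases eq_or_ne p 1 with rfl | h
    · have : r = 0 := by linarith
      simp [this]
    · have : 1 - p ≠ 0 := sub_ne_zero.2 h.symm
      field_simp

theorem stVec_eq_sum {A : C} {Y : Type} {σ : 𝟙_ C ⟶ A} {Z : Finset Y} {D : Y → (𝟙_ C ⟶ A)}
    (h : IsSum σ Z D) : stVec σ = ∑ j ∈ Z, stVec (D j) :=
  vec_ext fun a => by rw [map_sum]; exact isSum_state_iff.1 h a

theorem isSum_of_stVec_eq_sum {A : C} {Y : Type} {σ : 𝟙_ C ⟶ A} {Z : Finset Y}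
    {D : Y → (𝟙_ C ⟶ A)} (h : stVec σ = ∑ j ∈ Z, stVec (D j)) : IsSum σ Z D :=
  isSum_state_iff.2 fun a => by rw [← effFun_stVec, h, map_sum]; rfl

theorem isMultiple_iff_stVec {A : C} {p : ℝ} {σ τ : 𝟙_ C ⟶ A} :
    IsMultiple p σ τ ↔ stVec τ = p • stVec σ := by
  rw [isMultiple_state_iff]
  exact ⟨fun h => vec_ext fun a => by simpa [effFun_stVec] using h a, fun h a => by
    rw [← effFun_stVec, h, map_smul, smul_eq_mul, effFun_stVec]⟩

theorem exists_add {A : C} {σ τ : 𝟙_ C ⟶ A} (hσ : Normalised σ) (hτ : Normalised τ)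
    {p r : ℝ} (hp : 0 ≤ p) (hr : 0 ≤ r) (hpr : p + r ≤ 1) :
    ∃ ω : 𝟙_ C ⟶ A, stVec ω = p • stVec σ + r • stVec τ := by
  classical
  obtain ⟨D, hD, h1, h2⟩ := exists_test_pair hσ hτ hp hr hpr
  obtain ⟨t, -, ht, -⟩ := hD.split {Sum.inl (), Sum.inr true}
  refine ⟨t true, ?_⟩
  rw [stVec_eq_sum ht, Finset.sum_pair (by simp), h1, h2]

theorem stVec_eq_zero {A : C} {σ : 𝟙_ C ⟶ A} (h : prob (σ ≫ disc A) = 0) : stVec σ = 0 :=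
  vec_ext fun a => by
    rw [effFun_stVec, map_zero]
    exact le_antisymm ((prob_comp_le_disc σ a).trans h.le) (prob_nonneg _)

theorem isClosed_range_stVec (A : C) : IsClosed (Set.range (stVec : (𝟙_ C ⟶ A) → StR A)) := by
  have : Set.range (stVec : (𝟙_ C ⟶ A) → StR A) =
      Subtype.val ⁻¹' (Set.range (fun σ : 𝟙_ C ⟶ A => stFun σ)) := by
    ext x
    simp only [Set.mem_range, Set.mem_preimage]
    exact exists_congr fun σ => ⟨fun h => by rw [← h]; rfl, fun h => Subtype.ext h⟩
  rw [this]
  exact ((laws C).closed A).preimage continuous_subtype_val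

theorem isCompact_range_stVec (A : C) : IsCompact (Set.range (stVec : (𝟙_ C ⟶ A) → StR A)) := by
  rw [Subtype.isCompact_iff]
  have : (Subtype.val '' Set.range (stVec : (𝟙_ C ⟶ A) → StR A)) =
      Set.range (fun σ : 𝟙_ C ⟶ A => stFun σ) := by
    rw [← Set.range_comp]; rfl
  rw [this]
  refine (isCompact_univ_pi
    (fun _ : A ⟶ 𝟙_ C => isCompact_Icc (a := (0 : ℝ)) (b := 1))).of_isClosed_subset
    ((laws C).closed A) ?_
  rintro _ ⟨σ, rfl⟩ a -
  exact ⟨prob_nonneg _, prob_le_one _⟩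

/-- Every nonzero state is proportional to a normalised state: if its preparation fails, one tries
again, and in the limit the preparation succeeds with certainty. -/
theorem exists_normalised_smul {A : C} (σ : 𝟙_ C ⟶ A) (h : prob (σ ≫ disc A) ≠ 0) :
    ∃ ω : 𝟙_ C ⟶ A, Normalised ω ∧ stVec σ = prob (σ ≫ disc A) • stVec ω := by
  classical
  set t := prob (σ ≫ disc A) with ht
  have ht0 : 0 < t := lt_of_le_of_ne (prob_nonneg _) (Ne.symm h)
  have ht1 : t ≤ 1 := prob_le_one _
  obtain ⟨X, _, f, x, hf, hx⟩ := (laws C).exists_test σ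
  obtain ⟨s, hs, hs1, -⟩ := hf.split {x}
  have hsσ : s true = σ := stVec_injective (by rw [stVec_eq_sum hs1, Finset.sum_singleton, hx])
  have hs0 : prob (s false ≫ disc A) = 1 - t := by
    have := (laws C).prob_sum _ (hs.comp_channel (isChannel_disc A))
    simp only [Fintype.sum_bool, hsσ, ← ht] at this
    linarith
  -- one more attempt turns the weight `r` into `1 + (1 - t) r`
  have step : ∀ r : ℝ, (∃ κ : 𝟙_ C ⟶ A, stVec κ = r • stVec σ) →
      ∃ κ : 𝟙_ C ⟶ A, stVec κ = (1 + (1 - t) * r) • stVec σ := by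
    rintro r ⟨κ, hκ⟩
    obtain ⟨Y, _, g, y, hg, rfl⟩ := (laws C).exists_test κ
    have hT := hs.cond ((laws C).channel_id A) (hg.channel_comp (isChannel_disc A))
    obtain ⟨w, -, hw, -⟩ := hT.split {Sum.inl (), Sum.inr y}
    refine ⟨w true, vec_ext fun a => ?_⟩
    have := congrArg (effFun a) hκ
    simp only [effFun_stVec, map_smul, smul_eq_mul] at this
    rw [stVec_eq_sum hw, Finset.sum_pair (by simp), map_add, map_smul, smul_eq_mul]
    simp only [effFun_stVec, Sum.elim_inl, Sum.elim_inr, Category.comp_id, hsσ, Category.assoc]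
    rw [show s false ≫ disc A ≫ g y ≫ a = (s false ≫ disc A) ≫ (g y ≫ a) by simp, prob_comp, hs0,
      this]
    ring
  have hk : ∀ k : ℕ, ∃ κ : 𝟙_ C ⟶ A, stVec κ = ((1 - (1 - t) ^ k) / t) • stVec σ := by
    intro k
    induction k with
    | zero =>
      obtain ⟨τ, hτ⟩ := exists_normalised C A
      obtain ⟨ω, hω⟩ := exists_add hτ hτ le_rfl le_rfl (by norm_num)
      exact ⟨ω, by simp [hω]⟩
    | succ k ih =>
      obtain ⟨κ, hκ⟩ := step _ ih
      refine ⟨κ, hκ.trans ?_⟩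
      congr 1
      rw [pow_succ]
      field_simp
      ring
  have hlim : Filter.Tendsto (fun k : ℕ => ((1 - (1 - t) ^ k) / t) • stVec σ) Filter.atTop
      (nhds (((1 - 0) / t) • stVec σ)) :=
    Filter.Tendsto.smul_const ((tendsto_const_nhds.sub (tendsto_pow_atTop_nhds_zero_of_lt_one
      (by linarith) (by linarith))).div_const t) _
  obtain ⟨ω, hω⟩ := (isClosed_range_stVec A).mem_of_tendsto hlim
    (Filter.Eventually.of_forall fun k => hk k)
  have hσω : stVec σ = t • stVec ω := by
    rw [hω, smul_smul]
    field_simp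
    simp
  refine ⟨ω, ?_, hσω⟩
  have := congrArg (effFun (disc A)) hσω
  rw [map_smul, effFun_stVec, effFun_stVec, smul_eq_mul, ← ht] at this
  rw [Normalised]
  exact mul_left_cancel₀ h (by linarith)

theorem exists_normalised_smul' {A : C} (σ : 𝟙_ C ⟶ A) :
    ∃ ω : 𝟙_ C ⟶ A, Normalised ω ∧ stVec σ = prob (σ ≫ disc A) • stVec ω := by
  by_cases h : prob (σ ≫ disc A) = 0
  · obtain ⟨ω, hω⟩ := exists_normalised C A
    exact ⟨ω, hω, by rw [stVec_eq_zero h, h, zero_smul]⟩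
  · exact exists_normalised_smul σ h

theorem stVec_mem_StCone {A : C} (σ : 𝟙_ C ⟶ A) : stVec σ ∈ StCone A :=
  Submodule.subset_span ⟨σ, rfl⟩

theorem smul_mem_StCone {A : C} {x : StR A} (hx : x ∈ StCone A) {t : ℝ} (ht : 0 ≤ t) :
    t • x ∈ StCone A :=
  Submodule.smul_mem (StCone A) (⟨t, ht⟩ : {c : ℝ // 0 ≤ c}) hx

theorem exists_smul_of_mem_StCone {A : C} {x : StR A} (hx : x ∈ StCone A) :
    ∃ t : ℝ, 0 ≤ t ∧ ∃ σ : 𝟙_ C ⟶ A, Normalised σ ∧ x = t • stVec σ := by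
  refine Submodule.span_induction (p := fun x _ => ∃ t : ℝ, 0 ≤ t ∧ ∃ σ : 𝟙_ C ⟶ A,
    Normalised σ ∧ x = t • stVec σ) ?_ ?_ ?_ ?_ hx
  · rintro _ ⟨σ, rfl⟩
    obtain ⟨ω, hω, h⟩ := exists_normalised_smul' σ
    exact ⟨_, prob_nonneg _, ω, hω, h⟩
  · obtain ⟨ω, hω⟩ := exists_normalised C A
    exact ⟨0, le_rfl, ω, hω, by simp⟩
  · rintro _ _ - - ⟨t, ht, σ, hσ, rfl⟩ ⟨s, hs, τ, hτ, rfl⟩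
    rcases (add_nonneg ht hs).eq_or_lt' with h0 | h0
    · exact ⟨0, le_rfl, σ, hσ, by
        rw [show t = 0 by linarith, show s = 0 by linarith]; simp⟩
    · obtain ⟨ω, hω⟩ := exists_add hσ hτ (p := t / (t + s)) (r := s / (t + s)) (by positivity)
        (by positivity) (by rw [← add_div, div_self h0.ne'])
      refine ⟨t + s, h0.le, ω, ?_, ?_⟩
      · have := congrArg (effFun (disc A)) hω
        rw [map_add, map_smul, map_smul, effFun_stVec, effFun_stVec, effFun_stVec, hσ, hτ] at this
        rw [Normalised, this]
        simp only [smul_eq_mul]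
        field_simp
      · rw [hω, smul_add, smul_smul, smul_smul]
        congr 2 <;> field_simp
  · rintro c _ - ⟨t, ht, σ, hσ, rfl⟩
    exact ⟨c * t, mul_nonneg c.2 ht, σ, hσ, by rw [mul_smul]; rfl⟩

theorem effFun_nonneg {A : C} (a : A ⟶ 𝟙_ C) {x : StR A} (hx : x ∈ StCone A) : 0 ≤ effFun a x := by
  obtain ⟨t, ht, σ, -, rfl⟩ := exists_smul_of_mem_StCone hx
  rw [map_smul]
  exact mul_nonneg ht (prob_nonneg _)

theorem effFun_le_disc {A : C} (a : A ⟶ 𝟙_ C) {x : StR A} (hx : x ∈ StCone A) :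
    effFun a x ≤ effFun (disc A) x := by
  obtain ⟨t, ht, σ, -, rfl⟩ := exists_smul_of_mem_StCone hx
  rw [map_smul, map_smul]
  exact mul_le_mul_of_nonneg_left (prob_comp_le_disc σ a) ht

theorem exists_state_of_mem_StCone {A : C} {x : StR A} (hx : x ∈ StCone A)
    (h : effFun (disc A) x ≤ 1) : ∃ σ : 𝟙_ C ⟶ A, stVec σ = x := by
  obtain ⟨t, ht, σ, hσ, rfl⟩ := exists_smul_of_mem_StCone hx
  rw [map_smul, effFun_stVec, hσ, smul_eq_mul, mul_one] at h
  obtain ⟨ω, hω⟩ := exists_add hσ hσ ht le_rfl (by linarith)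
  exact ⟨ω, by simp [hω]⟩

theorem exists_normalised_of_mem_StCone {A : C} {x : StR A} (hx : x ∈ StCone A)
    (h : effFun (disc A) x = 1) : ∃ σ : 𝟙_ C ⟶ A, Normalised σ ∧ stVec σ = x := by
  obtain ⟨σ, rfl⟩ := exists_state_of_mem_StCone hx h.le
  exact ⟨σ, h, rfl⟩

theorem eq_zero_of_mem_StCone {A : C} {x : StR A} (hx : x ∈ StCone A)
    (h : effFun (disc A) x = 0) : x = 0 := by
  obtain ⟨t, ht, σ, hσ, rfl⟩ := exists_smul_of_mem_StCone hx
  rw [map_smul, effFun_stVec, hσ, smul_eq_mul, mul_one] at h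
  rw [h, zero_smul]

theorem act_mem_StCone {A B : C} (t : A ⟶ B) {x : StR A} (hx : x ∈ StCone A) :
    act t x ∈ StCone B := by
  obtain ⟨s, hs, σ, -, rfl⟩ := exists_smul_of_mem_StCone hx
  rw [map_smul, act_stVec]
  exact smul_mem_StCone (stVec_mem_StCone _) hs

theorem span_range_stVec (A : C) :
    Submodule.span ℝ (Set.range (stVec : (𝟙_ C ⟶ A) → StR A)) = ⊤ := by
  rw [← Submodule.map_injective_of_injective (StR A).injective_subtype |>.eq_iff]
  rw [Submodule.map_span, Submodule.map_top, Submodule.range_subtype, ← Set.range_comp]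
  rfl

/-- Pure states are the states on the extremal rays of the cone of states. -/
theorem IsPure.extremal {A : C} {σ : 𝟙_ C ⟶ A} (h : IsPure σ) {y z : StR A} (hy : y ∈ StCone A)
    (hz : z ∈ StCone A) (hyz : y + z = stVec σ) : ∃ c : ℝ, 0 ≤ c ∧ y = c • stVec σ := by
  classical
  obtain ⟨t, ht, η, hη, rfl⟩ := exists_smul_of_mem_StCone hy
  obtain ⟨s, hs, ζ, hζ, rfl⟩ := exists_smul_of_mem_StCone hz
  have h1 : t + s ≤ 1 := by
    have := congrArg (effFun (disc A)) hyz
    rw [map_add, map_smul, map_smul, effFun_stVec, effFun_stVec, hη, hζ, effFun_stVec] at this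
    simp only [smul_eq_mul, mul_one] at this
    rw [this]; exact prob_le_one _
  obtain ⟨D, hD, e1, e2⟩ := exists_test_pair hη hζ ht hs h1
  obtain ⟨p, hp, -, hpD⟩ := h _ D hD {Sum.inl (), Sum.inr true} (by simp)
    (isSum_of_stVec_eq_sum (by rw [Finset.sum_pair (by simp), e1, e2, hyz]))
  refine ⟨p (Sum.inl ()), hp _ (by simp), ?_⟩
  rw [← e1]
  exact isMultiple_iff_stVec.1 (hpD _ (by simp))

theorem isPure_of_extremal {A : C} {σ : 𝟙_ C ⟶ A} (hσ : Normalised σ)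
    (h : ∀ y ∈ StCone A, ∀ z ∈ StCone A, y + z = stVec σ → ∃ c : ℝ, y = c • stVec σ) :
    IsPure σ := by
  classical
  intro Y _ D hD Z hZ hsum
  have hs := stVec_eq_sum hsum
  have key : ∀ j ∈ Z, stVec (D j) = prob (D j ≫ disc A) • stVec σ := by
    intro j hj
    obtain ⟨c, hc⟩ := h (stVec (D j)) (stVec_mem_StCone _) (∑ i ∈ Z.erase j, stVec (D i))
      (Submodule.sum_mem _ fun i _ => stVec_mem_StCone _)
      (by rw [hs]; exact Finset.add_sum_erase Z (fun i => stVec (D i)) hj)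
    have := congrArg (effFun (disc A)) hc
    rw [map_smul, effFun_stVec, effFun_stVec, hσ, smul_eq_mul, mul_one] at this
    rw [hc, this]
  refine ⟨fun j => prob (D j ≫ disc A), fun j _ => prob_nonneg _, ?_,
    fun j hj => isMultiple_iff_stVec.2 (key j hj)⟩
  have := congrArg (effFun (disc A)) hs
  rw [map_sum, effFun_stVec, hσ] at this
  exact this.symm

end States

/-! ### Pure states, purifications and purity of the identity -/

section Pure

set_option linter.unusedSectionVars false

variable {C : Type u} [Category.{v} C] [MonoidalCategory C] [SymmetricCategory C] [OPTData C]
  [hC : Fact (IsSharpTheoryWithPurification C)]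

theorem IsPureSt₁.normalised {A : C} {σ : 𝟙_ C ⟶ A} (h : IsPureSt₁ σ) : Normalised σ :=
  normalised_iff.2 h.2

/-- The compact convex set of normalised states. -/
def normSet (A : C) : Set (StR A) := {x | ∃ σ : 𝟙_ C ⟶ A, Normalised σ ∧ stVec σ = x}

theorem mem_normSet_iff {A : C} {x : StR A} :
    x ∈ normSet A ↔ x ∈ StCone A ∧ effFun (disc A) x = 1 := by
  constructor
  · rintro ⟨σ, hσ, rfl⟩
    exact ⟨stVec_mem_StCone σ, hσ⟩
  · rintro ⟨h1, h2⟩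
    exact exists_normalised_of_mem_StCone h1 h2

theorem isCompact_normSet (A : C) : IsCompact (normSet A) := by
  have : normSet A = Set.range stVec ∩ {x | effFun (disc A) x = 1} := by
    ext x
    constructor
    · rintro ⟨σ, hσ, rfl⟩; exact ⟨⟨σ, rfl⟩, hσ⟩
    · rintro ⟨⟨σ, rfl⟩, hσ⟩; exact ⟨σ, hσ, rfl⟩
  rw [this]
  exact (isCompact_range_stVec A).inter_right
    (isClosed_eq (LinearMap.continuous_of_finiteDimensional _) continuous_const)

theorem normSet_nonempty (A : C) : (normSet A).Nonempty := by
  obtain ⟨σ, hσ⟩ := exists_normalised C A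
  exact ⟨_, σ, hσ, rfl⟩

theorem exists_pure_of_extremePoint {A : C} {x : StR A} (hx : x ∈ (normSet A).extremePoints ℝ) :
    ∃ ψ : 𝟙_ C ⟶ A, IsPureSt₁ ψ ∧ stVec ψ = x := by
  obtain ⟨⟨σ, hσ, rfl⟩, hext⟩ := hx
  refine ⟨σ, ⟨isPure_of_extremal hσ fun y hy z hz hyz => ?_, normalised_iff.1 hσ⟩, rfl⟩
  obtain ⟨t, ht, η, hη, rfl⟩ := exists_smul_of_mem_StCone hy
  obtain ⟨s, hs, ζ, hζ, rfl⟩ := exists_smul_of_mem_StCone hz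
  have h1 : t + s = 1 := by
    have := congrArg (effFun (disc A)) hyz
    rw [map_add, map_smul, map_smul, effFun_stVec, effFun_stVec, hη, hζ, effFun_stVec, hσ] at this
    simpa using this
  rcases ht.eq_or_lt' with rfl | ht
  · exact ⟨0, by simp⟩
  rcases hs.eq_or_lt' with rfl | hs
  · exact ⟨1, by rw [← hyz]; simp⟩
  exact ⟨t, by rw [hext ⟨η, hη, rfl⟩ ⟨ζ, hζ, rfl⟩ ⟨t, s, ht, hs, h1, hyz⟩]⟩

/-- A linear functional attains its maximum over the normalised states at a pure state. -/
theorem exists_pure_isMax {A : C} (f : StR A →ₗ[ℝ] ℝ) : ∃ ψ : 𝟙_ C ⟶ A, IsPureSt₁ ψ ∧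
    ∀ σ : 𝟙_ C ⟶ A, Normalised σ → f (stVec σ) ≤ f (stVec ψ) := by
  let f' : StrongDual ℝ (StR A) := LinearMap.toContinuousLinearMap f
  have hE : IsExposed ℝ (normSet A) (f'.toExposed (normSet A)) :=
    ContinuousLinearMap.toExposed.isExposed
  obtain ⟨x0, hx0, hmax⟩ := (isCompact_normSet A).exists_isMaxOn (normSet_nonempty A)
    f'.continuous.continuousOn
  obtain ⟨x, hx⟩ := (hE.isCompact (isCompact_normSet A)).extremePoints_nonempty
    ⟨x0, hx0, fun y hy => hmax hy⟩
  obtain ⟨ψ, hψ, rfl⟩ := exists_pure_of_extremePoint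
    (hE.isExtreme.extremePoints_subset_extremePoints hx)
  exact ⟨ψ, hψ, fun σ hσ => hx.1.2 _ ⟨σ, hσ, rfl⟩⟩

/-- A linear functional that is nonnegative on the pure states is nonnegative on all states. -/
theorem nonneg_of_pure {A : C} (f : StR A →ₗ[ℝ] ℝ)
    (h : ∀ ψ : 𝟙_ C ⟶ A, IsPureSt₁ ψ → 0 ≤ f (stVec ψ)) {x : StR A} (hx : x ∈ StCone A) :
    0 ≤ f x := by
  obtain ⟨t, ht, σ, hσ, rfl⟩ := exists_smul_of_mem_StCone hx
  obtain ⟨ψ, hψ, hmax⟩ := exists_pure_isMax (-f)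
  have := hmax σ hσ
  rw [map_smul]
  refine mul_nonneg ht ((h ψ hψ).trans ?_)
  simpa using this

theorem eq_of_pure {A : C} {f g : StR A →ₗ[ℝ] ℝ}
    (h : ∀ ψ : 𝟙_ C ⟶ A, IsPureSt₁ ψ → f (stVec ψ) = g (stVec ψ)) : f = g := by
  refine LinearMap.ext_on_range (span_range_stVec A) fun σ => ?_
  have h1 := nonneg_of_pure (f - g) (fun ψ hψ => by simp [h ψ hψ]) (stVec_mem_StCone σ)
  have h2 := nonneg_of_pure (g - f) (fun ψ hψ => by simp [h ψ hψ]) (stVec_mem_StCone σ)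
  simp only [LinearMap.sub_apply] at h1 h2
  linarith

theorem effect_eq_of_pure {A : C} {a b : A ⟶ 𝟙_ C}
    (h : ∀ ψ : 𝟙_ C ⟶ A, IsPureSt₁ ψ → prob (ψ ≫ a) = prob (ψ ≫ b)) : a = b :=
  effect_ext fun σ => LinearMap.congr_fun (eq_of_pure (f := effFun a) (g := effFun b) h) (stVec σ)

theorem span_pure (A : C) :
    Submodule.span ℝ (stVec '' {ψ : 𝟙_ C ⟶ A | IsPureSt₁ ψ}) = ⊤ := by
  by_contra hne
  obtain ⟨f, hf, hle⟩ := Submodule.exists_le_ker_of_lt_top _ (lt_top_iff_ne_top.2 hne)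
  refine hf (eq_of_pure fun ψ hψ => ?_)
  simpa using hle (Submodule.subset_span ⟨ψ, hψ, rfl⟩)

theorem exists_pure_prob_eq_one {A : C} {a : A ⟶ 𝟙_ C} {σ : 𝟙_ C ⟶ A} (h : prob (σ ≫ a) = 1) :
    ∃ ψ : 𝟙_ C ⟶ A, IsPureSt₁ ψ ∧ prob (ψ ≫ a) = 1 := by
  obtain ⟨ψ, hψ, hmax⟩ := exists_pure_isMax (effFun a)
  exact ⟨ψ, hψ, le_antisymm (prob_le_one _)
    (h.symm.le.trans (hmax σ (normalised_of_prob_eq_one h)))⟩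

theorem IsReversible.symm {A B : C} {U : A ≅ B} (h : IsReversible U) : IsReversible U.symm :=
  ⟨h.2, h.1⟩

theorem IsPure.comp_reversible {A B D : C} {t : A ⟶ B} (ht : IsPure t) {U : B ≅ D}
    (hU : IsReversible U) : IsPure (t ≫ U.hom) := by
  intro Y _ D hD Z hZ hsum
  obtain ⟨p, hp, hp1, hpD⟩ := ht Y _ (hD.comp_channel hU.2) Z hZ
    (by simpa using hsum.comp (𝟙 _) U.inv)
  exact ⟨p, hp, hp1, fun j hj => by simpa using (hpD j hj).comp (𝟙 _) U.hom⟩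

theorem IsPure.reversible_comp {A B D : C} {t : B ⟶ D} (ht : IsPure t) {U : A ≅ B}
    (hU : IsReversible U) : IsPure (U.hom ≫ t) := by
  intro Y _ D hD Z hZ hsum
  obtain ⟨p, hp, hp1, hpD⟩ := ht Y _ (hD.channel_comp hU.2) Z hZ
    (by simpa using hsum.comp U.inv (𝟙 _))
  exact ⟨p, hp, hp1, fun j hj => by simpa using (hpD j hj).comp U.hom (𝟙 _)⟩

theorem isReversible_leftUnitor (A : C) : IsReversible (λ_ A) := (laws C).channel_leftUnitor A
theorem isReversible_rightUnitor (A : C) : IsReversible (ρ_ A) := (laws C).channel_rightUnitor A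
theorem isReversible_associator (A B D : C) : IsReversible (α_ A B D) :=
  (laws C).channel_associator A B D
theorem isReversible_braiding (A B : C) : IsReversible (β_ A B) :=
  ⟨(laws C).channel_braiding A B, by
    simpa [SymmetricCategory.braiding_swap_eq_inv_braiding] using (laws C).channel_braiding B A⟩

theorem IsPureSt₁.comp_reversible {A B : C} {ψ : 𝟙_ C ⟶ A} (h : IsPureSt₁ ψ) {U : A ≅ B}
    (hU : IsReversible U) : IsPureSt₁ (ψ ≫ U.hom) :=
  ⟨h.1.comp_reversible hU, normalised_iff.1 (h.normalised.comp hU.1)⟩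

theorem isMarginal_iff {A B : C} {Ψ : 𝟙_ C ⟶ A ⊗ B} {σ : 𝟙_ C ⟶ A} :
    IsMarginal Ψ σ ↔ sliceL Ψ (disc B) = σ := by
  constructor
  · rintro ⟨w, hw, h⟩
    rw [← eq_disc hw]; exact h
  · intro h
    exact ⟨_, isChannel_disc B, h⟩

/-- Two purifications of the same state differ by a reversible channel. -/
theorem exists_reversible {A B : C} {Ψ Ψ' : 𝟙_ C ⟶ A ⊗ B} (h : IsPureSt₁ Ψ) (h' : IsPureSt₁ Ψ')
    (hm : sliceL Ψ (disc B) = sliceL Ψ' (disc B)) :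
    ∃ U : B ≅ B, IsReversible U ∧ Ψ' = Ψ ≫ (A ◁ U.hom) :=
  hC.out.purification_unique _ Ψ Ψ' ⟨h, isMarginal_iff.2 rfl⟩ ⟨h', isMarginal_iff.2 hm.symm⟩

theorem exists_purification {A : C} {σ : 𝟙_ C ⟶ A} (h : Normalised σ) :
    ∃ (B : C) (Ψ : 𝟙_ C ⟶ A ⊗ B), IsPureSt₁ Ψ ∧ sliceL Ψ (disc B) = σ := by
  obtain ⟨B, Ψ, h1, h2⟩ := hC.out.exists_purification σ (normalised_iff.1 h)
  exact ⟨B, Ψ, h1, isMarginal_iff.1 h2⟩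

theorem exists_pure (A : C) : ∃ ψ : 𝟙_ C ⟶ A, IsPureSt₁ ψ := by
  obtain ⟨ψ, hψ, -⟩ := exists_pure_isMax (0 : StR A →ₗ[ℝ] ℝ)
  exact ⟨ψ, hψ⟩

/-- The reversible channels act transitively on the pure states: pure states are purifications of
the state of the trivial system. -/
theorem exists_reversible_pure {A : C} {ψ φ : 𝟙_ C ⟶ A} (hψ : IsPureSt₁ ψ) (hφ : IsPureSt₁ φ) :
    ∃ U : A ≅ A, IsReversible U ∧ φ = ψ ≫ U.hom := by
  have key : ∀ {χ : 𝟙_ C ⟶ A}, IsPureSt₁ χ → sliceL (χ ≫ (λ_ A).inv) (disc A) = 𝟙 _ := by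
    intro χ hχ
    apply scalar_ext
    rw [prob_id, ← hχ.normalised]
    congr 1
    simp [sliceL, ← unitors_equal]
  obtain ⟨U, hU, h⟩ := exists_reversible (hψ.comp_reversible (isReversible_leftUnitor A).symm)
    (hφ.comp_reversible (isReversible_leftUnitor A).symm) ((key hψ).trans (key hφ).symm)
  refine ⟨U, hU, ?_⟩
  have := congrArg (fun f => f ≫ (λ_ A).hom) h
  simpa using this

/-- Every normalised pure state is detected with certainty by some pure effect. -/
theorem exists_pure_effect {A : C} {ψ : 𝟙_ C ⟶ A} (hψ : IsPureSt₁ ψ) :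
    ∃ a : A ⟶ 𝟙_ C, IsPure a ∧ prob (ψ ≫ a) = 1 := by
  obtain ⟨a, σ, ha, h⟩ := exists_prob_eq_one C A
  obtain ⟨φ, hφ, h1⟩ := exists_pure_prob_eq_one h
  obtain ⟨U, hU, rfl⟩ := exists_reversible_pure hψ hφ
  exact ⟨U.hom ≫ a, ha.reversible_comp hU, by simpa using h1⟩

theorem IsPureSt₁.prodSt {A B : C} {σ : 𝟙_ C ⟶ A} {τ : 𝟙_ C ⟶ B} (hσ : IsPureSt₁ σ)
    (hτ : IsPureSt₁ τ) : IsPureSt₁ (prodSt σ τ) := by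
  refine ⟨(hC.out.pure_tensor _ _ hσ.1 hτ.1).reversible_comp (isReversible_leftUnitor _).symm,
    normalised_iff.1 ?_⟩
  rw [Normalised, ← prodEff_disc, prodSt_comp_prodEff, prob_comp, hσ.normalised, hτ.normalised,
    one_mul]

theorem Normalised.prodSt {A B : C} {σ : 𝟙_ C ⟶ A} {τ : 𝟙_ C ⟶ B} (hσ : Normalised σ)
    (hτ : Normalised τ) : Normalised (prodSt σ τ) := by
  rw [Normalised, ← prodEff_disc, prodSt_comp_prodEff, prob_comp, hσ, hτ, one_mul]

/-- If a test coarse-grains to the identity, then its outcomes have the same probabilities on all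
pure states. Were the probabilities different for two pure states, the pure effects detecting these
would perfectly distinguish the two; then a purification of the mixture of `ψ ⊗ ψ` and `φ ⊗ φ`
would steer the second system to either of them, and the test acts on that purification as a
multiple of the identity. -/
theorem prob_eq_of_isSum_id {X : C} {Y : Type} [Fintype Y] {T : Y → (X ⟶ X)} (hT : IsTest T)
    {Z : Finset Y} (hZ : Z.Nonempty) (hsum : IsSum (𝟙 X) Z T) {ψ φ : 𝟙_ C ⟶ X}
    (hψ : IsPureSt₁ ψ) (hφ : IsPureSt₁ φ) {j : Y} (hj : j ∈ Z) :
    prob (ψ ≫ T j ≫ disc X) = prob (φ ≫ T j ≫ disc X) := by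
  have act_pure : ∀ {ψ : 𝟙_ C ⟶ X}, IsPureSt₁ ψ → ∀ a : X ⟶ 𝟙_ C,
      prob (ψ ≫ T j ≫ a) = prob (ψ ≫ T j ≫ disc X) * prob (ψ ≫ a) := by
    intro ψ hψ a
    obtain ⟨p, -, -, hp⟩ := hψ.1 Y _ (hT.channel_comp hψ.normalised.isChannel) Z hZ
      (by simpa using hsum.comp ψ (𝟙 _))
    have h := isMultiple_state_iff.1 (hp j hj)
    simp only [Category.assoc] at h
    rw [h, h, hψ.normalised, mul_one]
  have zero_of_ne : ∀ {ψ φ : 𝟙_ C ⟶ X}, IsPureSt₁ ψ → IsPureSt₁ φ → ∀ a : X ⟶ 𝟙_ C, IsPure a →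
      prob (ψ ≫ a) = 1 → prob (ψ ≫ T j ≫ disc X) ≠ prob (φ ≫ T j ≫ disc X) →
      prob (φ ≫ a) = 0 := by
    intro ψ φ hψ hφ a ha h1 hne
    obtain ⟨X', _, f, x, hf, rfl⟩ := (laws C).exists_test a
    obtain ⟨t, ht, h2, -⟩ := (by classical exact hf.split {x})
    have htf : t true = f x := effect_ext fun σ => by
      rw [isSum_effect_iff.1 h2 σ, Finset.sum_singleton]
    rw [← htf] at ha h1 ⊢
    obtain ⟨p, -, -, hp⟩ := ha (Y × Bool) _ ((laws C).test_comp _ _ hT ht)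
      (Z ×ˢ {true}) (by simpa using hZ) (by
        have := hsum.comp (𝟙 _) (t true)
        rw [isSum_effect_iff] at this ⊢
        simpa [Finset.sum_product] using this)
    have h := isMultiple_effect_iff.1 (hp (j, true) (by simpa using hj))
    have e1 := h ψ
    have e2 := h φ
    rw [act_pure hψ, h1] at e1
    rw [act_pure hφ] at e2
    rw [mul_one, mul_one] at e1
    rw [← e1] at e2
    by_contra h0
    exact hne (mul_right_cancel₀ h0 e2.symm)
  by_contra hne
  obtain ⟨a, ha, ha1⟩ := exists_pure_effect hψ
  obtain ⟨b, hb, hb1⟩ := exists_pure_effect hφ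
  have ha0 := zero_of_ne hψ hφ a ha ha1 hne
  have hb0 := zero_of_ne hφ hψ b hb hb1 (Ne.symm hne)
  obtain ⟨ω, hω⟩ := exists_add (hψ.prodSt hψ).normalised (hφ.prodSt hφ).normalised
    (p := 1 / 2) (r := 1 / 2) (by norm_num) (by norm_num) (by norm_num)
  have hωp : ∀ e, prob (ω ≫ e) = 1 / 2 * prob (prodSt ψ ψ ≫ e) + 1 / 2 * prob (prodSt φ φ ≫ e) := by
    intro e
    have := congrArg (effFun e) hω
    simpa [effFun_stVec] using this
  have hωn : Normalised ω := by
    rw [Normalised, hωp, (hψ.prodSt hψ).normalised, (hφ.prodSt hφ).normalised]; norm_num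
  obtain ⟨E, Γ, hΓ, hΓm⟩ := exists_purification hωn
  obtain ⟨p, -, -, hp⟩ := hΓ.1 Y _
    (((hT.whiskerRight X).whiskerRight E).channel_comp hΓ.normalised.isChannel) Z hZ
    (by simpa using (((hsum.whiskerRight X).whiskerRight E).comp Γ (𝟙 _)))
  have hΓp := isMultiple_state_iff.1 (hp j hj)
  have hval : ∀ e : X ⟶ 𝟙_ C, prob (prodSt ψ ψ ≫ (T j ▷ X) ≫ prodEff (disc X) e)
      + prob (prodSt φ φ ≫ (T j ▷ X) ≫ prodEff (disc X) e) =
      p j * (prob (prodSt ψ ψ ≫ prodEff (disc X) e) + prob (prodSt φ φ ≫ prodEff (disc X) e)) := by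
    intro e
    have h := hΓp (prodEff (prodEff (disc X) e) (disc E))
    rw [Category.assoc, whiskerRight_comp_prodEff, ← sliceL_comp, ← sliceL_comp, hΓm, hωp, hωp] at h
    linarith
  have h1 := hval a
  have h2 := hval b
  simp only [whiskerRight_comp_prodEff, prodSt_comp_prodEff, prob_comp, ha1, ha0, hb1, hb0] at h1 h2
  apply hne
  have e1 : prob (ψ ≫ disc X) = 1 := hψ.normalised
  have e2 : prob (φ ≫ disc X) = 1 := hφ.normalised
  simp only [e1, e2] at h1 h2
  linarith

/-- The identity is pure. -/
theorem isPure_id (A : C) : IsPure (𝟙 A) := by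
  intro Y _ T hT Z hZ hsum
  obtain ⟨α, hα⟩ := exists_pure A
  refine ⟨fun j => prob (α ≫ T j ≫ disc A), fun j _ => prob_nonneg _, ?_, fun j hj S Ψ E => ?_⟩
  · have := isSum_effect_iff.1 (by simpa using hsum.comp (𝟙 _) (disc A)) α
    rw [← this]; exact hα.normalised
  · have hTS := hT.whiskerRight S
    have hsS : IsSum (𝟙 (A ⊗ S)) Z (fun j => T j ▷ S) := by simpa using hsum.whiskerRight S
    obtain ⟨σ, hσ⟩ := exists_pure S
    have h0 : prob (prodSt α σ ≫ (T j ▷ S) ≫ disc (A ⊗ S)) = prob (α ≫ T j ≫ disc A) := by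
      rw [← prodEff_disc, whiskerRight_comp_prodEff, prodSt_comp_prodEff, prob_comp]
      have : prob (σ ≫ disc S) = 1 := hσ.normalised
      rw [this, mul_one]
    have hlin : effFun ((T j ▷ S) ≫ E) = prob (α ≫ T j ≫ disc A) • effFun E := by
      refine eq_of_pure fun ψ hψ => ?_
      obtain ⟨p, -, -, hp⟩ := hψ.1 Y _ (hTS.channel_comp hψ.normalised.isChannel) Z hZ
        (by simpa using hsS.comp ψ (𝟙 _))
      have h := isMultiple_state_iff.1 (hp j hj)
      simp only [Category.assoc] at h
      have hpj := h (disc _)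
      have hn : prob (ψ ≫ disc (A ⊗ S)) = 1 := hψ.normalised
      rw [hn, mul_one, prob_eq_of_isSum_id hTS hZ hsS hψ (hα.prodSt hσ) hj, h0] at hpj
      rw [effFun_stVec, h, ← hpj]
      rfl
    have := LinearMap.congr_fun hlin (stVec Ψ)
    rw [effFun_stVec] at this
    simpa [circuitProb, effFun_stVec] using this

theorem IsReversible.isPure {A B : C} {U : A ≅ B} (hU : IsReversible U) : IsPure U.hom := by
  simpa using (isPure_id A).comp_reversible hU

theorem IsPure.comp {A B D : C} {s : A ⟶ B} {t : B ⟶ D} (hs : IsPure s) (ht : IsPure t) :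
    IsPure (s ≫ t) := hC.out.pure_comp s t hs ht

theorem IsPure.whiskerRight {A B : C} {t : A ⟶ B} (ht : IsPure t) (S : C) : IsPure (t ▷ S) := by
  simpa using hC.out.pure_tensor t (𝟙 S) ht (isPure_id S)

theorem IsPure.whiskerLeft {A B : C} {t : A ⟶ B} (ht : IsPure t) (S : C) : IsPure (S ◁ t) := by
  simpa using hC.out.pure_tensor (𝟙 S) t (isPure_id S) ht

theorem IsPure.prodEff {A B : C} {a : A ⟶ 𝟙_ C} {b : B ⟶ 𝟙_ C} (ha : IsPure a) (hb : IsPure b) :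
    IsPure (prodEff a b) :=
  (hC.out.pure_tensor a b ha hb).comp (isReversible_leftUnitor _).isPure

theorem IsPure.sliceL {A B : C} {Ψ : 𝟙_ C ⟶ A ⊗ B} (hΨ : IsPure Ψ) {b : B ⟶ 𝟙_ C} (hb : IsPure b) :
    IsPure (sliceL Ψ b) :=
  hΨ.comp ((hb.whiskerLeft A).comp (isReversible_rightUnitor A).isPure)

theorem IsPure.sliceR {A B : C} {Ψ : 𝟙_ C ⟶ A ⊗ B} (hΨ : IsPure Ψ) {a : A ⟶ 𝟙_ C} (ha : IsPure a) :
    IsPure (sliceR Ψ a) :=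
  hΨ.comp ((ha.whiskerRight B).comp (isReversible_leftUnitor B).isPure)

theorem IsPure.effSliceL {A B : C} {E : A ⊗ B ⟶ 𝟙_ C} (hE : IsPure E) {τ : 𝟙_ C ⟶ B}
    (hτ : IsPure τ) : IsPure (effSliceL E τ) :=
  (isReversible_rightUnitor A).symm.isPure.comp ((hτ.whiskerLeft A).comp hE)

theorem IsPure.teleport {A B D : C} {E : A ⊗ B ⟶ 𝟙_ C} (hE : IsPure E) {Ψ : 𝟙_ C ⟶ D ⊗ B}
    (hΨ : IsPure Ψ) : IsPure (teleport E Ψ) :=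
  (isReversible_rightUnitor A).symm.isPure.comp
    (((hΨ.comp (isReversible_braiding D B).isPure).whiskerLeft A).comp
      ((isReversible_associator A B D).symm.isPure.comp
        ((hE.whiskerRight D).comp (isReversible_leftUnitor D).isPure)))

end Pure

/-! ### Centroids of convex bodies -/

section Centroid

open MeasureTheory

/-- The centroid of a convex body is fixed by every linear automorphism of the body, and it lies on
no supporting hyperplane through the origin. -/
theorem exists_centroid {E : Type*} [NormedAddCommGroup E] [NormedSpace ℝ E]
    [FiniteDimensional ℝ E] {K : Set E} (hK : IsCompact K) (hc : Convex ℝ K)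
    (hi : (interior K).Nonempty) :
    ∃ c ∈ K, (∀ g : E ≃ₗ[ℝ] E, g '' K = K → g c = c) ∧
      ∀ f : E →ₗ[ℝ] ℝ, (∀ x ∈ K, 0 ≤ f x) → f c = 0 → f = 0 := by
  borelize E
  let μ : Measure E := Measure.addHaar
  have h0 : μ K ≠ 0 := (Measure.measure_pos_of_nonempty_interior μ hi).ne'
  have hfin : μ K ≠ ⊤ := hK.measure_lt_top.ne
  have hint : IntegrableOn (fun x : E => x) K μ :=
    continuous_id.continuousOn.integrableOn_compact hK
  have hr : μ.real K ≠ 0 := ENNReal.toReal_ne_zero.2 ⟨h0, hfin⟩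
  refine ⟨⨍ x in K, x ∂μ, hc.set_average_mem hK.isClosed h0 hfin
    ((ae_restrict_iff' hK.measurableSet).2 (Filter.Eventually.of_forall fun _ h => h)) hint, ?_, ?_⟩
  · intro g hg
    have hdet : |LinearMap.det (g : E →ₗ[ℝ] E)| = 1 := by
      have := Measure.addHaar_image_linearMap μ (g : E →ₗ[ℝ] E) K
      rw [LinearEquiv.coe_coe, hg] at this
      have h1 := (ENNReal.mul_eq_right h0 hfin).1 this.symm
      rwa [ENNReal.ofReal_eq_one] at h1
    let G : E →L[ℝ] E := LinearMap.toContinuousLinearMap (g : E →ₗ[ℝ] E)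
    have hG : ∀ x, G x = g x := fun x => rfl
    have himg := integral_image_eq_integral_abs_det_fderiv_smul μ hK.measurableSet
      (f := g) (f' := fun _ => G) (fun x _ => G.hasFDerivAt.hasFDerivWithinAt)
      g.injective.injOn (fun x : E => x)
    have hdG : |G.det| = 1 := hdet
    rw [hg] at himg
    simp only [hdG, one_smul] at himg
    rw [setAverage_eq, ← hG, map_smul, ← G.integral_comp_comm hint]
    simp only [hG]
    rw [← himg]
  · intro f hf hfc
    by_contra hne
    obtain ⟨w, hw⟩ : ∃ w, f w ≠ 0 := by
      by_contra h; push Not at h; exact hne (LinearMap.ext h)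
    obtain ⟨v, hv⟩ : ∃ v, 0 < f v := by
      rcases hw.lt_or_gt with h | h
      · exact ⟨-w, by simpa using h⟩
      · exact ⟨w, h⟩
    let F : E →L[ℝ] ℝ := LinearMap.toContinuousLinearMap f
    have hF : ∀ x, F x = f x := fun x => rfl
    have hzero : ∫ x in K, F x ∂μ = 0 := by
      rw [← hF, setAverage_eq, map_smul, ← F.integral_comp_comm hint, smul_eq_mul,
        mul_eq_zero] at hfc
      exact hfc.resolve_left (inv_ne_zero hr)
    have hpos : 0 < ∫ x in K, F x ∂μ := by
      refine (setIntegral_pos_iff_support_of_nonneg_ae (f := fun x => F x)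
        ((ae_restrict_iff' hK.measurableSet).2 (Filter.Eventually.of_forall hf))
        (F.continuous.continuousOn.integrableOn_compact hK)).2 ?_
      have hopen : IsOpen (interior K ∩ {x | 0 < F x}) :=
        isOpen_interior.inter (isOpen_lt continuous_const F.continuous)
      obtain ⟨x, hx⟩ := hi
      have hne : (interior K ∩ {x | 0 < F x}).Nonempty := by
        have hcont : Continuous fun t : ℝ => x + t • v := by fun_prop
        have hev : ∀ᶠ t : ℝ in nhdsWithin 0 (Set.Ioi 0), x + t • v ∈ interior K := by
          refine Filter.Eventually.filter_mono nhdsWithin_le_nhds ?_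
          exact hcont.continuousAt.eventually_mem (by simpa using isOpen_interior.mem_nhds hx)
        obtain ⟨t, ht, ht0⟩ := (hev.and self_mem_nhdsWithin).exists
        refine ⟨x + t • v, ht, ?_⟩
        have h1 := hf x (interior_subset hx)
        have h2 : 0 < t * f v := mul_pos ht0 hv
        show 0 < F (x + t • v)
        rw [hF, map_add, map_smul, smul_eq_mul]
        linarith
      refine (hopen.measure_pos μ hne).trans_le (measure_mono ?_)
      rintro y ⟨hy, hy0⟩
      exact ⟨(show 0 < F y from hy0).ne', interior_subset hy⟩
    linarith

end Centroid

/-! ### States of pure effects, and transfer of purifications -/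

section Purification

set_option linter.unusedSectionVars false

variable {C : Type u} [Category.{v} C] [MonoidalCategory C] [SymmetricCategory C] [OPTData C]
  [hC : Fact (IsSharpTheoryWithPurification C)]

theorem isPureSt₁_of_pure {A : C} {σ : 𝟙_ C ⟶ A} (h : IsPure σ) (hn : Normalised σ) :
    IsPureSt₁ σ := ⟨h, normalised_iff.1 hn⟩

theorem exists_reversible_left {A B : C} {Ψ Ψ' : 𝟙_ C ⟶ A ⊗ B} (h : IsPureSt₁ Ψ)
    (h' : IsPureSt₁ Ψ') (hm : sliceR Ψ (disc A) = sliceR Ψ' (disc A)) :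
    ∃ U : A ≅ A, IsReversible U ∧ Ψ' = Ψ ≫ (U.hom ▷ B) := by
  obtain ⟨U, hU, hΨ⟩ := exists_reversible (h.comp_reversible (isReversible_braiding A B))
    (h'.comp_reversible (isReversible_braiding A B)) (by rw [sliceL_braiding, sliceL_braiding, hm])
  refine ⟨U, hU, ?_⟩
  have := congrArg (fun f => f ≫ (β_ A B).inv) hΨ
  simpa [← BraidedCategory.braiding_naturality_left_assoc] using this

/-- A state on which a pure effect occurs with certainty is pure: the effect, applied to a
purification, leaves the purifying system in a pure state, so that the purification is a product. -/
theorem isPureSt₁_of_prob_eq_one {A : C} {a : A ⟶ 𝟙_ C} (ha : IsPure a) {σ : 𝟙_ C ⟶ A}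
    (h : prob (σ ≫ a) = 1) : IsPureSt₁ σ := by
  have hσ := normalised_of_prob_eq_one h
  obtain ⟨B, Ψ, hΨ, hm⟩ := exists_purification hσ
  obtain ⟨a', -, ha'⟩ := exists_compl a
  have h0 : prob (σ ≫ a') = 0 := by
    have := ha' σ
    rw [hσ, h] at this; linarith
  have hmarg : sliceR Ψ (disc A) = sliceR Ψ a := state_ext fun b => by
    have h1 : prob (sliceL Ψ b ≫ a') = 0 := by
      refine le_antisymm ?_ (prob_nonneg _)
      rw [← sliceR_comp_eq, ← h0, ← hm, ← sliceR_comp_eq]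
      exact prob_comp_le_disc _ _
    rw [sliceR_comp_eq, sliceR_comp_eq, ← ha', h1, add_zero]
  have hβ : IsPureSt₁ (sliceR Ψ a) := isPureSt₁_of_pure (hΨ.1.sliceR ha) (by
    rw [Normalised, sliceR_comp_eq, hm, h])
  obtain ⟨α, hα⟩ := exists_pure A
  obtain ⟨U, hU, hΨU⟩ := exists_reversible_left (hα.prodSt hβ) hΨ (by
    rw [sliceR_prodSt, hmarg, scalar_ext (hα.normalised.trans prob_id.symm), Category.id_comp])
  rw [prodSt_comp_whiskerRight] at hΨU
  rw [← hm, hΨU, sliceL_prodSt, scalar_ext (hβ.normalised.trans prob_id.symm), Category.id_comp]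
  exact hα.comp_reversible hU

/-- A pure effect occurs with certainty on at most one state: it also does so on a mixture of two
such states, which is therefore pure. -/
theorem eq_of_prob_eq_one {A : C} {a : A ⟶ 𝟙_ C} (ha : IsPure a) {σ τ : 𝟙_ C ⟶ A}
    (hσ : prob (σ ≫ a) = 1) (hτ : prob (τ ≫ a) = 1) : σ = τ := by
  have hσn := normalised_of_prob_eq_one hσ
  have hτn := normalised_of_prob_eq_one hτ
  obtain ⟨ω, hω⟩ := exists_add hσn hτn (p := 1 / 2) (r := 1 / 2) (by norm_num) (by norm_num)
    (by norm_num)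
  have h1 : prob (ω ≫ a) = 1 := by
    rw [← effFun_stVec, hω, map_add, map_smul, map_smul, effFun_stVec, effFun_stVec, hσ, hτ]
    norm_num
  have hωp := isPureSt₁_of_prob_eq_one ha h1
  have key : ∀ κ ν : 𝟙_ C ⟶ A, Normalised κ →
      (1 / 2 : ℝ) • stVec κ + (1 / 2 : ℝ) • stVec ν = stVec ω → κ = ω := by
    intro κ ν hκ h
    obtain ⟨c, -, hc⟩ := hωp.1.extremal
      (smul_mem_StCone (stVec_mem_StCone κ) (by norm_num : (0 : ℝ) ≤ 1 / 2))
      (smul_mem_StCone (stVec_mem_StCone ν) (by norm_num : (0 : ℝ) ≤ 1 / 2)) h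
    have h2 := congrArg (effFun (disc A)) hc
    rw [map_smul, map_smul, effFun_stVec, effFun_stVec, hκ, hωp.normalised] at h2
    have h3 : c = 1 / 2 := by simpa using h2.symm
    rw [h3] at hc
    exact stVec_injective (smul_right_injective _ (by norm_num : (1 / 2 : ℝ) ≠ 0) hc)
  rw [key σ τ hσn hω.symm, key τ σ hτn (by rw [add_comm]; exact hω.symm)]

/-- Two purifications of one state, with possibly different purifying systems, are related by a pure
transformation of the purifying systems. -/
theorem exists_pure_transfer {A B B' : C} {Ψ : 𝟙_ C ⟶ A ⊗ B} {Ψ' : 𝟙_ C ⟶ A ⊗ B'}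
    (h : IsPureSt₁ Ψ) (h' : IsPureSt₁ Ψ') (hm : sliceL Ψ (disc B) = sliceL Ψ' (disc B')) :
    ∃ t : B ⟶ B', IsPure t ∧ Ψ' = Ψ ≫ (A ◁ t) := by
  obtain ⟨b, hb⟩ := exists_pure B
  obtain ⟨b', hb'⟩ := exists_pure B'
  obtain ⟨e, he, heb⟩ := exists_pure_effect hb
  let s : B ⟶ B ⊗ B' := (ρ_ B).inv ≫ (B ◁ b')
  let s' : B' ⟶ B ⊗ B' := (λ_ B').inv ≫ (b ▷ B')
  let r : B ⊗ B' ⟶ B' := (e ▷ B') ≫ (λ_ B').hom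
  have hsr : s' ≫ r = 𝟙 B' := by
    have : b ≫ e = 𝟙 _ := scalar_ext (heb.trans prob_id.symm)
    simp only [s', r, Category.assoc, ← comp_whiskerRight_assoc, this]
    simp
  have hs : IsPure s := (isReversible_rightUnitor B).symm.isPure.comp (hb'.1.whiskerLeft B)
  have hs' : IsPure s' := (isReversible_leftUnitor B').symm.isPure.comp (hb.1.whiskerRight B')
  have hr : IsPure r := (he.whiskerRight B').comp (isReversible_leftUnitor B').isPure
  have hsc : IsChannel s := (isReversible_rightUnitor B).2.comp
    (hb'.normalised.isChannel.whiskerLeft B)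
  have hsc' : IsChannel s' := (isReversible_leftUnitor B').2.comp
    (hb.normalised.isChannel.whiskerRight B')
  obtain ⟨U, hU, hΨU⟩ := exists_reversible
    (isPureSt₁_of_pure (h.1.comp (hs.whiskerLeft A)) (h.normalised.comp (hsc.whiskerLeft A)))
    (isPureSt₁_of_pure (h'.1.comp (hs'.whiskerLeft A)) (h'.normalised.comp (hsc'.whiskerLeft A)))
    (by rw [sliceL_whiskerLeft, sliceL_whiskerLeft, hsc.comp_disc, hsc'.comp_disc, hm])
  refine ⟨s ≫ U.hom ≫ r, hs.comp (hU.isPure.comp hr), ?_⟩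
  calc Ψ' = (Ψ' ≫ (A ◁ s')) ≫ (A ◁ r) := by
        rw [Category.assoc, ← whiskerLeft_comp, hsr]; simp
    _ = _ := by rw [hΨU]; simp

theorem exists_pure_transfer_left {A A' B : C} {Ψ : 𝟙_ C ⟶ A ⊗ B} {Ψ' : 𝟙_ C ⟶ A' ⊗ B}
    (h : IsPureSt₁ Ψ) (h' : IsPureSt₁ Ψ') (hm : sliceR Ψ (disc A) = sliceR Ψ' (disc A')) :
    ∃ t : A ⟶ A', IsPure t ∧ Ψ' = Ψ ≫ (t ▷ B) := by
  obtain ⟨t, ht, hΨ⟩ := exists_pure_transfer (h.comp_reversible (isReversible_braiding A B))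
    (h'.comp_reversible (isReversible_braiding A' B)) (by rw [sliceL_braiding, sliceL_braiding, hm])
  refine ⟨t, ht, ?_⟩
  have := congrArg (fun f => f ≫ (β_ A' B).inv) hΨ
  simpa [← BraidedCategory.braiding_naturality_left_assoc] using this

theorem convex_range_stVec (A : C) : Convex ℝ (Set.range (stVec : (𝟙_ C ⟶ A) → StR A)) := by
  rintro _ ⟨σ, rfl⟩ _ ⟨τ, rfl⟩ p r hp hr hpr
  refine exists_state_of_mem_StCone (Submodule.add_mem _
    (smul_mem_StCone (stVec_mem_StCone σ) hp) (smul_mem_StCone (stVec_mem_StCone τ) hr)) ?_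
  rw [map_add, map_smul, map_smul, effFun_stVec, effFun_stVec, smul_eq_mul, smul_eq_mul]
  have h1 := mul_le_mul_of_nonneg_left (prob_le_one (σ ≫ disc A)) hp
  have h2 := mul_le_mul_of_nonneg_left (prob_le_one (τ ≫ disc A)) hr
  linarith

theorem act_comp {A B D : C} (s : A ⟶ B) (t : B ⟶ D) (x : StR A) :
    act (s ≫ t) x = act t (act s x) :=
  vec_ext fun a => by simp only [effFun_act, Category.assoc]

theorem act_id {A : C} (x : StR A) : act (𝟙 A) x = x :=
  vec_ext fun a => by simp only [effFun_act, Category.id_comp]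

/-- The linear automorphism given by an isomorphism of systems. -/
def actEquiv {A B : C} (U : A ≅ B) : StR A ≃ₗ[ℝ] StR B :=
  LinearEquiv.ofLinearMap (act U.hom) (act U.inv)
    (LinearMap.ext fun x => by simp [← act_comp, act_id])
    (LinearMap.ext fun x => by simp [← act_comp, act_id])

theorem actEquiv_apply {A B : C} (U : A ≅ B) (x : StR A) : actEquiv U x = act U.hom x := rfl

variable (C) in
/-- Every system has a normalised state that is invariant under all reversible channels and on which
no nonzero effect vanishes. -/
theorem exists_invariant_state (A : C) : ∃ χ : 𝟙_ C ⟶ A, Normalised χ ∧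
    (∀ U : A ≅ A, χ ≫ U.hom = χ) ∧
    ∀ f : StR A →ₗ[ℝ] ℝ, (∀ x ∈ StCone A, 0 ≤ f x) → f (stVec χ) = 0 → f = 0 := by
  let n := Module.finrank ℝ (StR A)
  let φ : StR A ≃L[ℝ] EuclideanSpace ℝ (Fin n) :=
    ContinuousLinearEquiv.ofFinrankEq (by simp [n])
  let K : Set (StR A) := Set.range stVec
  have hK : IsCompact (φ '' K) := (isCompact_range_stVec A).image φ.continuous
  have hKc : Convex ℝ (φ '' K) := (convex_range_stVec A).is_linear_image φ.toLinearMap.isLinear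
  have h0K : (0 : StR A) ∈ K := by
    obtain ⟨σ, hσ⟩ := exists_state_of_mem_StCone (zero_mem (StCone A)) (by simp)
    exact ⟨σ, hσ⟩
  have h0 : (0 : EuclideanSpace ℝ (Fin n)) ∈ φ '' K := ⟨0, h0K, map_zero φ⟩
  have hi : (interior (φ '' K)).Nonempty := by
    rw [hKc.interior_nonempty_iff_affineSpan_eq_top,
      AffineSubspace.affineSpan_eq_top_iff_vectorSpan_eq_top_of_nonempty _ _ _ ⟨0, h0⟩, eq_top_iff,
      vectorSpan_eq_span_vsub_set_right ℝ h0]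
    have : (fun x : EuclideanSpace ℝ (Fin n) => x -ᵥ (0 : EuclideanSpace ℝ (Fin n))) '' (φ '' K) =
        (φ : StR A →ₗ[ℝ] EuclideanSpace ℝ (Fin n)) '' K := by simp
    rw [this, Submodule.span_image, span_range_stVec, Submodule.map_top]
    exact (LinearMap.range_eq_top.2 φ.surjective).ge
  obtain ⟨c, ⟨_, ⟨σ, rfl⟩, rfl⟩, hinv, hpos⟩ := exists_centroid hK hKc hi
  have hinv' : ∀ U : A ≅ A, act U.hom (stVec σ) = stVec σ := by
    intro U
    have := hinv (φ.symm.toLinearEquiv.trans ((actEquiv U).trans φ.toLinearEquiv)) (by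
      rw [Set.image_image]
      have : ∀ x, (φ.symm.toLinearEquiv.trans ((actEquiv U).trans φ.toLinearEquiv)) (φ x) =
          φ (act U.hom x) := fun x => by simp [actEquiv_apply]
      simp only [this]
      apply Set.Subset.antisymm
      · rintro _ ⟨_, ⟨τ, rfl⟩, rfl⟩
        exact ⟨_, ⟨τ ≫ U.hom, rfl⟩, by simp [act_stVec]⟩
      · rintro _ ⟨_, ⟨τ, rfl⟩, rfl⟩
        exact ⟨_, ⟨τ ≫ U.inv, rfl⟩, by simp [act_stVec]⟩)
    apply φ.injective
    simpa [actEquiv_apply] using this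
  have hpos' : ∀ f : StR A →ₗ[ℝ] ℝ, (∀ x ∈ StCone A, 0 ≤ f x) → f (stVec σ) = 0 → f = 0 := by
    intro f hf hfσ
    have := hpos (f ∘ₗ (φ.symm : EuclideanSpace ℝ (Fin n) →ₗ[ℝ] StR A)) (by
      rintro _ ⟨_, ⟨τ, rfl⟩, rfl⟩
      simpa using hf _ (stVec_mem_StCone τ)) (by simpa using hfσ)
    ext1 x
    simpa using LinearMap.congr_fun this (φ x)
  have hne : prob (σ ≫ disc A) ≠ 0 := by
    intro h
    have := hpos' (effFun (disc A)) (fun x hx => effFun_nonneg _ hx) h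
    obtain ⟨τ, hτ⟩ := exists_normalised C A
    have h1 : effFun (disc A) (stVec τ) = 1 := hτ
    rw [this] at h1
    simp at h1
  obtain ⟨χ, hχ, hσχ⟩ := exists_normalised_smul σ hne
  refine ⟨χ, hχ, fun U => ?_, fun f hf hfχ => hpos' f hf (by rw [hσχ, map_smul, hfχ, smul_zero])⟩
  apply stVec_injective
  rw [← act_stVec]
  have := hinv' U
  rw [hσχ, map_smul] at this
  exact smul_right_injective _ hne this

end Purification

/-! ### The invariant state, the Bell state and the dagger of pure states -/

section Bell

set_option linter.unusedSectionVars false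

variable {C : Type u} [Category.{v} C] [MonoidalCategory C] [SymmetricCategory C] [OPTData C]
  [hC : Fact (IsSharpTheoryWithPurification C)]

/-- A normalised state of `A` that is invariant under all reversible channels and on which no
nonzero effect vanishes. -/
noncomputable def invState (A : C) : 𝟙_ C ⟶ A := (exists_invariant_state C A).choose

theorem normalised_invState (A : C) : Normalised (invState A) :=
  (exists_invariant_state C A).choose_spec.1

theorem invState_comp {A : C} (U : A ≅ A) : invState A ≫ U.hom = invState A :=
  (exists_invariant_state C A).choose_spec.2.1 U

theorem eq_zero_of_invState {A : C} {f : StR A →ₗ[ℝ] ℝ} (hf : ∀ x ∈ StCone A, 0 ≤ f x)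
    (h : f (stVec (invState A)) = 0) : f = 0 :=
  (exists_invariant_state C A).choose_spec.2.2 f hf h

/-- The system purifying the invariant state of `A`. -/
noncomputable def bar (A : C) : C := (exists_purification (normalised_invState A)).choose

/-- A purification of the invariant state, in the role of a maximally entangled state. -/
noncomputable def bell (A : C) : 𝟙_ C ⟶ A ⊗ bar A :=
  (exists_purification (normalised_invState A)).choose_spec.choose

theorem isPureSt₁_bell (A : C) : IsPureSt₁ (bell A) :=
  (exists_purification (normalised_invState A)).choose_spec.choose_spec.1

theorem sliceL_bell_disc (A : C) : sliceL (bell A) (disc (bar A)) = invState A :=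
  (exists_purification (normalised_invState A)).choose_spec.choose_spec.2

theorem IsPure.exists_smul {A : C} {σ : 𝟙_ C ⟶ A} (h : IsPure σ) (h0 : prob (σ ≫ disc A) ≠ 0) :
    ∃ ψ : 𝟙_ C ⟶ A, IsPureSt₁ ψ ∧ stVec σ = prob (σ ≫ disc A) • stVec ψ := by
  obtain ⟨ψ, hψ, hσ⟩ := exists_normalised_smul σ h0
  refine ⟨ψ, isPureSt₁_of_pure (isPure_of_extremal hψ fun y hy z hz hyz => ?_) hψ, hσ⟩
  have hp := prob_nonneg (σ ≫ disc A)
  obtain ⟨c, -, hc⟩ := h.extremal (smul_mem_StCone hy hp) (smul_mem_StCone hz hp)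
    (by rw [← smul_add, hyz, hσ])
  refine ⟨c, ?_⟩
  rw [hσ, smul_comm] at hc
  exact smul_right_injective _ h0 hc

theorem prob_invState_ne_zero {A : C} {a : A ⟶ 𝟙_ C} {σ : 𝟙_ C ⟶ A} (h : prob (σ ≫ a) = 1) :
    prob (invState A ≫ a) ≠ 0 := by
  intro h0
  have := eq_zero_of_invState (f := effFun a) (fun x hx => effFun_nonneg a hx) h0
  have h1 : effFun a (stVec σ) = 1 := h
  rw [this] at h1
  simp at h1

theorem prob_sliceR_bell_disc {A : C} (a : A ⟶ 𝟙_ C) :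
    prob (sliceR (bell A) a ≫ disc (bar A)) = prob (invState A ≫ a) := by
  rw [sliceR_comp_eq, sliceL_bell_disc]

/-- Conjugation of pure states: a pure effect that occurs with certainty on `α` steers the Bell
state to a pure state `β`, and conversely each pure effect that occurs with certainty on `β` steers
it to `α`, with the same probability. -/
theorem exists_conj {A : C} {α : 𝟙_ C ⟶ A} (hα : IsPureSt₁ α) {a : A ⟶ 𝟙_ C} (ha : IsPure a)
    (h : prob (α ≫ a) = 1) : ∃ β : 𝟙_ C ⟶ bar A, IsPureSt₁ β ∧
      stVec (sliceR (bell A) a) = prob (invState A ≫ a) • stVec β ∧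
      ∀ b : bar A ⟶ 𝟙_ C, IsPure b → prob (β ≫ b) = 1 →
        stVec (sliceL (bell A) b) = prob (invState A ≫ a) • stVec α := by
  have hq := prob_invState_ne_zero h
  obtain ⟨β, hβ, hsβ⟩ := ((isPureSt₁_bell A).1.sliceR ha).exists_smul
    (by rwa [prob_sliceR_bell_disc])
  rw [prob_sliceR_bell_disc] at hsβ
  refine ⟨β, hβ, hsβ, fun b hb hβb => ?_⟩
  have e1 : prob (sliceL (bell A) b ≫ a) = prob (invState A ≫ a) := by
    rw [← sliceR_comp_eq, ← effFun_stVec, hsβ, map_smul, effFun_stVec, hβb, smul_eq_mul, mul_one]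
  have hle : prob (invState A ≫ a) ≤ prob (sliceL (bell A) b ≫ disc A) :=
    e1 ▸ prob_comp_le_disc _ _
  have hpos : 0 < prob (invState A ≫ a) := lt_of_le_of_ne (prob_nonneg _) hq.symm
  obtain ⟨α', hα', hsα⟩ := ((isPureSt₁_bell A).1.sliceL hb).exists_smul (hpos.trans_le hle).ne'
  -- transporting `a` to `α'` by a reversible channel preserves its probability on the
  -- invariant state, which bounds the probability of `b`
  obtain ⟨U, hU, rfl⟩ := exists_reversible_pure hα hα'
  have e2 : prob (sliceL (bell A) b ≫ disc A) ≤ prob (invState A ≫ a) := by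
    have h1 : prob (invState A ≫ U.inv ≫ a) = prob (invState A ≫ a) := by
      have := invState_comp U.symm
      rw [Iso.symm_hom] at this
      rw [← Category.assoc, this]
    have h2 : prob (sliceL (bell A) b ≫ U.inv ≫ a) = prob (sliceL (bell A) b ≫ disc A) := by
      rw [← effFun_stVec, hsα, map_smul, effFun_stVec]
      simp [h]
    rw [← h1, ← h2, ← sliceR_comp_eq, ← prob_sliceR_bell_disc]
    exact prob_comp_le_disc _ _
  have e3 := le_antisymm e2 hle
  rw [e3] at hsα
  have e4 : prob ((α ≫ U.hom) ≫ a) = 1 := by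
    have := e1
    rw [← effFun_stVec, hsα, map_smul, effFun_stVec, smul_eq_mul] at this
    exact mul_left_cancel₀ hq (by rw [this, mul_one])
  rw [hsα, eq_of_prob_eq_one ha e4 h]

/-- At most one pure effect occurs with certainty on a given pure state: two such effects steer the
Bell state to the same state, with the same probability. -/
theorem pure_effect_unique {A : C} {α : 𝟙_ C ⟶ A} (hα : IsPureSt₁ α) {a a' : A ⟶ 𝟙_ C}
    (ha : IsPure a) (ha' : IsPure a') (h : prob (α ≫ a) = 1) (h' : prob (α ≫ a') = 1) :
    a = a' := by
  obtain ⟨β, hβ, hs, hb⟩ := exists_conj hα ha h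
  obtain ⟨β', hβ', hs', hb'⟩ := exists_conj hα ha' h'
  obtain ⟨b, hbp, hbβ⟩ := exists_pure_effect hβ
  obtain ⟨b', hbp', hbβ'⟩ := exists_pure_effect hβ'
  have hq := prob_invState_ne_zero h
  have hq' := prob_invState_ne_zero h'
  have e : ∀ (c : A ⟶ 𝟙_ C) (b : bar A ⟶ 𝟙_ C) (τ : 𝟙_ C ⟶ bar A) (p r : ℝ),
      stVec (sliceR (bell A) c) = p • stVec τ → stVec (sliceL (bell A) b) = r • stVec α →
      prob (α ≫ c) = 1 → r = p * prob (τ ≫ b) := by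
    intro c b τ p r h1 h2 h3
    have := sliceR_comp_eq (bell A) c b
    have := congrArg prob this
    rw [← effFun_stVec, ← effFun_stVec, h1, h2, map_smul, map_smul, effFun_stVec, effFun_stVec, h3,
      smul_eq_mul, smul_eq_mul, mul_one] at this
    exact this.symm
  have e1 := e a' b β' _ _ hs' (hb b hbp hbβ) h'
  have e2 := e a b' β _ _ hs (hb' b' hbp' hbβ') h
  have n1 := prob_nonneg (invState A ≫ a)
  have n2 := prob_nonneg (invState A ≫ a')
  have l1 := mul_le_mul_of_nonneg_left (prob_le_one (β' ≫ b)) n2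
  have l2 := mul_le_mul_of_nonneg_left (prob_le_one (β ≫ b')) n1
  have e3 : prob (invState A ≫ a) = prob (invState A ≫ a') := by linarith
  have e4 : prob (β' ≫ b) = 1 := mul_left_cancel₀ hq' (by rw [← e1, e3, mul_one])
  have e5 : β' = β := eq_of_prob_eq_one hbp e4 hbβ
  have e6 : sliceR (bell A) a = sliceR (bell A) a' := stVec_injective (by rw [hs, hs', e3, e5])
  refine effect_eq_of_pure fun ψ hψ => ?_
  obtain ⟨c, hc, hψc⟩ := exists_pure_effect hψ
  obtain ⟨γ, hγ, -, hd⟩ := exists_conj hψ hc hψc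
  obtain ⟨d, hdp, hγd⟩ := exists_pure_effect hγ
  have h1 := hd d hdp hγd
  have h2 : prob (sliceL (bell A) d ≫ a) = prob (sliceL (bell A) d ≫ a') := by
    rw [← sliceR_comp_eq, ← sliceR_comp_eq, e6]
  rw [← effFun_stVec, ← effFun_stVec, h1, map_smul, map_smul, effFun_stVec, effFun_stVec] at h2
  exact smul_right_injective _ (prob_invState_ne_zero hψc) h2

open Classical in
/-- The dagger of a normalised pure state `ψ`: the pure effect that occurs with certainty on `ψ`
(a junk value if `ψ` is not pure and normalised). -/
noncomputable def dag {A : C} (ψ : 𝟙_ C ⟶ A) : A ⟶ 𝟙_ C :=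
  if h : IsPureSt₁ ψ then (exists_pure_effect h).choose else disc A

theorem isPure_dag {A : C} {ψ : 𝟙_ C ⟶ A} (h : IsPureSt₁ ψ) : IsPure (dag ψ) := by
  rw [dag, dif_pos h]; exact (exists_pure_effect h).choose_spec.1

theorem prob_comp_dag {A : C} {ψ : 𝟙_ C ⟶ A} (h : IsPureSt₁ ψ) : prob (ψ ≫ dag ψ) = 1 := by
  rw [dag, dif_pos h]; exact (exists_pure_effect h).choose_spec.2

theorem eq_dag {A : C} {ψ : 𝟙_ C ⟶ A} (h : IsPureSt₁ ψ) {a : A ⟶ 𝟙_ C} (ha : IsPure a)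
    (h1 : prob (ψ ≫ a) = 1) : a = dag ψ :=
  pure_effect_unique h ha (isPure_dag h) h1 (prob_comp_dag h)

theorem dag_comp_hom {A : C} {ψ : 𝟙_ C ⟶ A} (h : IsPureSt₁ ψ) {U : A ≅ A} (hU : IsReversible U) :
    dag (ψ ≫ U.hom) = U.inv ≫ dag ψ :=
  (eq_dag (h.comp_reversible hU) ((isPure_dag h).reversible_comp hU.symm)
    (by simp [prob_comp_dag h])).symm

/-- The probability of the dagger of a pure state on the invariant state; the inverse of the number
of elements of a maximal orthogonal family of pure states. -/
noncomputable def weight (A : C) : ℝ := prob (invState A ≫ dag (exists_pure A).choose)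

theorem prob_invState_dag {A : C} {ψ : 𝟙_ C ⟶ A} (h : IsPureSt₁ ψ) :
    prob (invState A ≫ dag ψ) = weight A := by
  obtain ⟨U, hU, rfl⟩ := exists_reversible_pure (exists_pure A).choose_spec h
  have := invState_comp U.symm
  rw [Iso.symm_hom] at this
  rw [dag_comp_hom (exists_pure A).choose_spec hU, ← Category.assoc, this, weight]

theorem weight_pos (A : C) : 0 < weight A :=
  lt_of_le_of_ne (prob_nonneg _)
    (prob_invState_ne_zero (prob_comp_dag (exists_pure A).choose_spec)).symm

open Classical in
/-- The pure state of `bar A` to which `dag ψ` steers the Bell state. -/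
noncomputable def conj {A : C} (ψ : 𝟙_ C ⟶ A) : 𝟙_ C ⟶ bar A :=
  if h : IsPureSt₁ ψ then (exists_conj h (isPure_dag h) (prob_comp_dag h)).choose
  else invState _

theorem isPureSt₁_conj {A : C} {ψ : 𝟙_ C ⟶ A} (h : IsPureSt₁ ψ) : IsPureSt₁ (conj ψ) := by
  rw [conj, dif_pos h]
  exact (exists_conj h (isPure_dag h) (prob_comp_dag h)).choose_spec.1

theorem sliceR_bell_dag {A : C} {ψ : 𝟙_ C ⟶ A} (h : IsPureSt₁ ψ) :
    stVec (sliceR (bell A) (dag ψ)) = weight A • stVec (conj ψ) := by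
  rw [conj, dif_pos h, ← prob_invState_dag h]
  exact (exists_conj h (isPure_dag h) (prob_comp_dag h)).choose_spec.2.1

theorem sliceL_bell_dag {A : C} {ψ : 𝟙_ C ⟶ A} (h : IsPureSt₁ ψ) :
    stVec (sliceL (bell A) (dag (conj ψ))) = weight A • stVec ψ := by
  have h1 := isPure_dag (isPureSt₁_conj h)
  have h2 := prob_comp_dag (isPureSt₁_conj h)
  conv at h2 => rw [conj, dif_pos h]
  rw [← prob_invState_dag h]
  refine (exists_conj h (isPure_dag h) (prob_comp_dag h)).choose_spec.2.2 _ h1 ?_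
  have h3 : conj ψ = _ := dif_pos h
  rw [← h3]
  exact prob_comp_dag (isPureSt₁_conj h)

/-- The transition probabilities of conjugate states are those of the original states, with the
roles of state and effect exchanged. -/
theorem prob_conj_dag_conj {A : C} {ψ φ : 𝟙_ C ⟶ A} (hψ : IsPureSt₁ ψ) (hφ : IsPureSt₁ φ) :
    prob (conj φ ≫ dag (conj ψ)) = prob (ψ ≫ dag φ) := by
  have h := congrArg prob (sliceR_comp_eq (bell A) (dag φ) (dag (conj ψ)))
  rw [← effFun_stVec, ← effFun_stVec, sliceR_bell_dag hφ, sliceL_bell_dag hψ, map_smul, map_smul,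
    effFun_stVec, effFun_stVec] at h
  exact smul_right_injective _ (weight_pos A).ne' h

theorem conj_inj {A : C} {ψ φ : 𝟙_ C ⟶ A} (hψ : IsPureSt₁ ψ) (hφ : IsPureSt₁ φ)
    (h : conj ψ = conj φ) : ψ = φ := by
  have h1 := sliceL_bell_dag hψ
  rw [h, sliceL_bell_dag hφ] at h1
  exact stVec_injective (smul_right_injective _ (weight_pos A).ne' h1.symm)

/-- Effects are determined by the states to which they steer the Bell state. -/
theorem effect_ext_bell {A : C} {a b : A ⟶ 𝟙_ C}
    (h : sliceR (bell A) a = sliceR (bell A) b) : a = b := by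
  refine effect_eq_of_pure fun ψ hψ => ?_
  have h2 : prob (sliceL (bell A) (dag (conj ψ)) ≫ a) =
      prob (sliceL (bell A) (dag (conj ψ)) ≫ b) := by
    rw [← sliceR_comp_eq, ← sliceR_comp_eq, h]
  rw [← effFun_stVec, ← effFun_stVec, sliceL_bell_dag hψ, map_smul, map_smul, effFun_stVec,
    effFun_stVec] at h2
  exact smul_right_injective _ (weight_pos A).ne' h2

/-- The invariant state dominates `weight A` times each pure state. The difference is the state to
which the complement of `dag (conj ψ)` steers the Bell state. -/
theorem invState_sub_mem {A : C} {ψ : 𝟙_ C ⟶ A} (h : IsPureSt₁ ψ) :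
    stVec (invState A) - weight A • stVec ψ ∈ StCone A := by
  obtain ⟨b', -, hb'⟩ := exists_compl (dag (conj ψ))
  convert stVec_mem_StCone (sliceL (bell A) b') using 1
  rw [← sliceL_bell_dag h, sub_eq_iff_eq_add, ← sliceL_bell_disc]
  refine vec_ext fun a => ?_
  rw [map_add, effFun_stVec, effFun_stVec, effFun_stVec, ← sliceR_comp_eq, ← sliceR_comp_eq,
    ← sliceR_comp_eq, ← hb', add_comm]

end Bell

/-! ### Steering and the projector on the complement of a pure state -/

section Projector

set_option linter.unusedSectionVars false

variable {C : Type u} [Category.{v} C] [MonoidalCategory C] [SymmetricCategory C] [OPTData C]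
  [hC : Fact (IsSharpTheoryWithPurification C)]

theorem associator_whiskerLeft_sliceL {A B E : C} (Γ : 𝟙_ C ⟶ (A ⊗ B) ⊗ E) (e : E ⟶ 𝟙_ C) :
    (Γ ≫ (α_ A B E).hom) ≫ (A ◁ ((B ◁ e) ≫ (ρ_ B).hom)) = sliceL Γ e := by
  simp [sliceL]

theorem sliceL_associator {A B E : C} (Γ : 𝟙_ C ⟶ (A ⊗ B) ⊗ E) (b : B ⟶ 𝟙_ C) (e : E ⟶ 𝟙_ C) :
    sliceL (Γ ≫ (α_ A B E).hom) (prodEff b e) = sliceL (sliceL Γ e) b := by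
  have h : prodEff b e = ((B ◁ e) ≫ (ρ_ B).hom) ≫ b := by
    simp only [prodEff, Category.assoc, MonoidalCategory.tensorHom_def', unitors_equal]
    rw [rightUnitor_naturality]
  rw [h, ← sliceL_whiskerLeft, associator_whiskerLeft_sliceL]

theorem stVec_sliceL {A B : C} (Ψ : 𝟙_ C ⟶ A ⊗ B) (b : B ⟶ 𝟙_ C) :
    stVec (sliceL Ψ b) = act ((A ◁ b) ≫ (ρ_ A).hom) (stVec Ψ) := by
  rw [act_stVec, sliceL]

theorem stVec_smul_comp {A : C} (c : 𝟙_ C ⟶ 𝟙_ C) (σ : 𝟙_ C ⟶ A) :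
    stVec (c ≫ σ) = prob c • stVec σ :=
  vec_ext fun a => by
    rw [map_smul, effFun_stVec, effFun_stVec, Category.assoc, prob_comp, smul_eq_mul]

/-- Steering: if the marginal on `A` of a pure state `Ψ` dominates `ε` times that of a state `Θ` of
`A ⊗ S`, then a transformation of the purifying system turns `Ψ` into `ε` times `Θ`. The auxiliary
system `W` carries a flag that singles out the summand `Θ`. -/
theorem exists_steering {A B S W : C} {Ψ : 𝟙_ C ⟶ A ⊗ B} (hΨ : IsPureSt₁ Ψ)
    {Θ : 𝟙_ C ⟶ A ⊗ S} (hΘ : Normalised Θ) {ε : ℝ} (hε : 0 ≤ ε)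
    (hle : stVec (sliceL Ψ (disc B)) - ε • stVec (sliceL Θ (disc S)) ∈ StCone A)
    {e : W ⟶ 𝟙_ C} {ω₁ ω₂ : 𝟙_ C ⟶ W} (h₁ : prob (ω₁ ≫ e) = 1) (hω₂ : Normalised ω₂)
    (h₂ : prob (ω₂ ≫ e) = 0) : ∃ r : B ⟶ S, stVec (Ψ ≫ (A ◁ r)) = ε • stVec Θ := by
  obtain ⟨t, ht, ρ', hρ', heq⟩ := exists_smul_of_mem_StCone hle
  obtain ⟨s₀, hs₀⟩ := exists_normalised C S
  have hω₁ := normalised_of_prob_eq_one h₁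
  let j : S ⟶ S ⊗ W := (ρ_ S).inv ≫ (S ◁ ω₁)
  let k : S ⊗ W ⟶ S := (S ◁ e) ≫ (ρ_ S).hom
  have hj : IsChannel j := (isReversible_rightUnitor S).2.comp (hω₁.isChannel.whiskerLeft S)
  have hjk : j ≫ k = 𝟙 S := by
    have : ω₁ ≫ e = 𝟙 _ := scalar_ext (h₁.trans prob_id.symm)
    simp only [j, k, Category.assoc, ← whiskerLeft_comp_assoc, this]
    simp
  have hX₁ : Normalised (Θ ≫ (A ◁ j)) := hΘ.comp (hj.whiskerLeft A)
  have hX₂ : Normalised (prodSt ρ' (prodSt s₀ ω₂)) := hρ'.prodSt (hs₀.prodSt hω₂)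
  have hwt : 1 - ε = t := by
    have h1 : Normalised (sliceL Ψ (disc B)) := by
      rw [Normalised, sliceL_comp, prodEff_disc]; exact hΨ.normalised
    have h2 : Normalised (sliceL Θ (disc S)) := by
      rw [Normalised, sliceL_comp, prodEff_disc]; exact hΘ
    have := congrArg (effFun (disc A)) heq
    rwa [map_sub, map_smul, map_smul, effFun_stVec, effFun_stVec, effFun_stVec, h1, h2, hρ',
      smul_eq_mul, smul_eq_mul, mul_one, mul_one] at this
  obtain ⟨Ξ, hΞ, hΞv⟩ := exists_normalised_of_mem_StCone
    (x := ε • stVec (Θ ≫ (A ◁ j)) + t • stVec (prodSt ρ' (prodSt s₀ ω₂)))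
    (Submodule.add_mem _ (smul_mem_StCone (stVec_mem_StCone _) hε)
      (smul_mem_StCone (stVec_mem_StCone _) ht))
    (by rw [map_add, map_smul, map_smul, effFun_stVec, effFun_stVec, hX₁, hX₂, smul_eq_mul,
      smul_eq_mul]; linarith)
  obtain ⟨Z, Γ, hΓ, hm⟩ := exists_purification hΞ
  obtain ⟨r, -, hr⟩ := exists_pure_transfer hΨ (hΓ.comp_reversible (isReversible_associator _ _ _))
    (by
      rw [← prodEff_disc, sliceL_associator, hm]
      apply stVec_injective
      rw [stVec_sliceL Ξ, hΞv, map_add, map_smul, map_smul, ← stVec_sliceL, ← stVec_sliceL,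
        sliceL_whiskerLeft, hj.comp_disc, sliceL_prodSt,
        scalar_ext (((hs₀.prodSt hω₂)).trans prob_id.symm), Category.id_comp, ← heq]
      abel)
  refine ⟨r ≫ (((S ⊗ W) ◁ disc Z) ≫ (ρ_ _).hom) ≫ k, ?_⟩
  have h3 : Ψ ≫ (A ◁ (r ≫ (((S ⊗ W) ◁ disc Z) ≫ (ρ_ _).hom) ≫ k)) = Ξ ≫ (A ◁ k) := by
    rw [← hm, ← associator_whiskerLeft_sliceL, hr]
    simp
  have h4 : stVec (prodSt ρ' (prodSt s₀ ω₂) ≫ (A ◁ k)) = 0 := by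
    apply stVec_eq_zero
    have : prodSt s₀ ω₂ ≫ k = (ω₂ ≫ e) ≫ s₀ := sliceL_prodSt s₀ ω₂ e
    rw [prodSt_comp_whiskerLeft, this, ← prodEff_disc, prodSt_comp_prodEff]
    rw [prob_comp, Category.assoc (ω₂ ≫ e), prob_comp (ω₂ ≫ e), h₂]
    simp
  rw [h3, ← act_stVec, hΞv, map_add, map_smul, map_smul, act_stVec, act_stVec, h4, Category.assoc,
    ← whiskerLeft_comp, hjk]
  simp

theorem weight_lt_one {A : C} {α ρ : 𝟙_ C ⟶ A} (hα : IsPureSt₁ α) (hρ : Normalised ρ)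
    (h0 : prob (ρ ≫ dag α) = 0) : weight A < 1 := by
  refine lt_of_le_of_ne (prob_le_one _) fun h1 => ?_
  have h2 := eq_zero_of_invState (f := effFun (disc A) - effFun (dag α))
    (fun x hx => by simpa using effFun_le_disc (dag α) hx) (by
      rw [LinearMap.sub_apply, effFun_stVec, effFun_stVec, prob_invState_dag hα, h1,
        normalised_invState A, sub_self])
  have h3 := LinearMap.congr_fun h2 (stVec ρ)
  rw [LinearMap.sub_apply, effFun_stVec, effFun_stVec, hρ, h0] at h3
  simp at h3

/-- A pure transformation that discards exactly the part of the system detected by `dag α`. -/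
theorem exists_pure_compl {A : C} {α ρ : 𝟙_ C ⟶ A} (hα : IsPureSt₁ α) (hρ : Normalised ρ)
    (h0 : prob (ρ ≫ dag α) = 0) : ∃ (E : C) (T : A ⟶ E), IsPure T ∧
      ∀ σ : 𝟙_ C ⟶ A, prob (σ ≫ T ≫ disc E) + prob (σ ≫ dag α) = prob (σ ≫ disc A) := by
  obtain ⟨a', -, ha'⟩ := exists_compl (dag α)
  have hβ := isPureSt₁_conj hα
  obtain ⟨κ, hκ, hκv⟩ := exists_normalised_smul' (sliceR (bell A) a')
  set k := prob (sliceR (bell A) a' ≫ disc (bar A)) with hk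
  have hkq : weight A + k = 1 := by
    rw [hk, prob_sliceR_bell_disc, ← prob_invState_dag hα, ha', normalised_invState A]
  have hk0 : 0 ≤ k := prob_nonneg _
  obtain ⟨ω, hω, hωv⟩ := exists_normalised_of_mem_StCone
    (x := k • stVec (prodSt κ α) + weight A • stVec (prodSt (conj α) ρ))
    (Submodule.add_mem _ (smul_mem_StCone (stVec_mem_StCone _) hk0)
      (smul_mem_StCone (stVec_mem_StCone _) (weight_pos A).le))
    (by rw [map_add, map_smul, map_smul, effFun_stVec, effFun_stVec, hκ.prodSt hα.normalised,
      hβ.normalised.prodSt hρ, smul_eq_mul, smul_eq_mul]; linarith)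
  obtain ⟨E, Γ, hΓ, hm⟩ := exists_purification hω
  have hR : stVec (sliceR (bell A) (disc A)) =
      stVec (sliceR (bell A) a') + weight A • stVec (conj α) := by
    rw [← sliceR_bell_dag hα]
    refine vec_ext fun b => ?_
    rw [map_add, effFun_stVec, effFun_stVec, effFun_stVec, sliceR_comp_eq, sliceR_comp_eq,
      sliceR_comp_eq, ← ha', add_comm]
  obtain ⟨t, ht, hΨ⟩ := exists_pure_transfer
    ((isPureSt₁_bell A).comp_reversible (isReversible_braiding _ _))
    (hΓ.comp_reversible (isReversible_associator _ _ _)) (by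
      rw [← prodEff_disc, sliceL_associator, hm, sliceL_braiding]
      apply stVec_injective
      rw [stVec_sliceL ω, hωv, map_add, map_smul, map_smul, ← stVec_sliceL, ← stVec_sliceL,
        sliceL_prodSt, sliceL_prodSt, scalar_ext (hα.normalised.trans prob_id.symm),
        scalar_ext (Eq.trans hρ prob_id.symm), Category.id_comp, Category.id_comp, ← hκv, hR])
  refine ⟨E, t ≫ (dag α ▷ E) ≫ (λ_ E).hom, ht.comp (((isPure_dag hα).whiskerRight E).comp
    (isReversible_leftUnitor E).isPure), ?_⟩
  have hT : (t ≫ (dag α ▷ E) ≫ (λ_ E).hom) ≫ disc E = a' := by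
    apply effect_ext_bell
    have h1 : (t ≫ (dag α ▷ E) ≫ (λ_ E).hom) ≫ disc E = t ≫ prodEff (dag α) (disc E) := by
      simp [prodEff, MonoidalCategory.tensorHom_def]
    rw [h1, ← sliceL_braiding, ← sliceL_whiskerLeft, ← hΨ, sliceL_associator, hm]
    apply stVec_injective
    rw [stVec_sliceL ω, hωv, map_add, map_smul, map_smul, ← stVec_sliceL, ← stVec_sliceL,
      sliceL_prodSt, sliceL_prodSt, stVec_smul_comp, stVec_smul_comp, prob_comp_dag hα, h0,
      hκv]
    simp
  intro σ
  rw [hT, add_comm, ha']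

theorem prob_eq_zero_of_le {A : C} {a : A ⟶ 𝟙_ C} {x y : StR A} (hy : y ∈ StCone A)
    (h : effFun a x = 0) (hxy : x - y ∈ StCone A) : effFun a y = 0 := by
  have h1 := effFun_nonneg a hxy
  rw [map_sub, h] at h1
  linarith [effFun_nonneg a hy]

/-- The projector on the orthogonal complement of a pure state `α`: a pure transformation that
occurs with the complementary probability to `dag α` and fixes each state orthogonal to `α`, as well
as each bipartite extension of the normalised difference of the invariant state and `α`. -/
theorem exists_projector {A : C} {α ρ : 𝟙_ C ⟶ A} (hα : IsPureSt₁ α) (hρ : Normalised ρ)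
    (h0 : prob (ρ ≫ dag α) = 0) : ∃ P : A ⟶ A, IsPure P ∧
      (∀ x, effFun (disc A) (act P x) + effFun (dag α) x = effFun (disc A) x) ∧
      (∀ σ : 𝟙_ C ⟶ A, prob (σ ≫ dag α) = 0 → σ ≫ P = σ) ∧
      ∀ (S : C) (Θ : 𝟙_ C ⟶ A ⊗ S), Normalised Θ → stVec (sliceL Θ (disc S)) =
        (1 - weight A)⁻¹ • (stVec (invState A) - weight A • stVec α) → Θ ≫ (P ▷ S) = Θ := by
  have hq := weight_lt_one hα hρ h0
  obtain ⟨E, T, hT, huT⟩ := exists_pure_compl hα hρ h0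
  set N : Set (StR A) := stVec '' {σ : 𝟙_ C ⟶ A | Normalised σ ∧ prob (σ ≫ dag α) = 0} with hN
  obtain ⟨s, hsN, hs⟩ := (Submodule.fg_span_iff_fg_span_finset_subset N).1
    (IsNoetherian.noetherian (Submodule.span ℝ N))
  have hκm : (1 - weight A)⁻¹ • (stVec (invState A) - weight A • stVec α) ∈ StCone A :=
    smul_mem_StCone (invState_sub_mem hα) (inv_nonneg.2 (by linarith))
  obtain ⟨κ, hκ, hκv⟩ := exists_normalised_of_mem_StCone hκm (by
    rw [map_smul, map_sub, map_smul, effFun_stVec, effFun_stVec, normalised_invState A,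
      hα.normalised, smul_eq_mul, smul_eq_mul, mul_one, inv_mul_cancel₀ (by linarith)])
  have hκ0 : prob (κ ≫ dag α) = 0 := by
    rw [← effFun_stVec, hκv, map_smul, map_sub, map_smul, effFun_stVec, effFun_stVec,
      prob_invState_dag hα, prob_comp_dag hα]
    simp
  -- a state orthogonal to `α` that dominates a multiple of each of finitely many states which
  -- span the orthogonal complement, and of `κ`
  classical
  have hsC : ∀ x ∈ insert (stVec κ) s, x ∈ StCone A ∧ effFun (disc A) x = 1 ∧
      effFun (dag α) x = 0 := by
    intro x hx
    rcases Finset.mem_insert.1 hx with rfl | hx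
    · exact ⟨stVec_mem_StCone _, hκ, hκ0⟩
    · obtain ⟨σ, ⟨h1, h2⟩, rfl⟩ := hsN hx
      exact ⟨stVec_mem_StCone _, h1, h2⟩
  set S := insert (stVec κ) s with hS
  have hcard : (0 : ℝ) < S.card := by
    exact_mod_cast Finset.card_pos.2 ⟨_, Finset.mem_insert_self _ _⟩
  set ε : ℝ := (S.card : ℝ)⁻¹ with hε
  have hε0 : 0 < ε := inv_pos.2 hcard
  obtain ⟨ρ₀, hρ₀, hρ₀v⟩ := exists_normalised_of_mem_StCone (x := ε • ∑ x ∈ S, x)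
    (smul_mem_StCone (Submodule.sum_mem _ fun x hx => (hsC x hx).1) hε0.le) (by
      rw [map_smul, map_sum, Finset.sum_congr rfl fun x hx => (hsC x hx).2.1]
      simp [hε, hcard.ne'])
  have hdom : ∀ x ∈ S, stVec ρ₀ - ε • x ∈ StCone A := by
    intro x hx
    rw [hρ₀v, ← Finset.add_sum_erase S (fun y => y) hx, smul_add, add_sub_cancel_left]
    exact smul_mem_StCone (Submodule.sum_mem _ fun y hy => (hsC y (Finset.mem_of_mem_erase hy)).1)
      hε0.le
  have hρ₀0 : effFun (dag α) (stVec ρ₀) = 0 := by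
    rw [hρ₀v, map_smul, map_sum, Finset.sum_congr rfl fun x hx => (hsC x hx).2.2]
    simp
  obtain ⟨B, Ψ, hΨ, hm⟩ := exists_purification hρ₀
  have hR : sliceR (Ψ ≫ (T ▷ B)) (disc E) = sliceR Ψ (disc A) := by
    refine state_ext fun b => ?_
    rw [sliceR_whiskerRight, sliceR_comp_eq, sliceR_comp_eq, ← huT (sliceL Ψ b)]
    have h1 : prob (sliceL Ψ b ≫ dag α) = 0 := by
      refine le_antisymm ?_ (prob_nonneg _)
      have h2 : prob (ρ₀ ≫ dag α) = 0 := hρ₀0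
      rw [← sliceR_comp_eq, ← h2, ← hm, ← sliceR_comp_eq]
      exact prob_comp_le_disc _ _
    rw [h1, add_zero]
  have hTΨ : IsPureSt₁ (Ψ ≫ (T ▷ B)) := by
    refine isPureSt₁_of_pure (hΨ.1.comp (hT.whiskerRight B)) ?_
    rw [Normalised, ← prodEff_disc, ← sliceR_comp, hR, sliceR_comp, prodEff_disc]
    exact hΨ.normalised
  obtain ⟨r, hr, hΨr⟩ := exists_pure_transfer_left hTΨ hΨ hR
  have hfix : Ψ ≫ ((T ≫ r) ▷ B) = Ψ := by
    rw [comp_whiskerRight, ← Category.assoc, ← hΨr]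
  have hfixS : ∀ (X : C) (Θ : 𝟙_ C ⟶ A ⊗ X), Normalised Θ → stVec (sliceL Θ (disc X)) ∈ S →
      Θ ≫ ((T ≫ r) ▷ X) = Θ := by
    intro X Θ hΘ hΘS
    obtain ⟨w, hw⟩ := exists_steering hΨ hΘ hε0.le (by rw [hm]; exact hdom _ hΘS)
      (prob_comp_dag hα) hρ h0
    apply stVec_injective
    apply smul_right_injective _ hε0.ne'
    show ε • stVec (Θ ≫ ((T ≫ r) ▷ X)) = ε • stVec Θ
    rw [← act_stVec, ← map_smul, ← hw, act_stVec, Category.assoc, whisker_exchange,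
      ← Category.assoc, hfix]
  have hfixV : ∀ x ∈ S, act (T ≫ r) x = x := by
    intro x hx
    obtain ⟨σ, hσ, rfl⟩ := exists_normalised_of_mem_StCone (hsC x hx).1 (hsC x hx).2.1
    have h1 : Normalised (σ ≫ (ρ_ A).inv) := hσ.comp (isReversible_rightUnitor A).2
    have h2 : sliceL (σ ≫ (ρ_ A).inv) (disc (𝟙_ C)) = σ := by
      simp [sliceL, disc_unit]
    have h3 := hfixS _ _ h1 (by rw [h2]; exact hx)
    rw [act_stVec]
    congr 1
    have h4 := congrArg (fun f => f ≫ (ρ_ A).hom) h3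
    simpa using h4
  have hle : ∀ σ : 𝟙_ C ⟶ A, prob (σ ≫ (T ≫ r) ≫ disc A) + prob (σ ≫ dag α) ≤
      prob (σ ≫ disc A) := by
    intro σ
    have := prob_comp_disc_le r (σ ≫ T)
    rw [← huT σ]
    simp only [Category.assoc] at this ⊢
    linarith
  refine ⟨T ≫ r, hT.comp hr, ?_, ?_, ?_⟩
  · -- the two sides agree on the invariant state, on which no nonzero effect vanishes
    have hz := eq_zero_of_invState
      (f := effFun (disc A) - effFun (disc A) ∘ₗ act (T ≫ r) - effFun (dag α)) (by
        intro x hx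
        obtain ⟨t, ht, σ, -, rfl⟩ := exists_smul_of_mem_StCone hx
        rw [map_smul]
        refine mul_nonneg ht ?_
        have := hle σ
        simp only [LinearMap.sub_apply, LinearMap.comp_apply, act_stVec, effFun_stVec,
          Category.assoc] at this ⊢
        linarith) (by
        refine le_antisymm ?_ ?_
        · have h1 : effFun (disc A) (act (T ≫ r) (stVec (invState A) - weight A • stVec α)) =
              1 - weight A := by
            have h2 := hfixV _ (Finset.mem_insert_self (stVec κ) s)
            rw [hκv, map_smul] at h2
            rw [smul_right_injective _ (inv_ne_zero (by linarith : (1 - weight A) ≠ 0)) h2, map_sub,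
              map_smul, effFun_stVec, effFun_stVec, normalised_invState A, hα.normalised]
            simp
          rw [map_sub, map_smul, map_sub, map_smul, act_stVec (T ≫ r) α, effFun_stVec,
            smul_eq_mul] at h1
          have h3 := mul_nonneg (weight_pos A).le (prob_nonneg ((α ≫ T ≫ r) ≫ disc A))
          rw [LinearMap.sub_apply, LinearMap.sub_apply, LinearMap.comp_apply,
            effFun_stVec, effFun_stVec, normalised_invState A, prob_invState_dag hα]
          linarith
        · have := hle (invState A)
          simp only [LinearMap.sub_apply, LinearMap.comp_apply, act_stVec, effFun_stVec,
            Category.assoc] at this ⊢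
          linarith)
    intro x
    have := LinearMap.congr_fun hz x
    simp only [LinearMap.sub_apply, LinearMap.comp_apply, LinearMap.zero_apply] at this
    linarith
  · intro σ hσ
    have hspan : ∀ x ∈ Submodule.span ℝ N, act (T ≫ r) x = x := by
      rw [hs]
      intro x hx
      have : Submodule.span ℝ (s : Set (StR A)) ≤ LinearMap.eqLocus (act (T ≫ r)) LinearMap.id :=
        Submodule.span_le.2 fun y hy => hfixV y (Finset.mem_insert_of_mem hy)
      exact this hx
    apply stVec_injective
    rw [← act_stVec]
    refine hspan _ ?_
    by_cases hσ0 : prob (σ ≫ disc A) = 0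
    · rw [stVec_eq_zero hσ0]; exact zero_mem _
    · obtain ⟨ω, hω, hσω⟩ := exists_normalised_smul σ hσ0
      rw [hσω]
      refine Submodule.smul_mem _ _ (Submodule.subset_span ⟨ω, ⟨hω, ?_⟩, rfl⟩)
      rw [← effFun_stVec, hσω, map_smul, effFun_stVec, smul_eq_mul] at hσ
      exact (mul_eq_zero.1 hσ).resolve_left hσ0
  · intro X Θ hΘ hΘv
    refine hfixS X Θ hΘ ?_
    rw [hΘv, ← hκv]
    exact Finset.mem_insert_self _ _

end Projector

/-! ### Orthogonal families and diagonalisation -/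

section Frames

set_option linter.unusedSectionVars false

variable {C : Type u} [Category.{v} C] [MonoidalCategory C] [SymmetricCategory C] [OPTData C]
  [hC : Fact (IsSharpTheoryWithPurification C)]

theorem comp_dag_of_fix {A : C} {β : 𝟙_ C ⟶ A} (hβ : IsPureSt₁ β) {P : A ⟶ A} (hP : IsPure P)
    (h : β ≫ P = β) : P ≫ dag β = dag β :=
  eq_dag hβ (hP.comp (isPure_dag hβ)) (by rw [← Category.assoc, h, prob_comp_dag hβ])

/-- Orthogonality of pure states is symmetric: the projector on the complement of `α` fixes `β`, so
that `dag β` occurs at most as often as that projector, which never occurs on `α`. -/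
theorem prob_dag_eq_zero_symm {A : C} {α β : 𝟙_ C ⟶ A} (hα : IsPureSt₁ α) (hβ : IsPureSt₁ β)
    (h : prob (β ≫ dag α) = 0) : prob (α ≫ dag β) = 0 := by
  obtain ⟨P, hP, hu, hfix, -⟩ := exists_projector hα hβ.normalised h
  have h1 := hu (stVec α)
  rw [act_stVec, effFun_stVec, effFun_stVec, effFun_stVec, prob_comp_dag hα, hα.normalised] at h1
  have h2 := prob_comp_le_disc (α ≫ P) (dag β)
  rw [Category.assoc, comp_dag_of_fix hβ hP (hfix β h)] at h2
  linarith [prob_nonneg (α ≫ dag β)]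

theorem effFun_disc_of_pure {A : C} {ψ : 𝟙_ C ⟶ A} (h : IsPureSt₁ ψ) :
    effFun (disc A) (stVec ψ) = 1 := h.normalised

theorem effFun_dag_invState {A : C} {ψ : 𝟙_ C ⟶ A} (h : IsPureSt₁ ψ) :
    effFun (dag ψ) (stVec (invState A)) = weight A := prob_invState_dag h

/-- A finite set of pairwise orthogonal normalised pure states. -/
structure IsOrtho {A : C} (s : Finset (𝟙_ C ⟶ A)) : Prop where
  pure : ∀ ψ ∈ s, IsPureSt₁ ψ
  ortho : ∀ ψ ∈ s, ∀ φ ∈ s, ψ ≠ φ → prob (φ ≫ dag ψ) = 0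

/-- The daggers of the states of the set add up to the deterministic effect. -/
def IsComplete {A : C} (s : Finset (𝟙_ C ⟶ A)) : Prop :=
  ∀ x, ∑ ψ ∈ s, effFun (dag ψ) x = effFun (disc A) x

theorem IsOrtho.mono {A : C} {s t : Finset (𝟙_ C ⟶ A)} (h : IsOrtho t) (hst : s ⊆ t) : IsOrtho s :=
  ⟨fun ψ hψ => h.pure ψ (hst hψ), fun ψ hψ φ hφ => h.ortho ψ (hst hψ) φ (hst hφ)⟩

theorem isOrtho_empty {A : C} : IsOrtho (∅ : Finset (𝟙_ C ⟶ A)) := ⟨by simp, by simp⟩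

open Classical in
theorem IsOrtho.insert_pure {A : C} {s : Finset (𝟙_ C ⟶ A)} (h : IsOrtho s) {α : 𝟙_ C ⟶ A}
    (hα : IsPureSt₁ α) (h0 : ∀ ψ ∈ s, prob (α ≫ dag ψ) = 0) : IsOrtho (insert α s) := by
  refine ⟨fun ψ hψ => ?_, fun ψ hψ φ hφ hne => ?_⟩
  · rcases Finset.mem_insert.1 hψ with rfl | hψ
    exacts [hα, h.pure ψ hψ]
  · rcases Finset.mem_insert.1 hψ with h1 | h1 <;> rcases Finset.mem_insert.1 hφ with h2 | h2
    · exact absurd (h1.trans h2.symm) hne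
    · exact h1 ▸ prob_dag_eq_zero_symm (h.pure φ h2) hα (h0 φ h2)
    · exact h2 ▸ h0 ψ h1
    · exact h.ortho ψ h1 φ h2 hne

theorem IsOrtho.prob_eq {A : C} {s : Finset (𝟙_ C ⟶ A)} (h : IsOrtho s) [DecidableEq (𝟙_ C ⟶ A)]
    {ψ φ : 𝟙_ C ⟶ A} (hψ : ψ ∈ s) (hφ : φ ∈ s) :
    prob (φ ≫ dag ψ) = if ψ = φ then 1 else 0 := by
  split_ifs with he
  · rw [he, prob_comp_dag (h.pure φ hφ)]
  · exact h.ortho ψ hψ φ hφ he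

/-- The complement of the daggers of an orthogonal set is an effect; it is obtained by composing the
projectors on the complements of the single states. -/
theorem IsOrtho.exists_compl {A : C} {s : Finset (𝟙_ C ⟶ A)} (h : IsOrtho s) :
    ∃ e : A ⟶ 𝟙_ C, ∀ x, effFun e x + ∑ ψ ∈ s, effFun (dag ψ) x = effFun (disc A) x := by
  classical
  induction s using Finset.induction_on with
  | empty => exact ⟨disc A, fun x => by simp⟩
  | insert ψ s hψ ih =>
    have hs := h.mono (Finset.subset_insert ψ s)
    have hψp := h.pure ψ (Finset.mem_insert_self ψ s)
    obtain ⟨e, he⟩ := ih hs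
    rcases s.eq_empty_or_nonempty with rfl | ⟨φ, hφ⟩
    · obtain ⟨a', -, ha'⟩ := OPT.exists_compl (dag ψ)
      refine ⟨a', fun x => ?_⟩
      have : effFun a' + effFun (dag ψ) = effFun (disc A) := eq_of_pure fun σ _ => by
        rw [LinearMap.add_apply, effFun_stVec, effFun_stVec, effFun_stVec, ← ha', add_comm]
      simpa using LinearMap.congr_fun this x
    · have h0 : ∀ φ ∈ s, prob (φ ≫ dag ψ) = 0 := fun φ hφ =>
        h.ortho ψ (Finset.mem_insert_self ψ s) φ (Finset.mem_insert_of_mem hφ)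
          (by rintro rfl; exact hψ hφ)
      obtain ⟨P, hP, hu, hfix, -⟩ := exists_projector hψp (hs.pure φ hφ).normalised (h0 φ hφ)
      refine ⟨P ≫ e, fun x => ?_⟩
      have h1 : ∑ φ ∈ s, effFun (dag φ) (act P x) = ∑ φ ∈ s, effFun (dag φ) x :=
        Finset.sum_congr rfl fun φ hφ => by
          rw [effFun_act, comp_dag_of_fix (hs.pure φ hφ) hP (hfix φ (h0 φ hφ))]
      have h2 := he (act P x)
      have h3 := hu x
      rw [h1] at h2
      rw [Finset.sum_insert hψ, ← effFun_act]
      linarith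

open Classical in
theorem IsOrtho.image_conj {A : C} {s : Finset (𝟙_ C ⟶ A)} (h : IsOrtho s) :
    IsOrtho (s.image conj) := by
  refine ⟨fun ψ hψ => ?_, fun ψ hψ φ hφ hne => ?_⟩
  · obtain ⟨ψ', h1, rfl⟩ := Finset.mem_image.1 hψ
    exact isPureSt₁_conj (h.pure ψ' h1)
  · obtain ⟨ψ', h1, rfl⟩ := Finset.mem_image.1 hψ
    obtain ⟨φ', h2, rfl⟩ := Finset.mem_image.1 hφ
    rw [prob_conj_dag_conj (h.pure ψ' h1) (h.pure φ' h2)]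
    exact h.ortho φ' h2 ψ' h1 fun he => hne (congrArg _ he.symm)

theorem effFun_eq_bell {A : C} (a : A ⟶ 𝟙_ C) {ψ : 𝟙_ C ⟶ A} (h : IsPureSt₁ ψ) :
    effFun (dag (conj ψ)) (stVec (sliceR (bell A) a)) = weight A * effFun a (stVec ψ) := by
  rw [effFun_stVec, sliceR_comp_eq, ← effFun_stVec, sliceL_bell_dag h, map_smul, smul_eq_mul]

/-- The invariant state dominates `weight A` times the sum of an orthogonal set of pure states. -/
theorem IsOrtho.invState_sub_sum_mem {A : C} {s : Finset (𝟙_ C ⟶ A)} (h : IsOrtho s) :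
    stVec (invState A) - weight A • ∑ ψ ∈ s, stVec ψ ∈ StCone A := by
  classical
  obtain ⟨e, he⟩ := h.image_conj.exists_compl
  convert stVec_mem_StCone (sliceL (bell A) e) using 1
  refine vec_ext fun a => ?_
  have h1 := he (stVec (sliceR (bell A) a))
  rw [Finset.sum_image fun ψ hψ φ hφ => conj_inj (h.pure ψ hψ) (h.pure φ hφ),
    Finset.sum_congr rfl fun ψ hψ => effFun_eq_bell a (h.pure ψ hψ), effFun_stVec, effFun_stVec,
    prob_sliceR_bell_disc, sliceR_comp_eq] at h1
  rw [map_sub, map_smul, map_sum, effFun_stVec, effFun_stVec, smul_eq_mul, Finset.mul_sum]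
  linarith

theorem IsOrtho.card_mul_weight_le {A : C} {s : Finset (𝟙_ C ⟶ A)} (h : IsOrtho s) :
    s.card * weight A ≤ 1 := by
  have h1 := effFun_nonneg (disc A) h.invState_sub_sum_mem
  rw [map_sub, map_smul, map_sum, effFun_stVec, normalised_invState A,
    Finset.sum_congr rfl fun ψ hψ => effFun_disc_of_pure (h.pure ψ hψ)] at h1
  simp at h1
  linarith

theorem IsOrtho.sum_dag_sum {A : C} {s : Finset (𝟙_ C ⟶ A)} (h : IsOrtho s) {ψ : 𝟙_ C ⟶ A}
    (hψ : ψ ∈ s) (c : (𝟙_ C ⟶ A) → ℝ) : effFun (dag ψ) (∑ φ ∈ s, c φ • stVec φ) = c ψ := by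
  classical
  rw [map_sum, Finset.sum_congr rfl fun φ hφ => by
    rw [map_smul, effFun_stVec, h.prob_eq hψ hφ, smul_eq_mul, mul_ite, mul_one, mul_zero]]
  rw [Finset.sum_ite_eq, if_pos hψ]

open Classical in
/-- If the daggers of an orthogonal set do not add up to the deterministic effect, then the
complement of their sum occurs with certainty on some pure state, which can be added to the set. -/
theorem IsOrtho.exists_insert {A : C} {s : Finset (𝟙_ C ⟶ A)} (h : IsOrtho s)
    (hc : ¬ IsComplete s) : ∃ α : 𝟙_ C ⟶ A, α ∉ s ∧ IsOrtho (insert α s) := by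
  obtain ⟨e, he⟩ := h.exists_compl
  set x := stVec (invState A) - weight A • ∑ ψ ∈ s, stVec ψ with hx
  have hψx : ∀ ψ ∈ s, effFun (dag ψ) x = 0 := fun ψ hψ => by
    have := h.sum_dag_sum hψ (fun _ => 1)
    simp only [one_smul] at this
    rw [hx, map_sub, map_smul, this, effFun_stVec, prob_invState_dag (h.pure ψ hψ)]
    simp
  have hex : effFun e x = effFun (disc A) x := by
    rw [← he, Finset.sum_eq_zero hψx, add_zero]
  obtain ⟨t, ht, σ, hσ, hxσ⟩ := exists_smul_of_mem_StCone h.invState_sub_sum_mem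
  rw [← hx] at hxσ
  have ht0 : t ≠ 0 := by
    rintro rfl
    rw [zero_smul] at hxσ
    refine hc fun y => ?_
    have h1 : effFun e = 0 := eq_zero_of_invState (fun x hx => effFun_nonneg e hx) (by
      have h2 := he (stVec (invState A))
      have h3 : stVec (invState A) = weight A • ∑ ψ ∈ s, stVec ψ := by
        rw [← sub_eq_zero, ← hx, hxσ]
      have h4 : effFun (disc A) (stVec (invState A)) = s.card * weight A := by
        rw [h3, map_smul, map_sum,
          Finset.sum_congr rfl fun ψ hψ => effFun_disc_of_pure (h.pure ψ hψ)]
        simp [mul_comm]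
      have h5 : ∑ ψ ∈ s, effFun (dag ψ) (stVec (invState A)) = s.card * weight A := by
        rw [Finset.sum_congr rfl fun ψ hψ => effFun_dag_invState (h.pure ψ hψ)]
        simp
      linarith)
    have h2 := he y
    rwa [h1, LinearMap.zero_apply, zero_add] at h2
  have hσe : prob (σ ≫ e) = 1 := by
    rw [hxσ, map_smul, map_smul] at hex
    rw [← effFun_stVec, smul_right_injective _ ht0 hex]
    exact hσ
  obtain ⟨α, hα, hαe⟩ := exists_pure_prob_eq_one hσe
  have h0 : ∀ ψ ∈ s, prob (α ≫ dag ψ) = 0 := by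
    have h1 := he (stVec α)
    rw [effFun_stVec, effFun_stVec, hαe, hα.normalised, add_eq_left] at h1
    intro ψ hψ
    exact (Finset.sum_eq_zero_iff_of_nonneg fun ψ _ => prob_nonneg _).1 h1 ψ hψ
  refine ⟨α, fun hs => ?_, h.insert_pure hα h0⟩
  have := h0 α hs
  rw [prob_comp_dag hα] at this
  exact one_ne_zero this

/-- An orthogonal family cannot be enlarged indefinitely; `n` bounds the number of steps. -/
theorem exists_lt_card_add_mul_weight {A : C} (s : Finset (𝟙_ C ⟶ A)) :
    ∃ n : ℕ, 1 < (s.card + n : ℕ) * weight A := by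
  obtain ⟨n, hn⟩ := exists_nat_gt (1 / weight A)
  refine ⟨n, ?_⟩
  rw [div_lt_iff₀ (weight_pos A)] at hn
  push_cast
  nlinarith [weight_pos A, (Nat.cast_nonneg s.card : (0 : ℝ) ≤ s.card)]

theorem IsOrtho.exists_isComplete {A : C} {s : Finset (𝟙_ C ⟶ A)} (h : IsOrtho s) :
    ∃ t, s ⊆ t ∧ IsOrtho t ∧ IsComplete t := by
  classical
  obtain ⟨n, hn⟩ := exists_lt_card_add_mul_weight s
  induction n generalizing s with
  | zero => exact absurd h.card_mul_weight_le (by simpa using hn)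
  | succ n ih =>
    by_cases hc : IsComplete s
    · exact ⟨s, Finset.Subset.refl s, h, hc⟩
    · obtain ⟨α, hα, hins⟩ := h.exists_insert hc
      obtain ⟨t, hst, ht⟩ := ih hins (by
        rw [Finset.card_insert_of_notMem hα]
        convert hn using 3
        omega)
      exact ⟨t, (Finset.subset_insert α s).trans hst, ht⟩

theorem IsComplete.invState_eq {A : C} {s : Finset (𝟙_ C ⟶ A)} (h : IsOrtho s)
    (hc : IsComplete s) : stVec (invState A) = weight A • ∑ ψ ∈ s, stVec ψ := by
  rw [← sub_eq_zero]
  refine eq_zero_of_mem_StCone h.invState_sub_sum_mem ?_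
  have h1 := hc (stVec (invState A))
  rw [Finset.sum_congr rfl fun ψ hψ => effFun_dag_invState (h.pure ψ hψ)] at h1
  rw [map_sub, map_smul, map_sum,
    Finset.sum_congr rfl fun ψ hψ => effFun_disc_of_pure (h.pure ψ hψ), ← h1]
  simp [mul_comm]

/-- Among the daggers of pure states one has the greatest value on a given vector. The conjugates of
the pure states are those normalised states of `bar A` on which the dagger of some conjugate state
occurs with certainty; this condition is closed. -/
theorem exists_dag_isMax {A : C} (x : StR A) : ∃ α : 𝟙_ C ⟶ A, IsPureSt₁ α ∧
    ∀ γ : 𝟙_ C ⟶ A, IsPureSt₁ γ → effFun (dag γ) x ≤ effFun (dag α) x := by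
  classical
  let b := Module.Basis.ofSpan (span_pure A).ge
  have hb : ∀ i, ∃ ψ : 𝟙_ C ⟶ A, IsPureSt₁ ψ ∧ stVec ψ = b i := fun i =>
    Module.Basis.ofSpan_subset (span_pure A).ge ⟨i, rfl⟩
  choose ψ hψ hψb using hb
  have : Finite ((linearIndepOn_empty ℝ id).extend (Set.empty_subset
    (stVec '' {ψ : 𝟙_ C ⟶ A | IsPureSt₁ ψ}))) := Module.Finite.finite_basis b
  have := Fintype.ofFinite ((linearIndepOn_empty ℝ id).extend (Set.empty_subset
    (stVec '' {ψ : 𝟙_ C ⟶ A | IsPureSt₁ ψ})))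
  let L : StR A →ₗ[ℝ] Module.Dual ℝ (StR (bar A)) :=
    b.constr ℝ fun i => effFun (dag (conj (ψ i)))
  have hL : ∀ γ : 𝟙_ C ⟶ A, IsPureSt₁ γ → ∀ y, L y (stVec (conj γ)) = effFun (dag γ) y := by
    intro γ hγ y
    have : (Module.Dual.eval ℝ _ (stVec (conj γ))) ∘ₗ L = effFun (dag γ) := b.ext fun i => by
      rw [LinearMap.comp_apply, Module.Dual.eval_apply, b.constr_basis, ← hψb, effFun_stVec,
        effFun_stVec, prob_conj_dag_conj (hψ i) hγ]
    exact LinearMap.congr_fun this y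
  have hcont : Continuous fun p : StR (bar A) × StR A => L p.2 p.1 := by
    have : (fun p : StR (bar A) × StR A => L p.2 p.1) =
        fun p => ∑ i, b.repr p.2 i * effFun (dag (conj (ψ i))) p.1 := by
      funext p
      simp only [L, Module.Basis.constr_apply_fintype, LinearMap.sum_apply, LinearMap.smul_apply,
        smul_eq_mul, Module.Basis.equivFun_apply]
    rw [this]
    refine continuous_finsetSum _ fun i _ => Continuous.mul ?_ ?_
    · exact (LinearMap.continuous_of_finiteDimensional (b.coord i)).comp continuous_snd
    · exact (LinearMap.continuous_of_finiteDimensional (effFun _)).comp continuous_fst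
  let K : Set (StR (bar A) × StR A) := (normSet (bar A) ×ˢ normSet A) ∩ ({p | 1 ≤ L p.2 p.1} ∩
    ⋂ α ∈ {α : 𝟙_ C ⟶ A | IsPureSt₁ α},
      {p | L (stVec α) p.1 = effFun (dag (conj α)) p.1})
  have hK : IsCompact K := by
    refine ((isCompact_normSet _).prod (isCompact_normSet _)).inter_right
      ((isClosed_le continuous_const hcont).inter (isClosed_biInter fun α _ => isClosed_eq ?_ ?_))
    · exact (LinearMap.continuous_of_finiteDimensional (L (stVec α))).comp continuous_fst
    · exact (LinearMap.continuous_of_finiteDimensional (effFun _)).comp continuous_fst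
  have hmem : ∀ γ : 𝟙_ C ⟶ A, IsPureSt₁ γ → (stVec (conj γ), stVec γ) ∈ K := by
    intro γ hγ
    refine ⟨⟨?_, ?_⟩, ?_, ?_⟩
    · exact mem_normSet_iff.2 ⟨stVec_mem_StCone _, (isPureSt₁_conj hγ).normalised⟩
    · exact mem_normSet_iff.2 ⟨stVec_mem_StCone _, hγ.normalised⟩
    · show 1 ≤ L (stVec γ) (stVec (conj γ))
      rw [hL γ hγ, effFun_stVec, prob_comp_dag hγ]
    · refine Set.mem_iInter₂.2 fun α hα => ?_
      show L (stVec α) (stVec (conj γ)) = _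
      rw [hL γ hγ, effFun_stVec, effFun_stVec, prob_conj_dag_conj hα hγ]
  obtain ⟨γ₀, hγ₀⟩ := exists_pure A
  obtain ⟨p, ⟨⟨hp1, hp2⟩, hp3, hp4⟩, hmax⟩ := hK.exists_isMaxOn ⟨_, hmem γ₀ hγ₀⟩
    (f := fun p => L x p.1)
    ((LinearMap.continuous_of_finiteDimensional (L x)).comp continuous_fst).continuousOn
  obtain ⟨τ, hτ, hτp⟩ := exists_normalised_of_mem_StCone (mem_normSet_iff.1 hp1).1
    (mem_normSet_iff.1 hp1).2
  obtain ⟨σ, hσ, hσp⟩ := exists_normalised_of_mem_StCone (mem_normSet_iff.1 hp2).1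
    (mem_normSet_iff.1 hp2).2
  obtain ⟨α, hα, hαmax⟩ := exists_pure_isMax (L.flip p.1)
  have h1 : 1 ≤ L (stVec α) p.1 := by
    have := hαmax σ hσ
    rw [hσp] at this
    exact le_trans hp3 this
  have h2 : L (stVec α) p.1 = effFun (dag (conj α)) p.1 := Set.mem_iInter₂.1 hp4 α hα
  have h3 : prob (τ ≫ dag (conj α)) = 1 := by
    refine le_antisymm (prob_le_one _) ?_
    rw [← effFun_stVec, hτp, ← h2]; exact h1
  have h4 : p.1 = stVec (conj α) := by
    rw [← hτp, eq_of_prob_eq_one (isPure_dag (isPureSt₁_conj hα)) h3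
      (prob_comp_dag (isPureSt₁_conj hα))]
  refine ⟨α, hα, fun γ hγ => ?_⟩
  have h5 := hmax (hmem γ hγ)
  simp only [Set.mem_ofPred_eq] at h5
  rwa [hL γ hγ, h4, hL α hα] at h5

/-- Every normalised state dominates the part of it that is detected by the best pure effect. -/
theorem exists_sub_smul_pure_mem {A : C} {σ : 𝟙_ C ⟶ A} (hσ : Normalised σ) :
    ∃ α : 𝟙_ C ⟶ A, IsPureSt₁ α ∧ 0 < prob (σ ≫ dag α) ∧
      stVec σ - prob (σ ≫ dag α) • stVec α ∈ StCone A := by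
  obtain ⟨α, hα, hmax⟩ := exists_dag_isMax (stVec σ)
  have hpos : 0 < prob (σ ≫ dag α) := by
    obtain ⟨t, -, ht, htc⟩ := (isOrtho_empty (A := A)).exists_isComplete
    by_contra hn
    have h1 := htc (stVec σ)
    have h2 : ∑ ψ ∈ t, effFun (dag ψ) (stVec σ) ≤ 0 :=
      Finset.sum_nonpos fun ψ hψ => (hmax ψ (ht.pure ψ hψ)).trans (not_lt.1 hn)
    rw [h1, effFun_stVec, hσ] at h2
    linarith
  refine ⟨α, hα, hpos, ?_⟩
  obtain ⟨B, Ψ, hΨ, hm⟩ := exists_purification hσ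
  have hR : ∀ a : A ⟶ 𝟙_ C, prob (sliceR Ψ a ≫ disc B) = prob (σ ≫ a) := fun a => by
    rw [sliceR_comp_eq, hm]
  obtain ⟨β, hβ, hsβ⟩ := (hΨ.1.sliceR (isPure_dag hα)).exists_smul (by rw [hR]; exact hpos.ne')
  rw [hR] at hsβ
  have e1 : prob (sliceL Ψ (dag β) ≫ dag α) = prob (σ ≫ dag α) := by
    rw [← sliceR_comp_eq, ← effFun_stVec, hsβ, map_smul, effFun_stVec, prob_comp_dag hβ,
      smul_eq_mul, mul_one]
  have e2 : prob (σ ≫ dag α) ≤ prob (sliceL Ψ (dag β) ≫ disc A) := e1 ▸ prob_comp_le_disc _ _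
  obtain ⟨α', hα', hsα⟩ := (hΨ.1.sliceL (isPure_dag hβ)).exists_smul (hpos.trans_le e2).ne'
  have e3 : prob (sliceL Ψ (dag β) ≫ disc A) ≤ prob (σ ≫ dag α') := by
    have h1 : prob (sliceL Ψ (dag β) ≫ dag α') = prob (sliceL Ψ (dag β) ≫ disc A) := by
      rw [← effFun_stVec, hsα, map_smul, effFun_stVec, prob_comp_dag hα', smul_eq_mul, mul_one]
    rw [← h1, ← sliceR_comp_eq, ← hR]
    exact prob_comp_le_disc _ _
  have e4 : prob (sliceL Ψ (dag β) ≫ disc A) = prob (σ ≫ dag α) :=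
    le_antisymm (e3.trans (hmax α' hα')) e2
  rw [e4] at hsα
  have e5 : prob (α' ≫ dag α) = 1 := by
    rw [← effFun_stVec, hsα, map_smul, effFun_stVec, smul_eq_mul] at e1
    exact mul_left_cancel₀ hpos.ne' (by rw [e1, mul_one])
  rw [eq_of_prob_eq_one (isPure_dag hα) e5 (prob_comp_dag hα)] at hsα
  obtain ⟨b', -, hb'⟩ := exists_compl (dag β)
  convert stVec_mem_StCone (sliceL Ψ b') using 1
  rw [← hsα, sub_eq_iff_eq_add, ← hm]
  refine vec_ext fun a => ?_
  rw [map_add, effFun_stVec, effFun_stVec, effFun_stVec, ← sliceR_comp_eq, ← sliceR_comp_eq,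
    ← sliceR_comp_eq, ← hb', add_comm]

/-- Diagonalisation of the elements of the state cone that are orthogonal to a given set. -/
theorem IsOrtho.exists_diag {A : C} {s : Finset (𝟙_ C ⟶ A)} (h : IsOrtho s) {x : StR A}
    (hx : x ∈ StCone A) (h0 : ∀ ψ ∈ s, effFun (dag ψ) x = 0) :
    ∃ t, s ⊆ t ∧ IsOrtho t ∧ IsComplete t ∧ x = ∑ ψ ∈ t, effFun (dag ψ) x • stVec ψ := by
  classical
  obtain ⟨n, hn⟩ := exists_lt_card_add_mul_weight s
  induction n generalizing s x with
  | zero => exact absurd h.card_mul_weight_le (by simpa using hn)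
  | succ n ih =>
    by_cases hx0 : x = 0
    · obtain ⟨t, hst, ht⟩ := h.exists_isComplete
      exact ⟨t, hst, ht.1, ht.2, by simp [hx0]⟩
    obtain ⟨r, hr, σ, hσ, rfl⟩ := exists_smul_of_mem_StCone hx
    have hr0 : r ≠ 0 := fun h => hx0 (by rw [h, zero_smul])
    obtain ⟨α, hα, hpos, hsub⟩ := exists_sub_smul_pure_mem hσ
    have hσ0 : ∀ ψ ∈ s, effFun (dag ψ) (stVec σ) = 0 := fun ψ hψ => by
      have := h0 ψ hψ
      rw [map_smul, smul_eq_mul] at this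
      exact (mul_eq_zero.1 this).resolve_left hr0
    have hα0 : ∀ ψ ∈ s, prob (α ≫ dag ψ) = 0 := fun ψ hψ => by
      have := prob_eq_zero_of_le (smul_mem_StCone (stVec_mem_StCone α) hpos.le) (hσ0 ψ hψ) hsub
      rw [map_smul, smul_eq_mul] at this
      exact (mul_eq_zero.1 this).resolve_left hpos.ne'
    have hαs : α ∉ s := fun hs => by
      have := hα0 α hs
      rw [prob_comp_dag hα] at this
      exact one_ne_zero this
    have hins := h.insert_pure hα hα0
    obtain ⟨t, hst, ht, htc, hsum⟩ := ih hins (x := r • (stVec σ - prob (σ ≫ dag α) • stVec α))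
      (smul_mem_StCone hsub hr) (by
        intro ψ hψ
        rw [map_smul, map_sub, map_smul, effFun_stVec _ α]
        rcases Finset.mem_insert.1 hψ with rfl | hψ
        · rw [prob_comp_dag hα, effFun_stVec]; simp
        · rw [hα0 ψ hψ, hσ0 ψ hψ]; simp) (by
        rw [Finset.card_insert_of_notMem hαs]
        convert hn using 3
        omega)
    refine ⟨t, (Finset.subset_insert α s).trans hst, ht, htc, ?_⟩
    have hαt : α ∈ t := hst (Finset.mem_insert_self α s)
    obtain ⟨y, hy⟩ : ∃ y, y = r • (stVec σ - prob (σ ≫ dag α) • stVec α) := ⟨_, rfl⟩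
    rw [← hy] at hsum
    have hxy : r • stVec σ = y + (r * prob (σ ≫ dag α)) • stVec α := by
      rw [hy, smul_sub, smul_smul, sub_add_cancel]
    have h2 : ∀ ψ ∈ t, effFun (dag ψ) (r • stVec σ) • stVec ψ =
        effFun (dag ψ) y • stVec ψ +
          if ψ = α then (r * prob (σ ≫ dag α)) • stVec α else 0 := by
      intro ψ hψ
      rw [hxy, map_add, map_smul, effFun_stVec _ α, ht.prob_eq hψ hαt, add_smul]
      split_ifs with he
      · rw [he]; simp
      · simp
    rw [Finset.sum_congr rfl h2, Finset.sum_add_distrib, ← hsum, Finset.sum_ite_eq', if_pos hαt,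
      hxy]

/-- The invariant state is an order unit of the state cone. -/
theorem exists_add_smul_invState_mem {A : C} (x : StR A) :
    ∃ r : ℝ, x + r • stVec (invState A) ∈ StCone A ∧ -x + r • stVec (invState A) ∈ StCone A := by
  have hx : x ∈ Submodule.span ℝ (stVec '' {ψ : 𝟙_ C ⟶ A | IsPureSt₁ ψ}) := by
    rw [span_pure]; trivial
  induction hx using Submodule.span_induction with
  | mem x hx =>
    obtain ⟨ψ, hψ, rfl⟩ := hx
    refine ⟨(weight A)⁻¹, ?_, ?_⟩
    · exact Submodule.add_mem _ (stVec_mem_StCone _)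
        (smul_mem_StCone (stVec_mem_StCone _) (inv_nonneg.2 (weight_pos A).le))
    · have := smul_mem_StCone (invState_sub_mem hψ) (inv_nonneg.2 (weight_pos A).le)
      rwa [smul_sub, smul_smul, inv_mul_cancel₀ (weight_pos A).ne', one_smul,
        sub_eq_neg_add] at this
  | zero => exact ⟨0, by simp⟩
  | add x y _ _ hx hy =>
    obtain ⟨r, h1, h2⟩ := hx
    obtain ⟨r', h1', h2'⟩ := hy
    refine ⟨r + r', ?_, ?_⟩
    · convert Submodule.add_mem _ h1 h1' using 1
      module
    · convert Submodule.add_mem _ h2 h2' using 1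
      module
  | smul c x _ hx =>
    obtain ⟨r, h1, h2⟩ := hx
    rcases le_total 0 c with hc | hc
    · refine ⟨c * r, ?_, ?_⟩
      · convert smul_mem_StCone h1 hc using 1
        module
      · convert smul_mem_StCone h2 hc using 1
        module
    · refine ⟨-c * r, ?_, ?_⟩
      · convert smul_mem_StCone h2 (neg_nonneg.2 hc) using 1
        module
      · convert smul_mem_StCone h1 (neg_nonneg.2 hc) using 1
        module

/-- Diagonalisation of an arbitrary vector of `St_ℝ(A)`. -/
theorem exists_diag {A : C} (x : StR A) :
    ∃ t, IsOrtho t ∧ IsComplete t ∧ x = ∑ ψ ∈ t, effFun (dag ψ) x • stVec ψ := by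
  obtain ⟨r, hr, -⟩ := exists_add_smul_invState_mem x
  obtain ⟨t, -, ht, htc, hsum⟩ := (isOrtho_empty (A := A)).exists_diag hr (by simp)
  refine ⟨t, ht, htc, ?_⟩
  have h1 : ∑ ψ ∈ t, effFun (dag ψ) (x + r • stVec (invState A)) • stVec ψ =
      ∑ ψ ∈ t, effFun (dag ψ) x • stVec ψ + r • stVec (invState A) := by
    have h2 : ∀ ψ ∈ t, effFun (dag ψ) (x + r • stVec (invState A)) • stVec ψ =
        effFun (dag ψ) x • stVec ψ + (r * weight A) • stVec ψ := fun ψ hψ => by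
      rw [map_add, map_smul, effFun_dag_invState (ht.pure ψ hψ), add_smul, smul_eq_mul]
    rw [Finset.sum_congr rfl h2, Finset.sum_add_distrib, ← Finset.smul_sum, mul_smul,
      ← IsComplete.invState_eq ht htc]
  rw [h1] at hsum
  exact add_right_cancel hsum

end Frames

/-! ### Teleportation through the Bell state -/

section Teleportation

set_option linter.unusedSectionVars false

variable {C : Type u} [Category.{v} C] [MonoidalCategory C] [SymmetricCategory C] [OPTData C]
  [hC : Fact (IsSharpTheoryWithPurification C)]

theorem IsComplete.card_mul_weight {A : C} {s : Finset (𝟙_ C ⟶ A)} (h : IsOrtho s)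
    (hc : IsComplete s) : s.card * weight A = 1 := by
  have h1 := hc (stVec (invState A))
  rw [Finset.sum_congr rfl fun ψ hψ => effFun_dag_invState (h.pure ψ hψ), Finset.sum_const,
    nsmul_eq_mul] at h1
  exact h1.trans (normalised_invState A)

theorem vec_ext_dag {A : C} {x y : StR A}
    (h : ∀ ψ : 𝟙_ C ⟶ A, IsPureSt₁ ψ → effFun (dag ψ) x = effFun (dag ψ) y) : x = y := by
  obtain ⟨t, ht, -, hxy⟩ := exists_diag (x - y)
  rw [← sub_eq_zero, hxy]
  refine Finset.sum_eq_zero fun ψ hψ => ?_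
  rw [map_sub, h ψ (ht.pure ψ hψ), sub_self, zero_smul]

/-- A state in the face spanned by two orthogonal pure states is either pure or an interior point of
the face. -/
theorem isPure_or_exists_sub_mem {A : C} {φ₁ φ₀ σ : 𝟙_ C ⟶ A} (h₁ : IsPureSt₁ φ₁)
    (h₀ : IsPureSt₁ φ₀) (h : prob (φ₀ ≫ dag φ₁) = 0) (hσ : Normalised σ)
    (hF : prob (σ ≫ dag φ₁) + prob (σ ≫ dag φ₀) = 1) :
    IsPure σ ∨ ∃ ε : ℝ, 0 < ε ∧ stVec σ - ε • (stVec φ₁ + stVec φ₀) ∈ StCone A := by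
  classical
  have hne : φ₀ ≠ φ₁ := by
    rintro rfl
    rw [prob_comp_dag h₁] at h
    exact one_ne_zero h
  have hs₀ : IsOrtho (insert φ₀ (insert φ₁ ∅)) :=
    (isOrtho_empty.insert_pure h₁ (by simp)).insert_pure h₀ (by simpa using h)
  obtain ⟨s, hs₀s, hs, hsc⟩ := hs₀.exists_isComplete
  have h0s : φ₀ ∈ s := hs₀s (by simp)
  have h1s : φ₁ ∈ s.erase φ₀ := Finset.mem_erase.2 ⟨hne.symm, hs₀s (by simp)⟩
  set s' := (s.erase φ₀).erase φ₁ with hs'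
  have hs's : s' ⊆ s := (Finset.erase_subset _ _).trans (Finset.erase_subset _ _)
  have hsum : ∀ {M : Type} [AddCommMonoid M] (f : (𝟙_ C ⟶ A) → M),
      ∑ ψ ∈ s, f ψ = f φ₀ + (f φ₁ + ∑ ψ ∈ s', f ψ) := fun f => by
    rw [hs', Finset.add_sum_erase _ _ h1s, Finset.add_sum_erase _ _ h0s]
  have hzero : ∀ ψ ∈ s', effFun (dag ψ) (stVec σ) = 0 := by
    have h2 := hsc (stVec σ)
    rw [hsum, effFun_stVec, effFun_stVec, effFun_stVec, hσ] at h2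
    exact (Finset.sum_eq_zero_iff_of_nonneg
      fun ψ _ => effFun_nonneg _ (stVec_mem_StCone σ)).1 (by linarith)
  obtain ⟨t, hst, ht, htc, hσt⟩ := (hs.mono hs's).exists_diag (stVec_mem_StCone σ) hzero
  have hd : ∑ ψ ∈ t \ s', stVec ψ = stVec φ₁ + stVec φ₀ := by
    have h2 := (htc.invState_eq ht).symm.trans (hsc.invState_eq hs)
    have h3 := smul_right_injective _ (weight_pos A).ne' h2
    rw [← Finset.sum_sdiff hst, ← Finset.add_sum_erase _ _ h0s, ← Finset.add_sum_erase _ _ h1s,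
      ← add_assoc] at h3
    rw [add_right_cancel h3, add_comm]
  have hσd : stVec σ = ∑ ψ ∈ t \ s', effFun (dag ψ) (stVec σ) • stVec ψ := by
    rw [← Finset.sum_sdiff hst, Finset.sum_eq_zero (s := s'), add_zero] at hσt
    · exact hσt
    · intro ψ hψ
      rw [hzero ψ hψ, zero_smul]
  have hcard : (t \ s').card = 2 := by
    have h2 : t.card = s.card := by
      have := (htc.card_mul_weight ht).trans (hsc.card_mul_weight hs).symm
      exact_mod_cast mul_right_cancel₀ (weight_pos A).ne' this
    have h3 := Finset.card_erase_add_one h0s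
    have h4 := Finset.card_erase_add_one h1s
    rw [← hs'] at h4
    rw [Finset.card_sdiff_of_subset hst, h2]
    omega
  by_cases hall : ∀ ψ ∈ t \ s', 0 < effFun (dag ψ) (stVec σ)
  · right
    obtain ⟨ψ₀, hψ₀, hmin⟩ := Finset.exists_min_image (t \ s') (fun ψ => effFun (dag ψ) (stVec σ))
      (Finset.card_pos.1 (by omega))
    refine ⟨_, hall ψ₀ hψ₀, ?_⟩
    rw [← hd]
    nth_rewrite 1 [hσd]
    rw [Finset.smul_sum, ← Finset.sum_sub_distrib]
    refine Submodule.sum_mem _ fun ψ hψ => ?_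
    convert smul_mem_StCone (stVec_mem_StCone ψ) (sub_nonneg.2 (hmin ψ hψ)) using 1
    module
  · left
    push Not at hall
    obtain ⟨ψ₀, hψ₀, hle⟩ := hall
    have h2 : effFun (dag ψ₀) (stVec σ) = 0 :=
      le_antisymm hle (effFun_nonneg _ (stVec_mem_StCone σ))
    obtain ⟨g, hg⟩ := Finset.card_eq_one.1
      (show ((t \ s').erase ψ₀).card = 1 by rw [Finset.card_erase_of_mem hψ₀, hcard])
    rw [← Finset.add_sum_erase _ _ hψ₀, h2, zero_smul, zero_add, hg, Finset.sum_singleton] at hσd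
    have hgt : g ∈ t := by
      have : g ∈ (t \ s').erase ψ₀ := by rw [hg]; exact Finset.mem_singleton_self g
      exact (Finset.mem_sdiff.1 (Finset.mem_of_mem_erase this)).1
    have h3 := congrArg (effFun (disc A)) hσd
    rw [map_smul, effFun_disc_of_pure (ht.pure g hgt), effFun_stVec, hσ, smul_eq_mul, mul_one] at h3
    rw [← h3, one_smul] at hσd
    rw [stVec_injective hσd]
    exact (ht.pure g hgt).1

theorem dag_prodSt {A B : C} {σ : 𝟙_ C ⟶ A} {τ : 𝟙_ C ⟶ B} (hσ : IsPureSt₁ σ) (hτ : IsPureSt₁ τ) :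
    dag (prodSt σ τ) = prodEff (dag σ) (dag τ) :=
  (eq_dag (hσ.prodSt hτ) ((isPure_dag hσ).prodEff (isPure_dag hτ)) (by
    rw [prodSt_comp_prodEff, prob_comp, prob_comp_dag hσ, prob_comp_dag hτ, mul_one])).symm

theorem prob_bell_dag_prodSt {A : C} {γ α : 𝟙_ C ⟶ A} (hγ : IsPureSt₁ γ) (hα : IsPureSt₁ α) :
    prob (bell A ≫ dag (prodSt γ (conj α))) = weight A * prob (α ≫ dag γ) := by
  rw [dag_prodSt hγ (isPureSt₁_conj hα), ← sliceL_comp, ← effFun_stVec, sliceL_bell_dag hα,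
    map_smul, effFun_stVec, smul_eq_mul]

/-- Inserting the conjugate of `α` into the dagger of the Bell state gives a multiple of `dag α`. -/
theorem effSliceL_dag_bell {A : C} {α : 𝟙_ C ⟶ A} (hα : IsPureSt₁ α) (x : StR A) :
    effFun (effSliceL (dag (bell A)) (conj α)) x =
      prob (prodSt α (conj α) ≫ dag (bell A)) * effFun (dag α) x := by
  classical
  have hβ := isPureSt₁_conj hα
  have hB := isPureSt₁_bell A
  set e := effSliceL (dag (bell A)) (conj α) with he
  have hep : IsPure e := (isPure_dag hB).effSliceL hβ.1
  have h0 : ∀ γ : 𝟙_ C ⟶ A, IsPureSt₁ γ → prob (γ ≫ dag α) = 0 → prob (γ ≫ e) = 0 := by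
    intro γ hγ hγα
    rw [he, comp_effSliceL]
    exact prob_dag_eq_zero_symm (hγ.prodSt hβ) hB (by
      rw [prob_bell_dag_prodSt hγ hα, prob_dag_eq_zero_symm hα hγ hγα, mul_zero])
  have hχ : prob (invState A ≫ e) = weight A * prob (α ≫ e) := by
    obtain ⟨s, hαs, hs, hsc⟩ := (isOrtho_empty.insert_pure hα (by simp)).exists_isComplete
    have hαs' : α ∈ s := hαs (by simp)
    rw [← effFun_stVec, hsc.invState_eq hs, map_smul, map_sum, ← Finset.add_sum_erase _ _ hαs',
      Finset.sum_eq_zero, add_zero, smul_eq_mul, effFun_stVec]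
    intro γ hγ
    have hγ' := Finset.mem_erase.1 hγ
    exact h0 γ (hs.pure γ hγ'.2) (hs.ortho α hαs' γ hγ'.2 hγ'.1.symm)
  rw [← comp_effSliceL, ← he]
  by_cases hz : prob (α ≫ e) = 0
  · rw [hz, mul_zero] at hχ
    rw [hz, zero_mul, eq_zero_of_invState (fun x hx => effFun_nonneg e hx) hχ]
    rfl
  have hd : prob (sliceR (bell A) e ≫ disc (bar A)) = weight A * prob (α ≫ e) := by
    rw [prob_sliceR_bell_disc, hχ]
  have hne : weight A * prob (α ≫ e) ≠ 0 := mul_ne_zero (weight_pos A).ne' hz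
  obtain ⟨β', hβ', hβv⟩ := (hB.1.sliceR hep).exists_smul (by rw [hd]; exact hne)
  rw [hd] at hβv
  have h1 := effFun_eq_bell e hα
  rw [hβv, map_smul, effFun_stVec, effFun_stVec, smul_eq_mul] at h1
  have h2 : prob (β' ≫ dag (conj α)) = 1 := mul_left_cancel₀ hne (by rw [h1, mul_one])
  rw [eq_of_prob_eq_one (isPure_dag hβ) h2 (prob_comp_dag hβ), mul_comm, mul_smul,
    ← sliceR_bell_dag hα] at hβv
  have h3 : effFun e = prob (α ≫ e) • effFun (dag α) := eq_of_pure fun ψ hψ => by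
    have h4 := congrArg (effFun (dag (conj ψ))) hβv
    rw [map_smul, effFun_eq_bell e hψ, effFun_eq_bell _ hψ, smul_eq_mul, mul_left_comm] at h4
    exact mul_left_cancel₀ (weight_pos A).ne' h4
  rw [h3]
  rfl

/-- Reversible channels on `A` are mirrored, through the Bell state, by reversible channels on
`bar A`. -/
theorem conj_comp_hom {A : C} {α : 𝟙_ C ⟶ A} (hα : IsPureSt₁ α) {U : A ≅ A} (hU : IsReversible U) :
    ∃ W : bar A ≅ bar A, IsReversible W ∧ conj (α ≫ U.hom) = conj α ≫ W.inv ∧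
      bell A ≫ (U.hom ▷ bar A) = bell A ≫ (A ◁ W.hom) := by
  have hB := isPureSt₁_bell A
  have hBU : IsPureSt₁ (bell A ≫ (U.hom ▷ bar A)) :=
    isPureSt₁_of_pure (hB.1.comp (hU.isPure.whiskerRight _))
      (hB.normalised.comp (hU.1.whiskerRight _))
  obtain ⟨W, hW, hWB⟩ := exists_reversible hB hBU (by
    rw [sliceL_whiskerRight, sliceL_bell_disc, invState_comp])
  refine ⟨W, hW, ?_, hWB⟩
  have hαU := hα.comp_reversible hU
  have h1 : bell A ≫ (A ◁ W.inv) = bell A ≫ (U.inv ▷ bar A) := by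
    calc bell A ≫ (A ◁ W.inv)
        = (bell A ≫ (U.hom ▷ bar A)) ≫ ((U.inv ▷ bar A) ≫ (A ◁ W.inv)) := by
          rw [Category.assoc, ← comp_whiskerRight_assoc, Iso.hom_inv_id]; simp
      _ = bell A ≫ (U.inv ▷ bar A) := by
          rw [hWB, ← whisker_exchange, Category.assoc, ← whiskerLeft_comp_assoc, Iso.hom_inv_id]
          simp
  apply stVec_injective
  apply smul_right_injective _ (weight_pos A).ne'
  show weight A • _ = weight A • _
  rw [← sliceR_bell_dag hαU, dag_comp_hom hα hU, ← sliceR_whiskerRight, ← h1, sliceR_whiskerLeft,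
    ← act_stVec, sliceR_bell_dag hα, map_smul, act_stVec]

theorem prob_prodSt_conj_dag_bell {A : C} {α γ : 𝟙_ C ⟶ A} (hα : IsPureSt₁ α) (hγ : IsPureSt₁ γ) :
    prob (prodSt γ (conj γ) ≫ dag (bell A)) = prob (prodSt α (conj α) ≫ dag (bell A)) := by
  obtain ⟨U, hU, rfl⟩ := exists_reversible_pure hα hγ
  obtain ⟨W, hW, hc, hWB⟩ := conj_comp_hom hα hU
  have hB := isPureSt₁_bell A
  have h1 : (U.hom ▷ bar A) ≫ (A ◁ W.inv) ≫ dag (bell A) = dag (bell A) := by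
    refine eq_dag hB ((hU.isPure.whiskerRight _).comp
      ((hW.symm.isPure.whiskerLeft A).comp (isPure_dag hB))) ?_
    rw [← Category.assoc, hWB, Category.assoc, ← whiskerLeft_comp_assoc, Iso.hom_inv_id]
    simpa using prob_comp_dag hB
  rw [hc, ← prodSt_comp_whiskerLeft, ← prodSt_comp_whiskerRight, Category.assoc, Category.assoc, h1]

variable (C) in
/-- The dagger of the Bell state, applied to a conjugate pure state, is a multiple of the dagger of
the state, with a positive factor that does not depend on the state. -/
theorem exists_bell_effect (A : C) : ∃ r : ℝ, 0 < r ∧ ∀ α : 𝟙_ C ⟶ A, IsPureSt₁ α → ∀ x,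
    effFun (effSliceL (dag (bell A)) (conj α)) x = r * effFun (dag α) x := by
  obtain ⟨α₀, hα₀⟩ := exists_pure A
  refine ⟨prob (prodSt α₀ (conj α₀) ≫ dag (bell A)), ?_, fun α hα x => ?_⟩
  · refine lt_of_le_of_ne (prob_nonneg _) fun h => ?_
    have h1 := prob_dag_eq_zero_symm (isPureSt₁_bell A) (hα₀.prodSt (isPureSt₁_conj hα₀)) h.symm
    rw [prob_bell_dag_prodSt hα₀ hα₀, prob_comp_dag hα₀, mul_one] at h1
    exact (weight_pos A).ne' h1
  · rw [effSliceL_dag_bell hα, prob_prodSt_conj_dag_bell hα₀ hα]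

/-- Teleportation through the Bell state and its dagger. -/
theorem sliceL_bell_effSliceR {A : C} {r : ℝ} (hr : ∀ α : 𝟙_ C ⟶ A, IsPureSt₁ α → ∀ x,
    effFun (effSliceL (dag (bell A)) (conj α)) x = r * effFun (dag α) x) (σ : 𝟙_ C ⟶ A) :
    stVec (sliceL (bell A) (effSliceR (dag (bell A)) σ)) = (weight A * r) • stVec σ := by
  refine vec_ext_dag fun ψ hψ => ?_
  rw [effFun_stVec, ← sliceR_comp_eq, ← effFun_stVec, sliceR_bell_dag hψ, map_smul, effFun_stVec,
    comp_effSliceR, ← comp_effSliceL, ← effFun_stVec, hr ψ hψ, map_smul, smul_eq_mul, smul_eq_mul,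
    mul_assoc]

end Teleportation

/-! ### Automorphisms of the state cone -/

section Automorphisms

set_option linter.unusedSectionVars false

variable {C : Type u} [Category.{v} C] [MonoidalCategory C] [SymmetricCategory C] [OPTData C]
  [hC : Fact (IsSharpTheoryWithPurification C)]

/-- The normalised state complementary to `α` in the invariant state. -/
theorem exists_compl_state {A : C} {α : 𝟙_ C ⟶ A} (hα : IsPureSt₁ α) (hq : weight A < 1) :
    ∃ κ : 𝟙_ C ⟶ A, Normalised κ ∧ prob (κ ≫ dag α) = 0 ∧
      stVec κ = (1 - weight A)⁻¹ • (stVec (invState A) - weight A • stVec α) := by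
  obtain ⟨κ, hκ, hκv⟩ := exists_normalised_of_mem_StCone
    (smul_mem_StCone (invState_sub_mem hα) (inv_nonneg.2 (sub_nonneg.2 hq.le))) (by
    rw [map_smul, map_sub, map_smul, effFun_stVec, effFun_stVec, normalised_invState A,
      hα.normalised, smul_eq_mul, smul_eq_mul, mul_one, inv_mul_cancel₀ (by linarith)])
  refine ⟨κ, hκ, ?_, hκv⟩
  rw [← effFun_stVec, hκv, map_smul, map_sub, map_smul, effFun_stVec, effFun_stVec,
    prob_invState_dag hα, prob_comp_dag hα]
  simp

/-- `P` is a pure projector on the orthogonal complement of `α`. -/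
structure IsComplProjector {A : C} (α : 𝟙_ C ⟶ A) (P : A ⟶ A) : Prop where
  pure : IsPure P
  disc_act : ∀ x, effFun (disc A) (act P x) + effFun (dag α) x = effFun (disc A) x
  act_invState : act P (stVec (invState A)) = stVec (invState A) - weight A • stVec α
  dag_act : ∀ x, effFun (dag α) (act P x) = 0
  fix : ∀ (S : C) (Θ : 𝟙_ C ⟶ A ⊗ S), Normalised Θ → stVec (sliceL Θ (disc S)) =
    (1 - weight A)⁻¹ • (stVec (invState A) - weight A • stVec α) → Θ ≫ (P ▷ S) = Θ

theorem exists_isComplProjector {A : C} {α : 𝟙_ C ⟶ A} (hα : IsPureSt₁ α) (hq : weight A < 1) :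
    ∃ P : A ⟶ A, IsComplProjector α P := by
  obtain ⟨κ, hκ, hκ0, hκv⟩ := exists_compl_state hα hq
  obtain ⟨P, hP, hu, hfix, hΘ⟩ := exists_projector hα hκ hκ0
  have hne : 1 - weight A ≠ 0 := by linarith
  have h1 : act P (stVec (invState A) - weight A • stVec α) =
      stVec (invState A) - weight A • stVec α := by
    have h2 : act P (stVec κ) = stVec κ := by rw [act_stVec, hfix κ hκ0]
    rw [hκv, map_smul] at h2
    exact smul_right_injective _ (inv_ne_zero hne) h2
  have h2 : act P (stVec α) = 0 := by
    refine eq_zero_of_mem_StCone (act_mem_StCone P (stVec_mem_StCone α)) ?_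
    have := hu (stVec α)
    rw [effFun_disc_of_pure hα, effFun_stVec, prob_comp_dag hα] at this
    linarith
  have h3 : act P (stVec (invState A)) = stVec (invState A) - weight A • stVec α := by
    rw [map_sub, map_smul, h2, smul_zero, sub_zero] at h1
    exact h1
  refine ⟨P, hP, hu, h3, fun x => ?_, hΘ⟩
  have h4 := eq_zero_of_invState (f := effFun (P ≫ dag α)) (fun x hx => effFun_nonneg _ hx) (by
    rw [← effFun_act, h3, map_sub, map_smul, effFun_dag_invState hα, effFun_stVec,
      prob_comp_dag hα]
    simp)
  rw [effFun_act, h4]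
  rfl

/-- On the segment between two orthogonal pure states, the product state `α ⊗ conj α` and the
normalised projection of the Bell state, each point is moved along a direction of vanishing
marginals to a pure state: the last point of the face in that direction. -/
theorem exists_pure_in_face {A : C} {α : 𝟙_ C ⟶ A} (hα : IsPureSt₁ α) (hq : weight A < 1)
    {P : A ⟶ A} (hP : IsComplProjector α P) {p : ℝ} (hp0 : 0 ≤ p) (hp1 : p ≤ 1) :
    ∃ (Ψ : 𝟙_ C ⟶ A ⊗ bar A) (s : ℝ), IsPure Ψ ∧
      stVec Ψ = (p - s * weight A) • stVec (prodSt α (conj α)) +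
        ((1 - p) / (1 - weight A) - s) • stVec (bell A ≫ (P ▷ bar A)) + s • stVec (bell A) := by
  have hB := isPureSt₁_bell A
  have hβ := isPureSt₁_conj hα
  have h₁ := hα.prodSt hβ
  set f₁ := prodSt α (conj α) with hf₁
  set q := weight A with hqd
  have hq0 : 0 < q := weight_pos A
  have hne : 1 - q ≠ 0 := by linarith
  have hw : prob ((bell A ≫ (P ▷ bar A)) ≫ disc (A ⊗ bar A)) = 1 - q := by
    have h := hP.disc_act (stVec (invState A))
    rw [effFun_dag_invState hα, act_stVec, effFun_stVec, effFun_stVec, normalised_invState A] at h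
    rw [← prodEff_disc, ← sliceL_comp, sliceL_whiskerRight, sliceL_bell_disc]
    linarith
  obtain ⟨f₀, h₀, hf₀⟩ := (hB.1.comp (hP.pure.whiskerRight (bar A))).exists_smul
    (by rw [hw]; exact hne)
  rw [hw] at hf₀
  have ho : prob (f₀ ≫ dag f₁) = 0 := by
    have h : effFun (dag f₁) (stVec (bell A ≫ (P ▷ bar A))) = 0 := by
      rw [effFun_stVec, hf₁, dag_prodSt hα hβ, ← sliceL_comp, sliceL_whiskerRight, ← effFun_stVec,
        ← act_stVec, hP.dag_act]
    rw [hf₀, map_smul, smul_eq_mul, effFun_stVec] at h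
    exact (mul_eq_zero.1 h).resolve_left hne
  have ho' : prob (f₁ ≫ dag f₀) = 0 := prob_dag_eq_zero_symm h₁ h₀ ho
  have hfix : f₀ ≫ (P ▷ bar A) = f₀ := by
    refine hP.fix _ _ h₀.normalised ?_
    have h : stVec (sliceL (bell A ≫ (P ▷ bar A)) (disc (bar A))) =
        (1 - q) • stVec (sliceL f₀ (disc (bar A))) := by
      rw [stVec_sliceL, hf₀, map_smul, ← stVec_sliceL]
    rw [sliceL_whiskerRight, sliceL_bell_disc, ← act_stVec, hP.act_invState] at h
    rw [h, smul_smul, inv_mul_cancel₀ hne, one_smul]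
  have hb₁ : prob (bell A ≫ dag f₁) = q := by
    rw [hf₁, prob_bell_dag_prodSt hα hα, prob_comp_dag hα, mul_one]
  have hb₀ : prob (bell A ≫ dag f₀) = 1 - q := by
    have h : (P ▷ bar A) ≫ dag f₀ = dag f₀ :=
      eq_dag h₀ ((hP.pure.whiskerRight _).comp (isPure_dag h₀))
        (by rw [← Category.assoc, hfix, prob_comp_dag h₀])
    rw [← h, ← Category.assoc, ← effFun_stVec, hf₀, map_smul, effFun_stVec, prob_comp_dag h₀,
      smul_eq_mul, mul_one]
  obtain ⟨v, hv⟩ : ∃ v, v = stVec (bell A) - q • stVec f₁ - (1 - q) • stVec f₀ := ⟨_, rfl⟩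
  have hvu : effFun (disc _) v = 0 := by
    rw [hv, map_sub, map_sub, map_smul, map_smul, effFun_disc_of_pure hB, effFun_disc_of_pure h₁,
      effFun_disc_of_pure h₀]
    simp
  have hv₁ : effFun (dag f₁) v = 0 := by
    rw [hv, map_sub, map_sub, map_smul, map_smul, effFun_stVec, effFun_stVec, effFun_stVec, hb₁,
      prob_comp_dag h₁, ho]
    simp
  have hv₀ : effFun (dag f₀) v = 0 := by
    rw [hv, map_sub, map_sub, map_smul, map_smul, effFun_stVec, effFun_stVec, effFun_stVec, hb₀,
      prob_comp_dag h₀, ho']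
    simp
  have hvne : v ≠ 0 := by
    intro h
    rw [hv, sub_sub, sub_eq_zero] at h
    obtain ⟨c, -, hc⟩ := hB.1.extremal (smul_mem_StCone (stVec_mem_StCone f₁) hq0.le)
      (smul_mem_StCone (stVec_mem_StCone f₀) (by linarith : 0 ≤ 1 - q)) h.symm
    have e1 := congrArg (effFun (dag f₁)) hc
    have e2 := congrArg (effFun (disc _)) hc
    rw [map_smul, map_smul, effFun_stVec, effFun_stVec, hb₁, prob_comp_dag h₁, smul_eq_mul,
      smul_eq_mul, mul_one] at e1
    rw [map_smul, map_smul, effFun_disc_of_pure h₁, effFun_disc_of_pure hB, smul_eq_mul,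
      smul_eq_mul, mul_one, mul_one] at e2
    have e3 : q * q = q * 1 := by rw [mul_one]; nth_rewrite 1 [e2]; exact e1.symm
    exact hq.ne (mul_left_cancel₀ hq0.ne' e3)
  obtain ⟨b, hb⟩ : ∃ b, b = p • stVec f₁ + (1 - p) • stVec f₀ := ⟨_, rfl⟩
  let K : Set ℝ := {s | b + s • v ∈ normSet (A ⊗ bar A)}
  have hKc : IsClosed K :=
    (isCompact_normSet _).isClosed.preimage (f := fun s : ℝ => b + s • v) (by fun_prop)
  have hKb : Bornology.IsBounded K := by
    obtain ⟨a, ha⟩ : ∃ a, effFun a v ≠ 0 := by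
      by_contra hcon
      push Not at hcon
      exact hvne (vec_ext fun a => by rw [hcon a, map_zero])
    refine isBounded_iff_forall_norm_le.2 ⟨(1 + |effFun a b|) / |effFun a v|, fun s hs => ?_⟩
    rw [le_div_iff₀ (abs_pos.2 ha), Real.norm_eq_abs, ← abs_mul]
    obtain ⟨hs1, hs2⟩ := mem_normSet_iff.1 hs
    have e1 := effFun_nonneg a hs1
    have e2 := effFun_le_disc a hs1
    rw [hs2] at e2
    rw [map_add, map_smul, smul_eq_mul] at e1 e2
    refine abs_le.2 ⟨?_, ?_⟩ <;> linarith [neg_abs_le (effFun a b), le_abs_self (effFun a b)]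
  have hK0 : (0 : ℝ) ∈ K := by
    show b + (0 : ℝ) • v ∈ normSet _
    rw [zero_smul, add_zero, mem_normSet_iff, hb]
    refine ⟨Submodule.add_mem _ (smul_mem_StCone (stVec_mem_StCone _) hp0)
      (smul_mem_StCone (stVec_mem_StCone _) (sub_nonneg.2 hp1)), ?_⟩
    rw [map_add, map_smul, map_smul, effFun_disc_of_pure h₁, effFun_disc_of_pure h₀]
    simp
  obtain ⟨s, hs, hmax⟩ := (Metric.isCompact_of_isClosed_isBounded hKc hKb).exists_isMaxOn ⟨0, hK0⟩
    continuousOn_id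
  obtain ⟨hs1, hs2⟩ := mem_normSet_iff.1 hs
  obtain ⟨Ψ, hΨ, hΨv⟩ := exists_normalised_of_mem_StCone hs1 hs2
  refine ⟨Ψ, s, ?_, ?_⟩
  · refine (isPure_or_exists_sub_mem h₁ h₀ ho hΨ ?_).resolve_right ?_
    · rw [← effFun_stVec, ← effFun_stVec, hΨv, map_add, map_add, map_smul, map_smul, hv₁, hv₀, hb,
        map_add, map_add, map_smul, map_smul, map_smul, map_smul, effFun_stVec, effFun_stVec,
        effFun_stVec, effFun_stVec, prob_comp_dag h₁, prob_comp_dag h₀, ho, ho']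
      simp
    · -- otherwise the point could be moved further
      rintro ⟨ε, hε, hmem⟩
      have hmem2 : s + ε ∈ K := by
        refine mem_normSet_iff.2 ⟨?_, ?_⟩
        · have e : b + (s + ε) • v = (stVec Ψ - ε • (stVec f₁ + stVec f₀)) +
              (ε • stVec (bell A) + ((ε * (1 - q)) • stVec f₁ + (ε * q) • stVec f₀)) := by
            rw [hΨv, hv]; module
          rw [e]
          exact Submodule.add_mem _ hmem (Submodule.add_mem _
            (smul_mem_StCone (stVec_mem_StCone _) hε.le) (Submodule.add_mem _
            (smul_mem_StCone (stVec_mem_StCone _) (mul_nonneg hε.le (by linarith)))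
            (smul_mem_StCone (stVec_mem_StCone _) (mul_nonneg hε.le hq0.le))))
        · rw [add_smul, ← add_assoc, map_add, hs2, map_smul, hvu]
          simp
      have h := hmax hmem2
      simp only [id, Set.mem_ofPred_eq] at h
      linarith
  · have e : ((1 - p) / (1 - q) - s) * (1 - q) = (1 - p) - s * (1 - q) := by field_simp
    rw [hΨv, hb, hv, hf₀, smul_smul, e]
    module

/-- Teleporting through the pure states of the face yields pure transformations. -/
theorem exists_pure_of_face {A : C} {α : 𝟙_ C ⟶ A} (hα : IsPureSt₁ α) (hq : weight A < 1)
    {P : A ⟶ A} (hP : IsComplProjector α P) {r : ℝ} (hr : ∀ α : 𝟙_ C ⟶ A, IsPureSt₁ α → ∀ x,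
    effFun (effSliceL (dag (bell A)) (conj α)) x = r * effFun (dag α) x)
    {p : ℝ} (hp0 : 0 ≤ p) (hp1 : p ≤ 1) :
    ∃ (S : A ⟶ A) (s : ℝ), IsPure S ∧ ∀ x, act S x =
      (r * (p - s * weight A) * effFun (dag α) x) • stVec α +
        (r * (((1 - p) / (1 - weight A) - s) * weight A)) • act P x +
        (r * (s * weight A)) • x := by
  obtain ⟨Ψ, s, hΨ, hΨv⟩ := exists_pure_in_face hα hq hP hp0 hp1
  refine ⟨teleport (dag (bell A)) Ψ, s, (isPure_dag (isPureSt₁_bell A)).teleport hΨ, fun x => ?_⟩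
  let R : StR A →ₗ[ℝ] StR A :=
    (r * (p - s * weight A)) • (effFun (dag α)).smulRight (stVec α) +
      (r * (((1 - p) / (1 - weight A) - s) * weight A)) • act P +
      (r * (s * weight A)) • LinearMap.id
  have hR : act (teleport (dag (bell A)) Ψ) = R := by
    refine LinearMap.ext_on (span_range_stVec A) ?_
    rintro _ ⟨σ, rfl⟩
    have e := sliceL_bell_effSliceR hr σ
    have e1 : prob (conj α ≫ effSliceR (dag (bell A)) σ) = r * effFun (dag α) (stVec σ) := by
      rw [comp_effSliceR, ← comp_effSliceL, ← hr α hα, effFun_stVec]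
    rw [act_stVec, comp_teleport, stVec_sliceL, hΨv, map_add, map_add, map_smul, map_smul, map_smul,
      ← stVec_sliceL, ← stVec_sliceL, ← stVec_sliceL, sliceL_prodSt, stVec_smul_comp, e1,
      sliceL_whiskerRight, ← act_stVec, e, map_smul]
    simp only [R, LinearMap.add_apply, LinearMap.smul_apply, LinearMap.smulRight_apply,
      LinearMap.id_apply]
    module
  rw [hR]
  simp only [R, LinearMap.add_apply, LinearMap.smul_apply, LinearMap.smulRight_apply,
    LinearMap.id_apply]
  module

theorem stVec_sliceR {A B : C} (Ψ : 𝟙_ C ⟶ A ⊗ B) (a : A ⟶ 𝟙_ C) :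
    stVec (sliceR Ψ a) = act ((a ▷ B) ≫ (λ_ B).hom) (stVec Ψ) := by
  rw [act_stVec, sliceR]

/-- A pure transformation that occurs with the same positive probability on all states is a multiple
of a reversible one. -/
theorem exists_act_eq_smul {A : C} {M : A ⟶ A} (hM : IsPure M) {c : ℝ} (hc : 0 < c)
    (h : ∀ x, effFun (disc A) (act M x) = c * effFun (disc A) x) :
    ∃ U : A ≅ A, ∀ x, act M x = c • act U.hom x := by
  have hB := isPureSt₁_bell A
  have hw : prob ((bell A ≫ (M ▷ bar A)) ≫ disc _) = c := by
    rw [← prodEff_disc, ← sliceL_comp, sliceL_whiskerRight, sliceL_bell_disc, ← effFun_stVec,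
      ← act_stVec, h, effFun_stVec, normalised_invState A, mul_one]
  obtain ⟨Φ, hΦ, hΦv⟩ := (hB.1.comp (hM.whiskerRight (bar A))).exists_smul
    (by rw [hw]; exact hc.ne')
  rw [hw] at hΦv
  obtain ⟨U, -, hU⟩ := exists_reversible_left hB hΦ (by
    apply stVec_injective
    apply smul_right_injective _ hc.ne'
    show c • _ = c • _
    rw [stVec_sliceR Φ, ← map_smul, ← hΦv, ← stVec_sliceR, sliceR_whiskerRight]
    refine vec_ext fun b => ?_
    have h1 := h (stVec (sliceL (bell A) b))
    rw [effFun_act, effFun_stVec, effFun_stVec] at h1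
    rw [map_smul, effFun_stVec, effFun_stVec, sliceR_comp_eq, sliceR_comp_eq, h1, smul_eq_mul])
  refine ⟨U, fun x => ?_⟩
  have : act M = c • act U.hom := by
    refine LinearMap.ext_on (span_pure A) ?_
    rintro _ ⟨ψ, hψ, rfl⟩
    apply smul_right_injective _ (weight_pos A).ne'
    show weight A • act M (stVec ψ) = weight A • c • act U.hom (stVec ψ)
    rw [← map_smul, smul_comm, ← map_smul, ← sliceL_bell_dag hψ, act_stVec, act_stVec,
      ← sliceL_whiskerRight, ← sliceL_whiskerRight, ← hU, stVec_sliceL, hΦv, map_smul,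
      ← stVec_sliceL]
  rw [this]
  rfl

/-- A linear automorphism of the state cone that adds the pure state `α` to the invariant state. -/
theorem exists_automorphism {A : C} {α : 𝟙_ C ⟶ A} (hα : IsPureSt₁ α) (hq : weight A < 1) :
    ∃ g : StR A ≃ₗ[ℝ] StR A, (∀ x, g x ∈ StCone A ↔ x ∈ StCone A) ∧
      g (stVec (invState A)) = stVec (invState A) + stVec α ∧
      (∀ x, effFun (disc A) (g x) = effFun (disc A) x + (weight A)⁻¹ * effFun (dag α) x) ∧
      ∀ x, effFun (dag α) (g x) = (1 + (weight A)⁻¹) * effFun (dag α) x := by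
  obtain ⟨P, hP⟩ := exists_isComplProjector hα hq
  obtain ⟨r, hr0, hr⟩ := exists_bell_effect C A
  have hq0 := weight_pos A
  set q := weight A with hqd
  have hne : 1 - q ≠ 0 := by linarith
  -- the second parameter makes the product of the two transformations occur with constant
  -- probability
  obtain ⟨S, s, hS, hSx⟩ := exists_pure_of_face hα hq hP hr (p := (1 + q) / 2) (by linarith)
    (by linarith)
  obtain ⟨S', s', hS', hSx'⟩ := exists_pure_of_face hα hq hP hr (p := q ^ 2) (by positivity)
    (by nlinarith)
  have e1 : (1 - (1 + q) / 2) / (1 - q) = 1 / 2 := by field_simp; ring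
  have e2 : (1 - q ^ 2) / (1 - q) = 1 + q := by field_simp; ring
  rw [← hqd, e1] at hSx
  rw [← hqd, e2] at hSx'
  have hSu : ∀ x, effFun (disc A) (act S x) =
      r * (q / 2) * effFun (disc A) x + r / 2 * effFun (dag α) x := fun x => by
    have h := hP.disc_act x
    rw [hSx, map_add, map_add, map_smul, map_smul, map_smul, effFun_disc_of_pure hα, smul_eq_mul,
      smul_eq_mul, smul_eq_mul, eq_sub_of_add_eq h]
    ring
  have hSα : ∀ x, effFun (dag α) (act S x) = r * ((1 + q) / 2) * effFun (dag α) x := fun x => by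
    rw [hSx, map_add, map_add, map_smul, map_smul, map_smul, effFun_stVec _ α, prob_comp_dag hα,
      hP.dag_act, smul_eq_mul, smul_eq_mul, smul_eq_mul]
    ring
  have hSu' : ∀ x, effFun (disc A) (act S' x) =
      r * (q * (1 + q)) * effFun (disc A) x + r * (-q) * effFun (dag α) x := fun x => by
    have h := hP.disc_act x
    rw [hSx', map_add, map_add, map_smul, map_smul, map_smul, effFun_disc_of_pure hα, smul_eq_mul,
      smul_eq_mul, smul_eq_mul, eq_sub_of_add_eq h]
    ring
  have hc : 0 < r ^ 2 * q ^ 2 * (1 + q) / 2 := by positivity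
  obtain ⟨U, hU⟩ := exists_act_eq_smul (hS.comp hS') hc fun x => by
    rw [act_comp, hSu', hSu, hSα]
    ring
  have hri : r * (q / 2) ≠ 0 := by positivity
  have hinj : Function.Injective ((r * (q / 2))⁻¹ • act S) := by
    intro x y hxy
    have h1 : act S x = act S y := smul_right_injective _ (inv_ne_zero hri) hxy
    have h2 : act (S ≫ S') x = act (S ≫ S') y := by rw [act_comp, act_comp, h1]
    rw [hU, hU] at h2
    exact (actEquiv U).injective (smul_right_injective _ hc.ne' h2)
  have hg : ∀ x, LinearEquiv.ofInjectiveEndo _ hinj x = (r * (q / 2))⁻¹ • act S x := fun x => rfl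
  refine ⟨LinearEquiv.ofInjectiveEndo _ hinj, fun x => ?_, ?_, fun x => ?_, fun x => ?_⟩
  · rw [hg]
    refine ⟨fun hx => ?_, fun hx => smul_mem_StCone (act_mem_StCone S hx) (by positivity)⟩
    have h1 : act S x ∈ StCone A := by
      have := smul_mem_StCone hx (by positivity : 0 ≤ r * (q / 2))
      rwa [smul_smul, mul_inv_cancel₀ hri, one_smul] at this
    have h2 : act U.inv (act S' (act S x)) = (r ^ 2 * q ^ 2 * (1 + q) / 2) • x := by
      rw [← act_comp S S', hU, map_smul, ← act_comp, Iso.hom_inv_id, act_id]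
    have h3 := act_mem_StCone U.inv (act_mem_StCone S' h1)
    rw [h2] at h3
    have h4 := smul_mem_StCone h3 (inv_nonneg.2 hc.le)
    rwa [smul_smul, inv_mul_cancel₀ hc.ne', one_smul] at h4
  · rw [hg, hSx, hP.act_invState, effFun_dag_invState hα, ← hqd, smul_add, smul_add, smul_smul,
      smul_smul, smul_smul, smul_sub, smul_smul]
    have a1 : (r * (q / 2))⁻¹ * (r * (s * q)) = 2 * s := by field_simp
    have a2 : (r * (q / 2))⁻¹ * (r * ((1 / 2 - s) * q)) = 1 - 2 * s := by field_simp
    have a3 : (r * (q / 2))⁻¹ * (r * ((1 + q) / 2 - s * q) * q) = 1 + q - 2 * s * q := by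
      field_simp
    rw [a1, a2, a3]
    module
  · rw [hg, map_smul, hSu, smul_eq_mul]
    field_simp
  · rw [hg, map_smul, hSα, smul_eq_mul]
    field_simp
    ring

end Automorphisms

/-! ### Volumes of order intervals -/

section Volume

open MeasureTheory

/-- The order interval `{x | -y ≤ x ≤ y}` of the order given by `K`. -/
def symInterval {E : Type*} [AddCommGroup E] (K : Set E) (y : E) : Set E :=
  {x | y + x ∈ K ∧ y - x ∈ K}

/-- The volume of the order intervals of a closed convex cone is multiplied by a constant under each
linear automorphism of the cone, and is strictly increasing above an interior point `e`. -/
theorem exists_volume {E : Type*} [NormedAddCommGroup E] [NormedSpace ℝ E] [FiniteDimensional ℝ E]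
    (K : PointedCone ℝ E) (hK : IsClosed (K : Set E)) (hb : ∀ y, Bornology.IsBounded
      (symInterval (K : Set E) y)) (f : E →ₗ[ℝ] ℝ) (hf : ∀ x ∈ K, 0 ≤ f x)
    (hf0 : ∀ x ∈ K, f x = 0 → x = 0) (e : E)
    (he : ∀ x, ∃ r : ℝ, 0 < r ∧ x + r • e ∈ K ∧ -x + r • e ∈ K) :
    ∃ w : E → ℝ, (∀ g : E ≃ₗ[ℝ] E, (∀ x, g x ∈ K ↔ x ∈ K) → ∃ D, ∀ x, w (g x) = D * w x) ∧
      (∀ x ∈ K, 0 < w (e + x)) ∧ ∀ x ∈ K, ∀ y ∈ K, y ≠ 0 → w (e + x) < w (e + x + y) := by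
  borelize E
  let μ : Measure E := Measure.addHaar
  have hsmul : ∀ {x : E} {t : ℝ}, 0 ≤ t → x ∈ K → t • x ∈ K := fun {x t} ht hx =>
    K.smul_mem ht hx
  have hcl : ∀ y, IsClosed (symInterval (K : Set E) y) := fun y =>
    (hK.preimage (f := fun x => y + x) (by fun_prop)).inter
      (hK.preimage (f := fun x => y - x) (by fun_prop))
  have hfin : ∀ y, μ (symInterval (K : Set E) y) ≠ ⊤ := fun y => (hb y).measure_lt_top.ne
  have hmono : ∀ y, ∀ z ∈ K, symInterval (K : Set E) y ⊆ symInterval (K : Set E) (y + z) := by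
    rintro y z hz x ⟨h1, h2⟩
    refine ⟨?_, ?_⟩
    · show y + z + x ∈ K
      rw [add_right_comm]
      exact K.add_mem h1 hz
    · show y + z - x ∈ K
      rw [add_sub_right_comm]
      exact K.add_mem h2 hz
  have hconv : ∀ y, Convex ℝ (symInterval (K : Set E) y) := by
    rintro y x₁ ⟨h1, h2⟩ x₂ ⟨h3, h4⟩ a b ha hb hab
    obtain rfl : b = 1 - a := by linarith
    refine ⟨?_, ?_⟩
    · have h : y + (a • x₁ + (1 - a) • x₂) = a • (y + x₁) + (1 - a) • (y + x₂) := by module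
      exact h ▸ K.add_mem (hsmul ha h1) (hsmul hb h3)
    · have h : y - (a • x₁ + (1 - a) • x₂) = a • (y - x₁) + (1 - a) • (y - x₂) := by module
      exact h ▸ K.add_mem (hsmul ha h2) (hsmul hb h4)
  have hneg : ∀ y, -symInterval (K : Set E) y = symInterval (K : Set E) y := by
    intro y
    ext x
    rw [Set.mem_neg]
    constructor
    · rintro ⟨h1, h2⟩
      exact ⟨by simpa [sub_eq_add_neg] using h2, by simpa [sub_eq_add_neg] using h1⟩
    · rintro ⟨h1, h2⟩
      exact ⟨by simpa [sub_eq_add_neg] using h2, by simpa [sub_eq_add_neg] using h1⟩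
  have hint₀ : (0 : E) ∈ interior (symInterval (K : Set E) e) := by
    have h0 : (0 : E) ∈ symInterval (K : Set E) e := by
      obtain ⟨r, hr, h1, -⟩ := he 0
      rw [zero_add] at h1
      have h2 := hsmul (inv_nonneg.2 hr.le) h1
      rw [smul_smul, inv_mul_cancel₀ hr.ne', one_smul] at h2
      exact ⟨by simpa using h2, by simpa using h2⟩
    have hne : (interior (symInterval (K : Set E) e)).Nonempty := by
      rw [(hconv e).interior_nonempty_iff_affineSpan_eq_top,
        AffineSubspace.affineSpan_eq_top_iff_vectorSpan_eq_top_of_nonempty _ _ _ ⟨0, h0⟩,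
        eq_top_iff, vectorSpan_eq_span_vsub_set_right ℝ h0]
      intro x _
      obtain ⟨r, hr, h1, h2⟩ := he x
      have h3 := hsmul (inv_nonneg.2 hr.le) h1
      have h4 := hsmul (inv_nonneg.2 hr.le) h2
      rw [smul_add, smul_smul, inv_mul_cancel₀ hr.ne', one_smul] at h3 h4
      have hx : x = r • (r⁻¹ • x) := by rw [smul_smul, mul_inv_cancel₀ hr.ne', one_smul]
      rw [hx]
      refine Submodule.smul_mem _ _ (Submodule.subset_span ⟨r⁻¹ • x, ⟨?_, ?_⟩, by simp⟩)
      · rwa [add_comm]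
      · rwa [smul_neg, neg_add_eq_sub] at h4
    obtain ⟨x, hx⟩ := hne
    have hx' : -x ∈ interior (symInterval (K : Set E) e) := by
      have h1 := (Homeomorph.neg E).preimage_interior (symInterval (K : Set E) e)
      have h2 : (Homeomorph.neg E) ⁻¹' symInterval (K : Set E) e = symInterval (K : Set E) e :=
        hneg e
      rw [h2] at h1
      have h3 : -x ∈ interior (symInterval (K : Set E) e) ↔ x ∈
        (Homeomorph.neg E) ⁻¹' interior (symInterval (K : Set E) e) := Iff.rfl
      rw [h3, h1]
      exact hx
    have := (hconv e).interior hx hx' (by norm_num : (0 : ℝ) ≤ 1 / 2)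
      (by norm_num : (0 : ℝ) ≤ 1 / 2) (by norm_num)
    simpa using this
  have hint : ∀ x ∈ K, (0 : E) ∈ interior (symInterval (K : Set E) (e + x)) := fun x hx =>
    interior_mono (hmono e x hx) hint₀
  refine ⟨fun y => μ.real (symInterval (K : Set E) y), fun g hg => ?_, fun x hx => ?_,
    fun x hx y hy hy0 => ?_⟩
  · refine ⟨|LinearMap.det (g : E →ₗ[ℝ] E)|, fun x => ?_⟩
    have himg : symInterval (K : Set E) (g x) = g '' symInterval (K : Set E) x := by
      ext z
      constructor
      · rintro ⟨h1, h2⟩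
        refine ⟨g.symm z, ⟨?_, ?_⟩, by simp⟩
        · exact (hg _).1 (by simpa using h1)
        · exact (hg _).1 (by simpa using h2)
      · rintro ⟨z, ⟨h1, h2⟩, rfl⟩
        exact ⟨by simpa using (hg _).2 h1, by simpa using (hg _).2 h2⟩
    have h1 := Measure.addHaar_image_linearMap μ (g : E →ₗ[ℝ] E) (symInterval (K : Set E) x)
    rw [LinearEquiv.coe_coe, ← himg] at h1
    show μ.real _ = _ * μ.real _
    rw [measureReal_def, h1, ENNReal.toReal_mul, ENNReal.toReal_ofReal (abs_nonneg _)]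
    rfl
  · exact ENNReal.toReal_pos (Measure.measure_pos_of_nonempty_interior μ ⟨0, hint x hx⟩).ne'
      (hfin _)
  · set a := e + x with ha
    let F : E →L[ℝ] ℝ := LinearMap.toContinuousLinearMap f
    have hF : ∀ x, F x = f x := fun x => rfl
    let O : Set E := interior (symInterval (K : Set E) (a + y)) ∩ {z | f a < F z}
    have hO : IsOpen O := isOpen_interior.inter (isOpen_lt continuous_const F.continuous)
    have hfy : 0 < f y := lt_of_le_of_ne (hf y hy) fun h => hy0 (hf0 y hy h.symm)
    have haK : a ∈ K := by
      have := (interior_subset (hint x hx)).1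
      simpa using this
    -- points of the larger interval close to its end `a + y` lie outside of the smaller one
    have hOne : O.Nonempty := by
      have hend : a + y ∈ closure (symInterval (K : Set E) (a + y)) := by
        refine subset_closure ⟨?_, by simp⟩
        exact K.add_mem (K.add_mem haK hy) (K.add_mem haK hy)
      have h0 : (0 : E) ∈ interior (symInterval (K : Set E) (a + y)) :=
        interior_mono (hmono a y hy) (hint x hx)
      have hfa : 0 ≤ f a := hf a haK
      obtain ⟨t, ht0, ht1, ht⟩ : ∃ t : ℝ, 0 < t ∧ t ≤ 1 ∧ t * (f a + f y) < f y := by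
        refine ⟨f y / (2 * (f a + f y)), by positivity, ?_, ?_⟩
        · rw [div_le_one (by positivity)]; linarith
        · have : f a + f y ≠ 0 := by positivity
          field_simp
          linarith
      refine ⟨t • (0 : E) + (1 - t) • (a + y), ?_, ?_⟩
      · exact (hconv (a + y)).combo_interior_closure_mem_interior h0 hend ht0 (by linarith)
          (by ring)
      · show f a < F _
        have hay : f (a + y) = f a + f y := map_add f a y
        rw [smul_zero, zero_add, hF, map_smul, hay, smul_eq_mul]
        linarith
    have hdisj : Disjoint (symInterval (K : Set E) a) O := by
      refine Set.disjoint_left.2 ?_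
      rintro z ⟨-, h2⟩ ⟨-, h4⟩
      have h5 := hf _ h2
      rw [map_sub] at h5
      have h6 : f a < f z := h4
      linarith
    have hsub : symInterval (K : Set E) a ∪ O ⊆ symInterval (K : Set E) (a + y) :=
      Set.union_subset (hmono a y hy) (Set.inter_subset_left.trans interior_subset)
    have hOfin : μ O ≠ ⊤ :=
      ((measure_mono (Set.subset_union_right.trans hsub)).trans_lt (hfin (a + y)).lt_top).ne
    have h1 : μ.real (symInterval (K : Set E) a ∪ O) =
        μ.real (symInterval (K : Set E) a) + μ.real O :=
      measureReal_union hdisj hO.measurableSet (hfin a) hOfin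
    have h2 : μ.real (symInterval (K : Set E) a ∪ O) ≤ μ.real (symInterval (K : Set E) (a + y)) :=
      measureReal_mono hsub (hfin (a + y))
    have h3 : 0 < μ.real O := ENNReal.toReal_pos (hO.measure_pos μ hOne).ne' hOfin
    linarith

end Volume

/-! ### Symmetry of the transition probabilities -/

section Symmetry

set_option linter.unusedSectionVars false

variable {C : Type u} [Category.{v} C] [MonoidalCategory C] [SymmetricCategory C] [OPTData C]
  [hC : Fact (IsSharpTheoryWithPurification C)]

theorem isClosed_StCone (A : C) : IsClosed (StCone A : Set (StR A)) := by
  -- near any vector the cone agrees with a multiple of the compact set of states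
  have hu : Continuous fun x : StR A => effFun (disc A) x :=
    LinearMap.continuous_of_finiteDimensional _
  refine isClosed_of_closure_subset fun x hx => ?_
  obtain ⟨c, hc0, hc⟩ : ∃ c : ℝ, 0 < c ∧ effFun (disc A) x < c :=
    ⟨|effFun (disc A) x| + 1, by positivity, by linarith [le_abs_self (effFun (disc A) x)]⟩
  have hcl : IsClosed ((fun y : StR A => c⁻¹ • y) ⁻¹' Set.range stVec) :=
    (isClosed_range_stVec A).preimage (by fun_prop)
  have hx' : x ∈ closure ((StCone A : Set (StR A)) ∩ {y | effFun (disc A) y < c}) := by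
    have := (isOpen_lt hu continuous_const).inter_closure (t := (StCone A : Set (StR A)))
      (s := {y | effFun (disc A) y < c}) ⟨hc, hx⟩
    rwa [Set.inter_comm] at this
  have hsub : (StCone A : Set (StR A)) ∩ {y | effFun (disc A) y < c} ⊆
      (fun y : StR A => c⁻¹ • y) ⁻¹' Set.range stVec := by
    rintro y ⟨hy, hyc⟩
    refine exists_state_of_mem_StCone (smul_mem_StCone hy (inv_nonneg.2 hc0.le)) ?_
    have : effFun (disc A) y < c := hyc
    rw [map_smul, smul_eq_mul, inv_mul_le_iff₀ hc0, mul_one]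
    exact this.le
  obtain ⟨σ, hσ⟩ := hcl.closure_subset_iff.2 hsub hx'
  have h1 : x = c • stVec σ := by rw [hσ, smul_smul, mul_inv_cancel₀ hc0.ne', one_smul]
  rw [h1]
  exact smul_mem_StCone (stVec_mem_StCone σ) hc0.le

/-- The volume function of the order intervals of the state cone. -/
theorem exists_volume_StCone (A : C) : ∃ w : StR A → ℝ,
    (∀ g : StR A ≃ₗ[ℝ] StR A, (∀ x, g x ∈ StCone A ↔ x ∈ StCone A) → ∃ D, ∀ x, w (g x) = D * w x) ∧
      (∀ x ∈ StCone A, 0 < w (stVec (invState A) + x)) ∧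
      ∀ x ∈ StCone A, ∀ y ∈ StCone A, y ≠ 0 →
        w (stVec (invState A) + x) < w (stVec (invState A) + x + y) := by
  let n := Module.finrank ℝ (StR A)
  let φ : StR A ≃L[ℝ] EuclideanSpace ℝ (Fin n) :=
    ContinuousLinearEquiv.ofFinrankEq (by simp [n])
  let K : PointedCone ℝ (EuclideanSpace ℝ (Fin n)) :=
    (StCone A).comap (φ.symm : EuclideanSpace ℝ (Fin n) →ₗ[ℝ] StR A)
  have hK : ∀ y, y ∈ K ↔ φ.symm y ∈ StCone A := fun y => Iff.rfl
  obtain ⟨w, hw1, hw2, hw3⟩ := exists_volume K ((isClosed_StCone A).preimage φ.symm.continuous)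
    (fun y => by
      -- an order interval is the image of a subset of a multiple of the state space
      obtain ⟨c, hc0, hc⟩ : ∃ c : ℝ, 0 < c ∧ 2 * effFun (disc A) (φ.symm y) < c :=
        ⟨|2 * effFun (disc A) (φ.symm y)| + 1, by positivity,
          by linarith [le_abs_self (2 * effFun (disc A) (φ.symm y))]⟩
      have hcomp : IsCompact ((fun z : StR A => φ (c • z) - y) '' Set.range stVec) :=
        (isCompact_range_stVec A).image (by fun_prop)
      refine hcomp.isBounded.subset ?_
      rintro x ⟨h1, h2⟩
      have h1' : φ.symm y + φ.symm x ∈ StCone A := by simpa [hK] using h1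
      have h2' : φ.symm y - φ.symm x ∈ StCone A := by simpa [hK] using h2
      have h3 := effFun_nonneg (disc A) h2'
      obtain ⟨σ, hσ⟩ := exists_state_of_mem_StCone
        (smul_mem_StCone h1' (inv_nonneg.2 hc0.le)) (by
          rw [map_smul, smul_eq_mul, inv_mul_le_iff₀ hc0, mul_one, map_add]
          rw [map_sub] at h3
          linarith)
      refine ⟨_, ⟨σ, rfl⟩, ?_⟩
      simp only [hσ, smul_smul, mul_inv_cancel₀ hc0.ne', one_smul, map_add,
        ContinuousLinearEquiv.apply_symm_apply]
      abel)
    ((effFun (disc A)) ∘ₗ (φ.symm : EuclideanSpace ℝ (Fin n) →ₗ[ℝ] StR A))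
    (fun x hx => effFun_nonneg _ hx)
    (fun x hx h => by
      have := eq_zero_of_mem_StCone (x := φ.symm x) hx h
      simpa using this)
    (φ (stVec (invState A)))
    (fun x => by
      obtain ⟨r, h1, h2⟩ := exists_add_smul_invState_mem (φ.symm x)
      have hpos : (0 : ℝ) ≤ |r| + 1 - r := by linarith [le_abs_self r]
      have h3 := smul_mem_StCone (stVec_mem_StCone (invState A)) hpos
      refine ⟨|r| + 1, by positivity, ?_, ?_⟩
      · rw [hK]
        convert Submodule.add_mem _ h1 h3 using 1
        simp only [map_add, map_smul, ContinuousLinearEquiv.symm_apply_apply]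
        module
      · rw [hK]
        convert Submodule.add_mem _ h2 h3 using 1
        simp only [map_add, map_smul, map_neg, ContinuousLinearEquiv.symm_apply_apply]
        module)
  have hKφ : ∀ x, φ x ∈ K ↔ x ∈ StCone A := fun x => by rw [hK, φ.symm_apply_apply]
  refine ⟨fun x => w (φ x), fun g hg => ?_, fun x hx => ?_, fun x hx y hy hy0 => ?_⟩
  · obtain ⟨D, hD⟩ := hw1 (φ.symm.toLinearEquiv.trans (g.trans φ.toLinearEquiv)) (fun x => by
      have : (φ.symm.toLinearEquiv.trans (g.trans φ.toLinearEquiv)) x = φ (g (φ.symm x)) := rfl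
      rw [this, hKφ, hg, hK])
    refine ⟨D, fun x => ?_⟩
    have := hD (φ x)
    simpa using this
  · show 0 < w (φ (_ + x))
    rw [map_add]
    exact hw2 _ ((hKφ x).2 hx)
  · show w (φ (_ + x)) < w (φ (_ + x + y))
    rw [map_add, map_add, map_add]
    exact hw3 _ ((hKφ x).2 hx) _ ((hKφ y).2 hy) (by simpa using hy0)

/-- Symmetry of transition probabilities. The automorphism that moves the invariant state `χ` to
`χ + α` moves `χ + w γ`, for some pure state `γ` and `w` an affine function of the transition
probability, to `χ + α + β`. As the volume of the order interval below `χ + w γ` depends only on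
`w`, the roles of `α` and `β` can be exchanged. -/
theorem prob_dag_comm {A : C} {α β : 𝟙_ C ⟶ A} (hα : IsPureSt₁ α) (hβ : IsPureSt₁ β) :
    prob (β ≫ dag α) = prob (α ≫ dag β) := by
  have hq1 : weight A ≤ 1 := prob_le_one _
  rcases hq1.eq_or_lt with hq | hq
  · have h : ∀ ψ : 𝟙_ C ⟶ A, IsPureSt₁ ψ → stVec (invState A) = stVec ψ := by
      intro ψ hψ
      have h1 := invState_sub_mem hψ
      rw [hq, one_smul] at h1
      refine sub_eq_zero.1 (eq_zero_of_mem_StCone h1 ?_)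
      rw [map_sub, effFun_stVec, normalised_invState A, effFun_disc_of_pure hψ, sub_self]
    rw [stVec_injective ((h α hα).symm.trans (h β hβ))]
  obtain ⟨w, hw1, hw2, hw3⟩ := exists_volume_StCone A
  set χ := stVec (invState A) with hχ
  have hχ0 : w χ ≠ 0 := by
    have := hw2 0 (zero_mem _)
    rw [add_zero] at this
    exact this.ne'
  -- the volume attached to `χ + t γ` does not depend on the pure state `γ`
  have hindep : ∀ (t : ℝ) (γ γ' : 𝟙_ C ⟶ A), IsPureSt₁ γ → IsPureSt₁ γ' →
      w (χ + t • stVec γ') = w (χ + t • stVec γ) := by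
    intro t γ γ' hγ hγ'
    obtain ⟨U, hU, rfl⟩ := exists_reversible_pure hγ hγ'
    obtain ⟨D, hD⟩ := hw1 (actEquiv U) (fun x => by
      refine ⟨fun h => ?_, fun h => act_mem_StCone _ h⟩
      have := act_mem_StCone U.inv h
      rwa [actEquiv_apply, ← act_comp, Iso.hom_inv_id, act_id] at this)
    have hUχ : actEquiv U χ = χ := by rw [actEquiv_apply, hχ, act_stVec, invState_comp]
    have h1 := hD χ
    rw [hUχ] at h1
    have hD1 : D = 1 := mul_right_cancel₀ hχ0 (by rw [← h1, one_mul])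
    have h2 := hD (χ + t • stVec γ)
    rwa [map_add, hUχ, map_smul, actEquiv_apply, act_stVec, hD1, one_mul] at h2
  obtain ⟨V, hV⟩ : ∃ V : ℝ → ℝ, ∀ t (γ : 𝟙_ C ⟶ A), IsPureSt₁ γ → w (χ + t • stVec γ) = V t := by
    obtain ⟨γ₀, hγ₀⟩ := exists_pure A
    exact ⟨fun t => w (χ + t • stVec γ₀), fun t γ hγ => hindep t γ₀ γ hγ₀ hγ⟩
  have hkey : ∀ α β : 𝟙_ C ⟶ A, IsPureSt₁ α → IsPureSt₁ β →
      ∃ t, 0 ≤ t ∧ t = 1 - prob (β ≫ dag α) / (weight A + 1) ∧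
        w (χ + stVec α + stVec β) * w χ = V 1 * V t := by
    intro α β hα hβ
    obtain ⟨g, hg, hgχ, hgu, hgα⟩ := exists_automorphism hα hq
    obtain ⟨D, hD⟩ := hw1 g hg
    have hmem : g.symm (stVec β) ∈ StCone A := by
      rw [← hg, g.apply_symm_apply]; exact stVec_mem_StCone β
    obtain ⟨t, ht, γ, hγ, hγv⟩ := exists_smul_of_mem_StCone hmem
    have hgγ : stVec β = t • g (stVec γ) := by rw [← map_smul, ← hγv, g.apply_symm_apply]
    have ht0 : t ≠ 0 := by
      rintro rfl
      have := congrArg (effFun (disc A)) hgγ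
      rw [zero_smul, map_zero, effFun_disc_of_pure hβ] at this
      exact one_ne_zero this
    have hγp : IsPureSt₁ γ := by
      refine isPureSt₁_of_pure (isPure_of_extremal hγ fun y hy z hz hyz => ?_) hγ
      obtain ⟨c, -, hc⟩ := hβ.1.extremal (smul_mem_StCone ((hg y).2 hy) ht)
        (smul_mem_StCone ((hg z).2 hz) ht) (by rw [← smul_add, ← map_add, hyz, hgγ])
      refine ⟨c, g.injective ?_⟩
      apply smul_right_injective _ ht0
      show t • g y = t • g (c • stVec γ)
      rw [hc, hgγ, map_smul, smul_comm]
    refine ⟨t, ht, ?_, ?_⟩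
    · have e1 := congrArg (effFun (disc A)) hgγ
      have e2 := congrArg (effFun (dag α)) hgγ
      rw [map_smul, hgu, effFun_disc_of_pure hβ, effFun_disc_of_pure hγp, smul_eq_mul] at e1
      rw [map_smul, hgα, effFun_stVec, smul_eq_mul] at e2
      have hq0 := weight_pos A
      rw [e2]
      field_simp
      field_simp at e1
      linarith
    · have e1 := hD χ
      have e2 := hD (χ + t • stVec γ)
      have e3 := hV 1 α hα
      rw [one_smul] at e3
      rw [hgχ, e3] at e1
      rw [map_add, hgχ, map_smul, ← hgγ, hV t γ hγp] at e2
      rw [e2, e1]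
      ring
  have hmono : ∀ t t' : ℝ, 0 ≤ t → t < t' → V t < V t' := by
    intro t t' ht htt
    obtain ⟨γ, hγ⟩ := exists_pure A
    have hne : (t' - t) • stVec γ ≠ 0 := by
      intro h
      have := congrArg (effFun (disc A)) h
      rw [map_smul, effFun_disc_of_pure hγ, map_zero, smul_eq_mul, mul_one] at this
      linarith
    have := hw3 (t • stVec γ) (smul_mem_StCone (stVec_mem_StCone γ) ht) ((t' - t) • stVec γ)
      (smul_mem_StCone (stVec_mem_StCone γ) (by linarith)) hne
    rwa [add_assoc, ← add_smul, add_sub_cancel, hV t γ hγ, hV t' γ hγ] at this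
  obtain ⟨t, ht, hte, hV1⟩ := hkey α β hα hβ
  obtain ⟨t', ht', hte', hV2⟩ := hkey β α hβ hα
  have hV10 : V 1 ≠ 0 := by
    have := hw2 _ (stVec_mem_StCone α)
    have h2 := hV 1 α hα
    rw [one_smul] at h2
    rw [← h2]
    exact this.ne'
  have hVt : V t = V t' := by
    rw [add_right_comm] at hV2
    exact mul_left_cancel₀ hV10 (hV1.symm.trans hV2)
  have htt : t = t' := by
    rcases lt_trichotomy t t' with h | h | h
    · exact absurd hVt (hmono t t' ht h).ne
    · exact h
    · exact absurd hVt (hmono t' t ht' h).ne'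
  have hq0 := weight_pos A
  rw [hte, hte'] at htt
  field_simp at htt
  linarith

end Symmetry

/-! ### The dagger and its inner product -/

section Dagger

set_option linter.unusedSectionVars false

variable {C : Type u} [Category.{v} C] [MonoidalCategory C] [SymmetricCategory C] [OPTData C]
  [hC : Fact (IsSharpTheoryWithPurification C)]

variable (C) in
/-- The dagger extends linearly, because the transition probabilities are symmetric. -/
theorem exists_dag_linearMap (A : C) : ∃ L : StR A →ₗ[ℝ] Module.Dual ℝ (StR A),
    ∀ ψ : 𝟙_ C ⟶ A, IsPureSt₁ ψ → L (stVec ψ) = effFun (dag ψ) := by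
  let b := Module.Basis.ofSpan (span_pure A).ge
  have hb : ∀ i, ∃ ψ : 𝟙_ C ⟶ A, IsPureSt₁ ψ ∧ stVec ψ = b i := fun i =>
    Module.Basis.ofSpan_subset (span_pure A).ge ⟨i, rfl⟩
  choose ψ hψ hψb using hb
  let L : StR A →ₗ[ℝ] Module.Dual ℝ (StR A) := b.constr ℝ fun i => effFun (dag (ψ i))
  have hL : ∀ γ : 𝟙_ C ⟶ A, IsPureSt₁ γ → ∀ y, L y (stVec γ) = effFun (dag γ) y := by
    intro γ hγ y
    have : (Module.Dual.eval ℝ _ (stVec γ)) ∘ₗ L = effFun (dag γ) := b.ext fun i => by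
      rw [LinearMap.comp_apply, Module.Dual.eval_apply, b.constr_basis, ← hψb, effFun_stVec,
        effFun_stVec, prob_dag_comm (hψ i) hγ]
    exact LinearMap.congr_fun this y
  refine ⟨L, fun γ hγ => eq_of_pure fun φ hφ => ?_⟩
  rw [hL φ hφ, effFun_stVec, effFun_stVec, prob_dag_comm hφ hγ]

theorem isPureEff₁_iff {A : C} {a : A ⟶ 𝟙_ C} :
    IsPureEff₁ a ↔ ∃ ψ : 𝟙_ C ⟶ A, IsPureSt₁ ψ ∧ a = dag ψ := by
  have hbdd : BddAbove (Set.range fun σ : 𝟙_ C ⟶ A => prob (σ ≫ a)) :=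
    ⟨1, by rintro _ ⟨σ, rfl⟩; exact prob_le_one _⟩
  obtain ⟨σ₀, -⟩ := exists_normalised C A
  have hne : Nonempty (𝟙_ C ⟶ A) := ⟨σ₀⟩
  constructor
  · rintro ⟨ha, h1⟩
    -- the supremum is attained, by compactness
    obtain ⟨_, ⟨σ, rfl⟩, hmax⟩ := (isCompact_range_stVec A).exists_isMaxOn ⟨_, σ₀, rfl⟩
      (LinearMap.continuous_of_finiteDimensional (effFun a)).continuousOn
    have h2 : prob (σ ≫ a) = 1 := by
      refine le_antisymm (prob_le_one _) ?_
      rw [← h1]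
      exact ciSup_le fun τ => hmax ⟨τ, rfl⟩
    obtain ⟨ψ, hψ, hψa⟩ := exists_pure_prob_eq_one h2
    exact ⟨ψ, hψ, eq_dag hψ ha hψa⟩
  · rintro ⟨ψ, hψ, rfl⟩
    refine ⟨isPure_dag hψ, le_antisymm (ciSup_le fun σ => prob_le_one _) ?_⟩
    rw [← prob_comp_dag hψ]
    exact le_ciSup hbdd ψ

theorem isDagger_iff {A : C} {D : StR A ≃ₗ[ℝ] EffR A} : IsDagger D ↔
    ∀ ψ : 𝟙_ C ⟶ A, IsPureSt₁ ψ → D (stVec ψ) = effVec (dag ψ) := by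
  constructor
  · rintro ⟨h, -⟩ ψ hψ
    obtain ⟨a, ⟨ha, ha1⟩, -, hD⟩ := h ψ hψ
    rw [hD, eq_dag hψ ha.1 ha1]
  · intro h
    refine ⟨fun ψ hψ => ⟨dag ψ, ⟨isPureEff₁_iff.2 ⟨ψ, hψ, rfl⟩, prob_comp_dag hψ⟩,
      fun b hb hb1 => eq_dag hψ hb.1 hb1, h ψ hψ⟩, fun a ha => ?_⟩
    obtain ⟨ψ, hψ, rfl⟩ := isPureEff₁_iff.1 ha
    exact ⟨ψ, hψ, h ψ hψ⟩

variable (C) in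
theorem exists_isDagger (A : C) : ∃ D : StR A ≃ₗ[ℝ] EffR A, IsDagger D := by
  obtain ⟨L, hL⟩ := exists_dag_linearMap C A
  have hinj : Function.Injective L := by
    rw [← LinearMap.ker_eq_bot, LinearMap.ker_eq_bot']
    intro x hx
    refine vec_ext_dag fun ψ hψ => ?_
    have hLψ : (Module.Dual.eval ℝ _ (stVec ψ)) ∘ₗ L = effFun (dag ψ) := eq_of_pure fun φ hφ => by
      rw [LinearMap.comp_apply, Module.Dual.eval_apply, hL φ hφ, effFun_stVec, effFun_stVec,
        prob_dag_comm hφ hψ]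
    rw [← hLψ, LinearMap.comp_apply, hx, map_zero, map_zero]
  have hmem : ∀ x, L x ∈ EffR A := by
    intro x
    have h : (⊤ : Submodule ℝ (StR A)) ≤ (EffR A).comap L := by
      rw [← span_pure A]
      refine Submodule.span_le.2 ?_
      rintro _ ⟨ψ, hψ, rfl⟩
      show L (stVec ψ) ∈ EffR A
      rw [hL ψ hψ]
      exact (effVec (dag ψ)).2
    exact h trivial
  have hsurj : Function.Surjective L :=
    (LinearMap.injective_iff_surjective_of_finrank_eq_finrank
      (Subspace.dual_finrank_eq (K := ℝ) (V := StR A)).symm).1 hinj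
  refine ⟨LinearEquiv.ofBijective (L.codRestrict (EffR A) hmem) ⟨fun x y h => ?_, fun y => ?_⟩, ?_⟩
  · exact hinj (congrArg Subtype.val h)
  · obtain ⟨x, hx⟩ := hsurj y
    exact ⟨x, Subtype.ext hx⟩
  · exact isDagger_iff.2 fun ψ hψ => Subtype.ext (hL ψ hψ)

theorem IsDagger.unique {A : C} {D D' : StR A ≃ₗ[ℝ] EffR A} (h : IsDagger D) (h' : IsDagger D') :
    D = D' := by
  have : (D : StR A →ₗ[ℝ] EffR A) = D' := by
    refine LinearMap.ext_on (span_pure A) ?_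
    rintro _ ⟨ψ, hψ, rfl⟩
    exact (isDagger_iff.1 h ψ hψ).trans (isDagger_iff.1 h' ψ hψ).symm
  exact LinearEquiv.toLinearMap_injective this

theorem IsDagger.form_pure_left {A : C} {D : StR A ≃ₗ[ℝ] EffR A} (h : IsDagger D) {ψ : 𝟙_ C ⟶ A}
    (hψ : IsPureSt₁ ψ) (x : StR A) : daggerForm D (stVec ψ) x = effFun (dag ψ) x := by
  have : daggerForm D (stVec ψ) = effFun (dag ψ) := congrArg Subtype.val (isDagger_iff.1 h ψ hψ)
  rw [this]

theorem IsDagger.form_comm {A : C} {D : StR A ≃ₗ[ℝ] EffR A} (h : IsDagger D) (x y : StR A) :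
    daggerForm D x y = daggerForm D y x := by
  have : daggerForm D = (daggerForm D).flip := by
    refine LinearMap.ext_on (span_pure A) ?_
    rintro _ ⟨ψ, hψ, rfl⟩
    refine LinearMap.ext_on (span_pure A) ?_
    rintro _ ⟨φ, hφ, rfl⟩
    change daggerForm D (stVec ψ) (stVec φ) = daggerForm D (stVec φ) (stVec ψ)
    rw [h.form_pure_left hψ, h.form_pure_left hφ, effFun_stVec, effFun_stVec,
      prob_dag_comm hψ hφ]
  conv_lhs => rw [this]
  rfl

theorem IsDagger.form_pure_right {A : C} {D : StR A ≃ₗ[ℝ] EffR A} (h : IsDagger D) {ψ : 𝟙_ C ⟶ A}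
    (hψ : IsPureSt₁ ψ) (x : StR A) : daggerForm D x (stVec ψ) = effFun (dag ψ) x := by
  rw [h.form_comm, h.form_pure_left hψ]

theorem form_eq_sum {A : C} (D : StR A ≃ₗ[ℝ] EffR A) (hD : IsDagger D)
    {t : Finset (𝟙_ C ⟶ A)} (ht : IsOrtho t) {x : StR A}
    (hx : x = ∑ ψ ∈ t, effFun (dag ψ) x • stVec ψ) (y : StR A) :
    daggerForm D x y = ∑ ψ ∈ t, effFun (dag ψ) x * effFun (dag ψ) y := by
  nth_rewrite 1 [hx]
  rw [map_sum, LinearMap.sum_apply]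
  refine Finset.sum_congr rfl fun ψ hψ => ?_
  rw [map_smul, LinearMap.smul_apply, hD.form_pure_left (ht.pure ψ hψ), smul_eq_mul]

theorem IsDagger.isSelfDualisingInner {A : C} {D : StR A ≃ₗ[ℝ] EffR A} (h : IsDagger D) :
    IsSelfDualisingInner (daggerForm D) := by
  refine ⟨h.form_comm, fun x hx0 => ?_, fun x => ⟨fun hx y hy => ?_, fun hx => ?_⟩⟩
  · obtain ⟨t, ht, -, hx⟩ := exists_diag x
    rw [form_eq_sum D h ht hx]
    refine lt_of_le_of_ne (Finset.sum_nonneg fun ψ _ => mul_self_nonneg _) fun h0 => hx0 ?_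
    have h1 := (Finset.sum_eq_zero_iff_of_nonneg fun ψ _ => mul_self_nonneg _).1 h0.symm
    rw [hx]
    refine Finset.sum_eq_zero fun ψ hψ => ?_
    rw [mul_self_eq_zero.1 (h1 ψ hψ), zero_smul]
  · obtain ⟨t, -, ht, -, hxt⟩ := (isOrtho_empty (A := A)).exists_diag hx (by simp)
    rw [form_eq_sum D h ht hxt]
    exact Finset.sum_nonneg fun ψ _ => mul_nonneg (effFun_nonneg _ hx) (effFun_nonneg _ hy)
  · obtain ⟨t, ht, -, hxt⟩ := exists_diag x
    rw [hxt]
    refine Submodule.sum_mem _ fun ψ hψ => smul_mem_StCone (stVec_mem_StCone ψ) ?_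
    rw [← h.form_pure_right (ht.pure ψ hψ)]
    exact hx _ (stVec_mem_StCone ψ)

end Dagger

/-! ### Maximal sets of perfectly distinguishable pure states -/

section MaximalSets

set_option linter.unusedSectionVars false

variable {C : Type u} [Category.{v} C] [MonoidalCategory C] [SymmetricCategory C] [OPTData C]
  [hC : Fact (IsSharpTheoryWithPurification C)]

/-- The vector that represents an effect under the dagger. -/
theorem exists_vec_of_effect {A : C} (D : StR A ≃ₗ[ℝ] EffR A) (hD : IsDagger D) (a : A ⟶ 𝟙_ C) :
    ∃ x ∈ StCone A, ∀ y, daggerForm D x y = effFun a y := by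
  have h : ∀ y, daggerForm D (D.symm (effVec a)) y = effFun a y := fun y => by
    show ((D (D.symm (effVec a)) : EffR A) : Module.Dual ℝ (StR A)) y = _
    rw [D.apply_symm_apply]
    rfl
  refine ⟨D.symm (effVec a), (hD.isSelfDualisingInner.2.2 _).2 fun y hy => ?_, h⟩
  rw [h]
  exact effFun_nonneg a hy

/-- Pure states that are perfectly distinguishable are orthogonal. -/
theorem prob_dag_eq_zero_of_effect {A : C} {α β : 𝟙_ C ⟶ A} (hα : IsPureSt₁ α)
    (hβ : IsPureSt₁ β) {a : A ⟶ 𝟙_ C} (h1 : prob (α ≫ a) = 1) (h0 : prob (β ≫ a) = 0) :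
    prob (β ≫ dag α) = 0 := by
  classical
  obtain ⟨D, hD⟩ := exists_isDagger C A
  obtain ⟨x, hx, hxa⟩ := exists_vec_of_effect D hD a
  obtain ⟨t, -, ht, htc, hxt⟩ := (isOrtho_empty (A := A)).exists_diag hx (by simp)
  have hc : ∀ ψ ∈ t, effFun (dag ψ) x = prob (ψ ≫ a) := fun ψ hψ => by
    rw [← hD.form_pure_right (ht.pure ψ hψ), hxa, effFun_stVec]
  have hsum : ∀ φ : 𝟙_ C ⟶ A, prob (φ ≫ a) = ∑ ψ ∈ t, prob (ψ ≫ a) * prob (φ ≫ dag ψ) := by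
    intro φ
    rw [← effFun_stVec, ← hxa, form_eq_sum D hD ht hxt]
    exact Finset.sum_congr rfl fun ψ hψ => by rw [hc ψ hψ, effFun_stVec]
  have hone : ∀ φ : 𝟙_ C ⟶ A, IsPureSt₁ φ → ∑ ψ ∈ t, prob (φ ≫ dag ψ) = 1 := fun φ hφ =>
    (htc (stVec φ)).trans (effFun_disc_of_pure hφ)
  -- `β` lives on the elements of the frame with eigenvalue zero, and `α` is orthogonal to these
  have hβ0 : ∀ ψ ∈ t, prob (ψ ≫ a) ≠ 0 → prob (β ≫ dag ψ) = 0 := by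
    intro ψ hψ hne
    have := (hsum β).symm.trans h0
    have := (Finset.sum_eq_zero_iff_of_nonneg fun ψ _ =>
      mul_nonneg (prob_nonneg _) (prob_nonneg _)).1 this ψ hψ
    exact (mul_eq_zero.1 this).resolve_left hne
  have hα0 : ∀ ψ ∈ t, prob (ψ ≫ a) ≠ 1 → prob (α ≫ dag ψ) = 0 := by
    intro ψ hψ hne
    have h2 : ∑ ψ ∈ t, (1 - prob (ψ ≫ a)) * prob (α ≫ dag ψ) = 0 := by
      simp only [sub_mul, one_mul, Finset.sum_sub_distrib]
      rw [hone α hα, ← hsum α, h1, sub_self]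
    have h3 := (Finset.sum_eq_zero_iff_of_nonneg fun ψ _ =>
      mul_nonneg (sub_nonneg.2 (prob_le_one _)) (prob_nonneg _)).1 h2 ψ hψ
    exact (mul_eq_zero.1 h3).resolve_left (sub_ne_zero.2 hne.symm)
  set s := t.filter fun ψ => prob (ψ ≫ a) = 0 with hs
  have hs0 : ∀ ψ ∈ s, prob (α ≫ dag ψ) = 0 := fun ψ hψ => by
    have h2 := Finset.mem_filter.1 hψ
    exact hα0 ψ h2.1 (by rw [h2.2]; exact zero_ne_one)
  have hαs : α ∉ s := fun h => by
    have := hs0 α h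
    rw [prob_comp_dag hα] at this
    exact one_ne_zero this
  obtain ⟨e, he⟩ := ((ht.mono (Finset.filter_subset _ t)).insert_pure hα hs0).exists_compl
  have h2 := he (stVec β)
  have h3 : ∑ ψ ∈ s, effFun (dag ψ) (stVec β) = 1 := by
    rw [← hone β hβ, hs, Finset.sum_filter]
    refine Finset.sum_congr rfl fun ψ hψ => ?_
    split_ifs with h4
    · rfl
    · exact (hβ0 ψ hψ h4).symm
  rw [Finset.sum_insert hαs, h3, effFun_disc_of_pure hβ, effFun_stVec, effFun_stVec] at h2
  linarith [prob_nonneg (β ≫ e), prob_nonneg (β ≫ dag α)]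

/-- A binary test with one outcome that realises `dag α` and another that leaves `dag ψ` unchanged
for each pure state `ψ` orthogonal to `α`. -/
theorem exists_compl_transformation {A : C} {α : 𝟙_ C ⟶ A} (hα : IsPureSt₁ α) :
    ∃ t : Bool → (A ⟶ A), IsTest t ∧ t false ≫ disc A = dag α ∧
      ∀ ψ : 𝟙_ C ⟶ A, IsPureSt₁ ψ → prob (ψ ≫ dag α) = 0 → t true ≫ dag ψ = dag ψ := by
  classical
  obtain ⟨P, hPu, hPf⟩ : ∃ P : A ⟶ A,
      (∀ σ : 𝟙_ C ⟶ A, prob (σ ≫ P ≫ disc A) + prob (σ ≫ dag α) = prob (σ ≫ disc A)) ∧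
      ∀ ψ : 𝟙_ C ⟶ A, IsPureSt₁ ψ → prob (ψ ≫ dag α) = 0 → P ≫ dag ψ = dag ψ := by
    by_cases h : ∃ ψ : 𝟙_ C ⟶ A, IsPureSt₁ ψ ∧ prob (ψ ≫ dag α) = 0
    · obtain ⟨ψ, hψ, h0⟩ := h
      obtain ⟨P, hP, hu, hfix, -⟩ := exists_projector hα hψ.normalised h0
      refine ⟨P, fun σ => ?_, fun φ hφ hφ0 => comp_dag_of_fix hφ hP (hfix φ hφ0)⟩
      have := hu (stVec σ)
      rwa [act_stVec, effFun_stVec, effFun_stVec, effFun_stVec, Category.assoc] at this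
    · obtain ⟨a', -, ha'⟩ := exists_compl (dag α)
      refine ⟨a' ≫ α, fun σ => ?_, fun φ hφ hφ0 => absurd ⟨φ, hφ, hφ0⟩ h⟩
      have h1 : α ≫ disc A = 𝟙 _ := scalar_ext (hα.normalised.trans prob_id.symm)
      rw [Category.assoc, h1, Category.comp_id, add_comm, ha']
  obtain ⟨X, _, f, x, hf, rfl⟩ := (laws C).exists_test P
  obtain ⟨t, ht, ht1, -⟩ := hf.split {x}
  have htP : t true = f x := (laws C).separation _ _ fun S ρ E => by
    rw [ht1 S ρ E, Finset.sum_singleton]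
  refine ⟨t, ht, ?_, by rw [htP]; exact hPf⟩
  refine effect_ext fun σ => ?_
  have h1 := sum_prob_eq_disc (ht.comp_channel (isChannel_disc A)) σ
  rw [Fintype.sum_bool, htP] at h1
  linarith [hPu σ]

/-- The daggers of orthogonal pure states belong to one observation-test. -/
theorem exists_test_of_ortho {A : C} {n : ℕ} (α : Fin n → (𝟙_ C ⟶ A)) (hα : ∀ i, IsPureSt₁ (α i))
    (ho : ∀ i j, i ≠ j → prob (α j ≫ dag (α i)) = 0) :
    ∃ D : Option (Fin n) → (A ⟶ 𝟙_ C), IsTest D ∧ ∀ i, D (some i) = dag (α i) := by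
  induction n with
  | zero =>
    exact ⟨fun _ => disc A, IsTest.reindex (Equiv.ofUnique (Option (Fin 0)) Unit)
      (isChannel_disc A), fun i => i.elim0⟩
  | succ n ih =>
    obtain ⟨D, hD, hDα⟩ := ih (fun i => α i.succ) (fun i => hα i.succ)
      fun i j hij => ho _ _ fun h => hij (Fin.succ_injective _ h)
    obtain ⟨t, ht, ht0, ht1⟩ := exists_compl_transformation (hα 0)
    let e : Option (Fin (n + 1)) ≃ Option (Fin n) ⊕ Unit :=
      { toFun := fun o => o.elim (Sum.inl none)
          (Fin.cases (Sum.inr ()) fun i => Sum.inl (some i))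
        invFun := Sum.elim (fun o => o.map Fin.succ) fun _ => some 0
        left_inv := by
          rintro (_ | i)
          · rfl
          · refine Fin.cases rfl (fun _ => rfl) i
        right_inv := by rintro ((_ | i) | _) <;> rfl }
    refine ⟨_, (ht.cond hD (isChannel_disc A)).reindex e, fun i => ?_⟩
    refine Fin.cases ?_ (fun i => ?_) i
    · exact ht0
    · show t true ≫ D (some i) = _
      rw [hDα]
      exact ht1 _ (hα _) (ho 0 i.succ (Fin.succ_ne_zero i).symm)

/-- A maximal set of perfectly distinguishable pure states is an orthogonal set whose daggers add up
to the deterministic effect. -/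
theorem IsPureMaximalSet.ortho {A : C} {d : ℕ} {α : Fin d → (𝟙_ C ⟶ A)}
    (h : IsPureMaximalSet α) : (∀ i, IsPureSt₁ (α i)) ∧
      (∀ i j, prob (α j ≫ dag (α i)) = if i = j then 1 else 0) ∧
      ∀ x, ∑ i, effFun (dag (α i)) x = effFun (disc A) x := by
  classical
  obtain ⟨hp, ⟨a, ha, haδ⟩, hmax⟩ := h
  have hα : ∀ i, IsPureSt₁ (α i) := fun i => isPureSt₁_of_pure (hp i)
    (normalised_of_prob_eq_one (a := a i) (by rw [haδ, if_pos rfl]))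
  have hδ : ∀ i j, prob (α j ≫ dag (α i)) = if i = j then 1 else 0 := by
    intro i j
    split_ifs with hij
    · rw [hij, prob_comp_dag (hα j)]
    · exact prob_dag_eq_zero_of_effect (hα i) (hα j) (a := a i) (by rw [haδ, if_pos rfl])
        (by rw [haδ, if_neg hij])
  refine ⟨hα, hδ, ?_⟩
  have hinj : Function.Injective α := by
    intro i j hij
    by_contra hne
    have h1 := haδ i j
    rw [← hij, haδ, if_pos rfl, if_neg hne] at h1
    exact one_ne_zero h1
  have hs : IsOrtho (Finset.univ.image α) := by
    refine ⟨fun ψ hψ => ?_, fun ψ hψ φ hφ hne => ?_⟩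
    · obtain ⟨i, -, rfl⟩ := Finset.mem_image.1 hψ
      exact hα i
    · obtain ⟨i, -, rfl⟩ := Finset.mem_image.1 hψ
      obtain ⟨j, -, rfl⟩ := Finset.mem_image.1 hφ
      rw [hδ, if_neg fun h => hne (congrArg α h)]
  by_cases hc : IsComplete (Finset.univ.image α)
  · intro x
    rw [← hc x, Finset.sum_image fun i _ j _ hij => hinj hij]
  · exfalso
    obtain ⟨β, hβs, hins⟩ := hs.exists_insert hc
    have hβ := hins.pure β (Finset.mem_insert_self _ _)
    have hβ0 : ∀ i, prob (β ≫ dag (α i)) = 0 := fun i => by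
      have hi : α i ∈ Finset.univ.image α := Finset.mem_image_of_mem α (Finset.mem_univ i)
      exact hins.ortho _ (Finset.mem_insert_of_mem hi) β (Finset.mem_insert_self _ _)
        fun h => hβs (h ▸ hi)
    obtain ⟨D, hD, hDα⟩ := exists_test_of_ortho α hα fun i j hij => by rw [hδ, if_neg hij]
    refine hmax ⟨β, D, hD, ?_⟩
    have hnone : ∀ σ : 𝟙_ C ⟶ A, prob (σ ≫ D none) + ∑ i, prob (σ ≫ dag (α i)) =
        prob (σ ≫ disc A) := fun σ => by
      rw [← sum_prob_eq_disc hD σ, Fintype.sum_option]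
      simp only [hDα]
    rintro (_ | i) (_ | j)
    · have := hnone β
      rw [Finset.sum_eq_zero fun i _ => hβ0 i, add_zero, hβ.normalised] at this
      simpa using this
    · have := hnone (α j)
      simp only [hδ, Finset.sum_ite_eq', Finset.mem_univ, if_true] at this
      have h2 : prob (α j ≫ D none) = 0 := by
        have h3 := (hα j).normalised
        rw [Normalised] at h3
        linarith
      simpa using h2
    · simpa [hDα] using hβ0 i
    · simpa [hDα] using hδ i j

end MaximalSets

/-! ### Projectors on faces -/

section Projectors

set_option linter.unusedSectionVars false

variable {C : Type u} [Category.{v} C] [MonoidalCategory C] [SymmetricCategory C] [OPTData C]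
  [hC : Fact (IsSharpTheoryWithPurification C)]

/-- The span of the pure states of the face `F_I`. -/
noncomputable def faceSpan {A : C} {d : ℕ} (α : Fin d → (𝟙_ C ⟶ A)) (I : Finset (Fin d)) :
    Submodule ℝ (StR A) :=
  Submodule.span ℝ (stVec ''
    {ψ : 𝟙_ C ⟶ A | IsPureSt₁ ψ ∧ ∑ i ∈ I, effFun (dag (α i)) (stVec ψ) = 1})

/-- An element of the state cone that is orthogonal to `α j` for each `j` outside of `I` is a
combination of pure states of the face `F_I`. -/
theorem IsPureMaximalSet.mem_faceSpan {A : C} {d : ℕ} {α : Fin d → (𝟙_ C ⟶ A)}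
    (h : IsPureMaximalSet α) {I : Finset (Fin d)} {x : StR A} (hx : x ∈ StCone A)
    (h0 : ∀ j ∉ I, effFun (dag (α j)) x = 0) : x ∈ faceSpan α I := by
  classical
  obtain ⟨hα, hδ, hsum⟩ := h.ortho
  have hs : IsOrtho (Iᶜ.image α) := by
    refine ⟨fun ψ hψ => ?_, fun ψ hψ φ hφ hne => ?_⟩
    · obtain ⟨i, -, rfl⟩ := Finset.mem_image.1 hψ
      exact hα i
    · obtain ⟨i, -, rfl⟩ := Finset.mem_image.1 hψ
      obtain ⟨j, -, rfl⟩ := Finset.mem_image.1 hφ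
      rw [hδ, if_neg fun h => hne (congrArg α h)]
  obtain ⟨t, hst, ht, -, hxt⟩ := hs.exists_diag hx (by
    intro ψ hψ
    obtain ⟨j, hj, rfl⟩ := Finset.mem_image.1 hψ
    exact h0 j (Finset.mem_compl.1 hj))
  rw [hxt]
  refine Submodule.sum_mem _ fun ψ hψ => ?_
  by_cases hψs : ψ ∈ Iᶜ.image α
  · obtain ⟨j, hj, rfl⟩ := Finset.mem_image.1 hψs
    rw [h0 j (Finset.mem_compl.1 hj), zero_smul]
    exact zero_mem _
  · refine Submodule.smul_mem _ _ (Submodule.subset_span ⟨ψ, ⟨ht.pure ψ hψ, ?_⟩, rfl⟩)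
    rw [← effFun_disc_of_pure (ht.pure ψ hψ), ← hsum, ← Finset.sum_add_sum_compl I,
      Finset.sum_eq_zero (s := Iᶜ), add_zero]
    intro j hj
    have hj' : α j ∈ Iᶜ.image α := Finset.mem_image_of_mem α hj
    exact ht.ortho _ (hst hj') ψ hψ fun h => hψs (h ▸ hj')

/-- Self-adjointness of the projectors. The projector maps into the span of the face, and the dagger
of a vector `x` in this span is invariant: the vector that represents `x† P` lies in the span as
well and has the same inner products with the face as `x`. -/
theorem IsProjector.form_act {A : C} {D : StR A ≃ₗ[ℝ] EffR A} (hD : IsDagger D) {d : ℕ}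
    {α : Fin d → (𝟙_ C ⟶ A)} (h : IsPureMaximalSet α) {I : Finset (Fin d)} {P : A ⟶ A}
    (hP : IsProjector D α I P) (x y : StR A) :
    daggerForm D (act P x) y = daggerForm D x (act P y) := by
  classical
  obtain ⟨hα, hδ, hsum⟩ := h.ortho
  have hface : ∀ z, (faceEffect D α I : Module.Dual ℝ (StR A)) z =
      ∑ i ∈ I, effFun (dag (α i)) z := fun z => by
    have h1 : (faceEffect D α I : Module.Dual ℝ (StR A)) = ∑ i ∈ I, effFun (dag (α i)) := by
      rw [faceEffect, Submodule.coe_sum]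
      exact Finset.sum_congr rfl fun i _ => congrArg Subtype.val (isDagger_iff.1 hD _ (hα i))
    rw [h1, LinearMap.sum_apply]
  have hPface : ∀ ψ : 𝟙_ C ⟶ A, IsPureSt₁ ψ → ∑ i ∈ I, effFun (dag (α i)) (stVec ψ) = 1 →
      ψ ≫ P = ψ := fun ψ hψ h1 => hP.1 ψ ⟨hψ.2, by rw [hface, h1]⟩
  have hPin : ∀ i ∈ I, α i ≫ P = α i := fun i hi => hPface _ (hα i) (by
    simp only [effFun_stVec, hδ]
    rw [Finset.sum_ite_eq', if_pos hi])
  have hPout : ∀ j ∉ I, act P (stVec (α j)) = 0 := fun j hj => by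
    rw [act_stVec]
    refine hP.2 _ ⟨(hα j).2, ?_⟩
    rw [hface]
    simp only [effFun_stVec, hδ]
    rw [Finset.sum_ite_eq', if_neg hj]
  have hχ : stVec (invState A) = weight A • ∑ i, stVec (α i) := by
    refine vec_ext_dag fun ψ hψ => ?_
    have h1 : effFun (dag ψ) (∑ i, stVec (α i)) = 1 := by
      rw [map_sum, ← effFun_disc_of_pure hψ, ← hsum]
      exact Finset.sum_congr rfl fun i _ => prob_dag_comm hψ (hα i)
    rw [effFun_dag_invState hψ, map_smul, h1, smul_eq_mul, mul_one]
  have hPzero : ∀ j ∉ I, ∀ z, effFun (dag (α j)) (act P z) = 0 := by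
    intro j hj z
    have h1 := eq_zero_of_invState (f := effFun (P ≫ dag (α j))) (fun x hx => effFun_nonneg _ hx)
      (by
        rw [hχ, map_smul, map_sum, Finset.sum_eq_zero, smul_zero]
        intro i _
        rw [← effFun_act]
        by_cases hi : i ∈ I
        · rw [act_stVec, hPin i hi, effFun_stVec, hδ, if_neg (fun hij : j = i => hj (hij ▸ hi))]
        · rw [hPout i hi, map_zero])
    rw [effFun_act, h1]
    rfl
  have hrange : ∀ z, act P z ∈ faceSpan α I := by
    intro z
    have h1 : (⊤ : Submodule ℝ (StR A)) ≤ (faceSpan α I).comap (act P) := by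
      rw [← span_range_stVec A]
      refine Submodule.span_le.2 ?_
      rintro _ ⟨σ, rfl⟩
      exact h.mem_faceSpan (act_mem_StCone P (stVec_mem_StCone σ)) fun j hj => hPzero j hj _
    exact h1 trivial
  have hinv : ∀ z ∈ faceSpan α I, ∀ w, daggerForm D z (act P w) = daggerForm D z w := by
    intro z hz w
    have h1 : faceSpan α I ≤ LinearMap.eqLocus ((daggerForm D).compl₂ (act P)) (daggerForm D) := by
      refine Submodule.span_le.2 ?_
      rintro _ ⟨η, ⟨hη, hηI⟩, rfl⟩
      obtain ⟨x, hx, hxf⟩ := exists_vec_of_effect D hD (P ≫ dag η)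
      have hxspan : x ∈ faceSpan α I := h.mem_faceSpan hx fun j hj => by
        rw [← hD.form_pure_right (hα j), hxf, ← effFun_act, hPout j hj, map_zero]
      have hηspan : stVec η ∈ faceSpan α I := Submodule.subset_span ⟨η, ⟨hη, hηI⟩, rfl⟩
      have h2 : faceSpan α I ≤ LinearMap.ker (daggerForm D (x - stVec η)) := by
        refine Submodule.span_le.2 ?_
        rintro _ ⟨φ, ⟨hφ, hφI⟩, rfl⟩
        show daggerForm D (x - stVec η) (stVec φ) = 0
        rw [map_sub, LinearMap.sub_apply, hxf, ← effFun_act, act_stVec, hPface φ hφ hφI,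
          hD.form_pure_left hη, sub_self]
      have h3 : x - stVec η = 0 := by
        by_contra hne
        exact (hD.isSelfDualisingInner.2.1 _ hne).ne' (h2 (Submodule.sub_mem _ hxspan hηspan))
      refine LinearMap.ext fun w => ?_
      show daggerForm D (stVec η) (act P w) = daggerForm D (stVec η) w
      rw [hD.form_pure_left hη, effFun_act, ← hxf, sub_eq_zero.1 h3]
    exact LinearMap.congr_fun (h1 hz) w
  rw [← hinv _ (hrange x) y, hD.form_comm x, ← hinv _ (hrange y) x, hD.form_comm]

end Projectors
end OPT

open OPT in
theorem mainTheorem7 {C : Type u} [Category.{v} C] [MonoidalCategory C] [SymmetricCategory C]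
    [OPTData C] (hC : OPT.IsSharpTheoryWithPurification C) (A : C) :
    (∃! D : OPT.StR A ≃ₗ[ℝ] OPT.EffR A, OPT.IsDagger D) ∧
    ∀ D : OPT.StR A ≃ₗ[ℝ] OPT.EffR A, OPT.IsDagger D →
      OPT.IsSelfDualisingInner (OPT.daggerForm D) ∧
      ∀ (d : ℕ) (α : Fin d → (𝟙_ C ⟶ A)), OPT.IsPureMaximalSet α →
        ∀ (I : Finset (Fin d)) (P : A ⟶ A), OPT.IsProjector D α I P →
          (∀ ρ : 𝟙_ C ⟶ A, OPT.stNorm ρ = 1 →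
            (D (OPT.act P (OPT.stVec ρ)) : Module.Dual ℝ (OPT.StR A)) =
              (D (OPT.stVec ρ) : Module.Dual ℝ (OPT.StR A)) ∘ₗ OPT.act P) ∧
          ∀ ξ η : OPT.StR A,
            OPT.daggerForm D (OPT.act P ξ) η = OPT.daggerForm D ξ (OPT.act P η) := by
  have : Fact (IsSharpTheoryWithPurification C) := ⟨hC⟩
  refine ⟨?_, fun D hD => ⟨hD.isSelfDualisingInner, fun d α hα I P hP => ⟨fun ρ _ => ?_, ?_⟩⟩⟩
  · obtain ⟨D, hD⟩ := exists_isDagger C A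
    exact ⟨D, hD, fun D' hD' => hD'.unique hD⟩
  · exact LinearMap.ext fun η => hP.form_act hD hα (stVec ρ) η
  · exact hP.form_act hD hα
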